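/- Let $G=(V,E)$ be a finite simple graph on $n$ nodes with maximum degree $d_{\max}$, and for $i\in V$ let $B_r(i)$ be the set of nodes at graph distance at most $r$ from $i$ (including $i$). Let $G$ have restricted growth coefficient $\kappa$, i.e. $|B_{r+1}(i)|\le\kappa\,|B_r(i)|$ for all nodes $i$ and all integers $r\ge 1$. Randomized graph cluster randomization (RGCR) with 1-hop-max clustering and treatment probability $p\in(0,1]$ draws an assignment $Z\in\{0,1\}^V$ as follows. First, draw independent $X_j\sim\mathcal U(0,1)$, $j\in V$, and let two nodes $i,i'$ belong to the same cluster if and only if $\max_{j\in B_1(i)}X_j=\max_{j\in B_1(i')}X_j$. Second, given the resulting $K$ clusters, select the treated clusters either by independent randomization (every cluster is treated with probability $p$, independently) or by complete randomization (a uniformly random set of $M$ clusters is treated, where $M=pK$ if $pK$ is an integer, and otherwise $M$ equals $\lfloor pK\rfloor+1$ with probability $pK-\lfloor pK\rfloor$ and $\lfloor pK\rfloor$ otherwise). Finally, $Z_i=1$ if and only if the cluster of $i$ is treated. Let $E_i^{\mathbf 1}=\{z\in\{0,1\}^V: z_j=1 \text{ for all } j\in B_1(i)\}$ be the full-neighborhood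 exposure event of node $i$. Let the response functions $Y_i:\{0,1\}^V\to[0,\bar Y]$ follow the full-neighborhood exposure model: $Y_i$ is constant on $E_i^{\mathbf 1}$. The Horvitz–Thompson estimator of the mean outcome under global treatment is $$\hat\mu_{\mathcal P}(\mathbf 1)=\frac1n\sum_{i\in V}\frac{\mathbf 1[Z\in E_i^{\mathbf 1}]\;Y_i(Z)}{\mathbb P[Z\in E_i^{\mathbf 1}]},$$ where the probability is over both the random clustering and the cluster-level randomization. Then, for both independent and complete cluster-level randomization, $$\operatorname{Var}\big[\hat\mu_{\mathcal P}(\mathbf 1)\big]\le\frac1n\cdot\bar Y^2\,(d_{\max}+1)^2\,\kappa^4\,p^{-1}.$$ -/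

import Mathlib

open MeasureTheory ProbabilityTheory
open scoped ENNReal

/-! Randomized graph cluster randomization (RGCR) on a finite simple graph. -/

namespace RGCR

variable {V : Type*} [Fintype V]

section Graph

open Classical in
/-- The ball `B_r(i)`: all nodes within graph distance `r` of `i`. Distances are extended, so nodes
in other connected components are never included. -/
noncomputable def hopBall (G : SimpleGraph V) (r : ℕ) (i : V) : Finset V :=
  Finset.univ.filter fun j => G.edist i j ≤ r

theorem hopBall_nonempty (G : SimpleGraph V) (r : ℕ) (i : V) : (hopBall G r i).Nonempty :=
  Finset.nonempty_def.2 ⟨i, by simp [hopBall]⟩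

/-- `G` has restricted growth with coefficient `κ`: `|B_{r+1}(i)| ≤ κ |B_r(i)|` for all nodes `i`
and all radii `r ≥ 1`. -/
def RestrictedGrowth (G : SimpleGraph V) (κ : ℝ) : Prop :=
  ∀ (i : V) (r : ℕ), 1 ≤ r → ((hopBall G (r + 1) i).card : ℝ) ≤ κ * (hopBall G r i).card

end Graph

section OneHopMax

/-- The largest number generated in the closed neighbourhood `B_1(i)`. -/
noncomputable def oneHopMax (G : SimpleGraph V) (x : V → ℝ) (i : V) : ℝ :=
  (hopBall G 1 i).sup' (hopBall_nonempty G 1 i) x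

/-- The clustering obtained from the generated numbers `x`: nodes with the same 1-hop maximum form
a cluster. A clustering is a partition of the nodes, given as an equivalence relation. -/
noncomputable def oneHopMaxClustering (G : SimpleGraph V) (x : V → ℝ) : Setoid V :=
  Setoid.ker (oneHopMax G x)

/-- The joint law of independent uniform `(0, 1)` numbers, one for each node. -/
noncomputable def uniformNumbers (V : Type*) [Fintype V] : Measure (V → ℝ) :=
  Measure.pi fun _ => volume.restrict (Set.Ioo (0 : ℝ) 1)

instance : IsProbabilityMeasure (uniformNumbers V) := by
  have : IsProbabilityMeasure ((volume : Measure ℝ).restrict (Set.Ioo (0 : ℝ) 1)) :=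
    ⟨by simp⟩
  unfold uniformNumbers
  infer_instance

theorem measurable_oneHopMax (G : SimpleGraph V) (i : V) :
    Measurable fun x : V → ℝ => oneHopMax G x i := by
  have h := Finset.measurable_sup' (s := hopBall G 1 i) (hopBall_nonempty G 1 i)
    (f := fun j (x : V → ℝ) => x j) (fun j _ => measurable_pi_apply j)
  have e : (fun x : V → ℝ => oneHopMax G x i) =
      (hopBall G 1 i).sup' (hopBall_nonempty G 1 i) (fun j (x : V → ℝ) => x j) := by
    funext x
    rw [Finset.sup'_apply]
    rfl
  rw [e]
  exact h

theorem measurableSet_oneHopMaxClustering_eq (G : SimpleGraph V) (c : Setoid V) :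
    MeasurableSet {x : V → ℝ | oneHopMaxClustering G x = c} := by
  have h : {x : V → ℝ | oneHopMaxClustering G x = c} =
      ⋂ i, ⋂ j, {x : V → ℝ | oneHopMax G x i = oneHopMax G x j ↔ c i j} := by
    ext x
    simp only [Set.mem_ofPred_eq, Set.mem_iInter, oneHopMaxClustering, Setoid.ext_iff,
      Setoid.ker_def]
  rw [h]
  refine MeasurableSet.iInter fun i => MeasurableSet.iInter fun j => ?_
  have e := measurableSet_eq_fun (measurable_oneHopMax G i) (measurable_oneHopMax G j)
  by_cases hc : c i j
  · simpa [hc] using e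
  · have : {x : V → ℝ | oneHopMax G x i = oneHopMax G x j ↔ c i j} =
        {x : V → ℝ | oneHopMax G x i = oneHopMax G x j}ᶜ := by
      ext x
      simp [hc]
    rw [this]
    exact e.compl

/-- The law of the random 1-hop-max clustering of `G`. -/
noncomputable def oneHopMaxLaw (G : SimpleGraph V) : PMF (Setoid V) :=
  ⟨fun c => uniformNumbers V {x | oneHopMaxClustering G x = c}, by
    have hfin : Finite (Setoid V) :=
      Finite.of_injective (fun (c : Setoid V) (i j : V) => c i j)
        fun a b h => Setoid.ext fun i j => iff_of_eq (congrFun (congrFun h i) j)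
    have hU : (⋃ c : Setoid V, {x : V → ℝ | oneHopMaxClustering G x = c}) = Set.univ := by
      ext x; simp
    have h := measure_iUnion (μ := uniformNumbers V)
      (f := fun c : Setoid V => {x : V → ℝ | oneHopMaxClustering G x = c})
      (fun a b hab => Set.disjoint_left.2 fun x hx hy => hab (hx.symm.trans hy))
      (measurableSet_oneHopMaxClustering_eq G)
    rw [hU, measure_univ] at h
    rw [h]
    exact ENNReal.summable.hasSum⟩

end OneHopMax

section Randomization

open Classical in
/-- Independent randomization of a finite set of clusters: every cluster is treated with
probability `p`, independently of the others. The outcome is the set of treated clusters. -/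
noncomputable def independentRandomization (p : unitInterval) (C : Type*) [Fintype C] :
    PMF (Finset C) :=
  PMF.ofFintype
    (fun T => ENNReal.ofReal p ^ T.card *
      ENNReal.ofReal (1 - p) ^ (Fintype.card C - T.card))
    (by
      rw [Fintype.sum_pow_mul_eq_add_pow,
        ← ENNReal.ofReal_add p.2.1 (sub_nonneg.2 p.2.2)]
      simp)

/-- The law of the randomized rounding of `t ≥ 0` to one of the two neighbouring integers with
mean `t`: the value is `⌊t⌋ + 1` with probability `t - ⌊t⌋` and `⌊t⌋` otherwise. If `t` is an
integer, the value is `t`. -/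
noncomputable def roundingProb (t : ℝ) (m : ℕ) : ℝ :=
  if m = ⌊t⌋₊ then 1 - (t - ⌊t⌋₊) else if m = ⌊t⌋₊ + 1 then t - ⌊t⌋₊ else 0

theorem roundingProb_nonneg {t : ℝ} (ht : 0 ≤ t) (m : ℕ) : 0 ≤ roundingProb t m := by
  have h1 := Nat.floor_le ht
  have h2 := Nat.lt_floor_add_one t
  unfold roundingProb
  split_ifs <;> linarith

theorem sum_roundingProb {t : ℝ} (ht : 0 ≤ t) {K : ℕ} (hK : t ≤ K) :
    ∑ m ∈ Finset.range (K + 1), roundingProb t m = 1 := by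
  have hf : ⌊t⌋₊ ≤ K := Nat.floor_le_of_le hK
  have h : ∀ m, roundingProb t m = (if m = ⌊t⌋₊ then 1 - (t - ⌊t⌋₊) else 0) +
      (if m = ⌊t⌋₊ + 1 then t - ⌊t⌋₊ else 0) := by
    intro m
    unfold roundingProb
    split_ifs <;> first | omega | simp
  simp only [h, Finset.sum_add_distrib, Finset.sum_ite_eq', Finset.mem_range]
  rw [if_pos (by omega)]
  split_ifs with h2
  · ring
  · have : ⌊t⌋₊ = K := by omega
    have h1 := Nat.floor_le ht
    rw [this] at h1 ⊢
    linarith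

open Classical in
/-- Complete randomization of a finite set of `K` clusters with treatment probability `p`: the
number `M` of treated clusters is `p K` (randomly rounded to a neighbouring integer with mean
`p K` if `p K` is not an integer), and given `M` the set of treated clusters is uniformly
distributed over all sets of `M` clusters. -/
noncomputable def completeRandomization (p : unitInterval) (C : Type*) [Fintype C] :
    PMF (Finset C) :=
  PMF.ofFintype
    (fun T => ENNReal.ofReal
      (roundingProb (p * Fintype.card C) T.card / (Fintype.card C).choose T.card))
    (by
      have h0 : (0 : ℝ) ≤ p * Fintype.card C := mul_nonneg p.2.1 (Nat.cast_nonneg _)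
      rw [← ENNReal.ofReal_sum_of_nonneg
        fun T _ => div_nonneg (roundingProb_nonneg h0 _) (Nat.cast_nonneg _)]
      have h := Finset.sum_powerset_apply_card
        (fun m => roundingProb (p * Fintype.card C) m / ((Fintype.card C).choose m : ℝ))
        (x := (Finset.univ : Finset C))
      rw [Finset.powerset_univ, Finset.card_univ] at h
      rw [h, ← ENNReal.ofReal_one]
      congr 1
      rw [← sum_roundingProb h0 (K := Fintype.card C)
        (mul_le_of_le_one_left (Nat.cast_nonneg _) p.2.2)]
      refine Finset.sum_congr rfl fun m hm => ?_
      have hc : ((Fintype.card C).choose m : ℝ) ≠ 0 := by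
        have := Nat.choose_pos (Nat.lt_succ_iff.1 (Finset.mem_range.1 hm))
        positivity
      rw [nsmul_eq_mul]
      field_simp)

open Classical in
/-- The law of the assignment `Z` (`true` is treatment) under RGCR: draw a clustering from `P`,
then a set of treated clusters with the given cluster-level randomization, and treat exactly the
nodes of the treated clusters. -/
noncomputable def design (P : PMF (Setoid V))
    (R : (C : Type _) → [Fintype C] → PMF (Finset C)) : PMF (V → Bool) :=
  P.bind fun c => (R (Quotient c)).map fun T i => decide (Quotient.mk c i ∈ T)

end Randomization

section Estimator

/-- The full-neighbourhood exposure event `E_i^1`: node `i` and all its neighbours are treated. -/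
def exposed (G : SimpleGraph V) (i : V) : Set (V → Bool) :=
  {z | ∀ j ∈ hopBall G 1 i, z j = true}

/-- The full-neighbourhood exposure model for the response functions `Y i z`: the response of a
node is the same under all assignments in which it is exposed to treatment. -/
def ExposureModel (G : SimpleGraph V) (Y : V → (V → Bool) → ℝ) : Prop :=
  ∀ (i : V) (z z' : V → Bool), z ∈ exposed G i → z' ∈ exposed G i → Y i z = Y i z'

/-- The Horvitz-Thompson estimator of the mean outcome `μ(1)` under the design `D`, as a function of
the realized assignment `z`. -/
noncomputable def htMean (G : SimpleGraph V) (D : PMF (V → Bool)) (Y : V → (V → Bool) → ℝ)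
    (z : V → Bool) : ℝ :=
  (1 / (Fintype.card V : ℝ)) *
    ∑ i, (exposed G i).indicator (fun z => Y i z / D.toMeasure.real (exposed G i)) z

/-- The variance of the Horvitz-Thompson mean-outcome estimator when the assignment is drawn from
the design `D`. -/
noncomputable def htVariance (G : SimpleGraph V) (D : PMF (V → Bool))
    (Y : V → (V → Bool) → ℝ) : ℝ :=
  variance (htMean G D Y) D.toMeasure

end Estimator

end RGCR

/-!
Write `N = κ (d_max + 1)`, a bound for the sizes of the 2-hop balls `B_2(i)`, and `P i` for the
exposure probability of node `i` and `P i j` for the probability that `i` and `j` are both exposed.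
Expanding the variance of the Horvitz-Thompson estimator into covariances of the exposure indicators
gives `Var ≤ (Ybar / n) ^ 2 ∑ U i j` for all `U i j ≥ 0` that bound the normalized covariances
`P i j / (P i P j) - 1` (`htVariance_le`). So it suffices that `∑ U i j ≤ n κ ^ 2 N ^ 2 / p`.

Given the numbers `x`, the exposure of a set of nodes is the event that all clusters meeting its
1-hop neighbourhood are treated, and its probability is `Q K a`, where `K` is the number of clusters
and `a` the number of those that are met (`design_real_eq_treatProb`). A node that has the largest
number in its 2-hop ball, a local maximum, has `a = 1`; by symmetry this has probability
`1 / |B_2(i)|`, so `P i ≥ p / N`. Pairs with `j ∉ B_4(i)` are called far, the others near. For far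
pairs almost surely no cluster meets both 1-hop balls, and the numbers of clusters they meet are
independent, because they depend on the numbers in the disjoint balls `B_2(i)` and `B_2(j)`.

*Independent randomization.* Here `Q K a = p ^ a`, so far pairs are uncorrelated. Near pairs have
`P i j ≤ P i`, hence normalized covariance at most `N / p`, and there are at most `n κ ^ 2 N` of
them (`exists_bound_independent`).

*Complete randomization.* Now `Q K a` is a mean of ratios of falling factorials. The treatment
indicators of different clusters are negatively associated, `Q K (a + b) ≤ Q K a * Q K b`
(`completeProb_add_le`). Yet far pairs can be positively correlated, because both exposure
probabilities depend on the common random number `K`. They are controlled through the deficit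
`p ^ a - Q K a`, which is of order `1 / K` (`mul_deficit_le`), while the 1-hop balls together meet
at most `N K` clusters (`sum_clusterHits_le`). So the deficits of all nodes have a bounded sum
(`sum_deficit_le`), and replacing each conditional exposure probability by a local upper bound, for
which far nodes are independent, costs little. Where the ball meets at least `A` clusters, for a
cutoff `A` depending on `p` and on the least number of clusters, the deficit is not small relative
to the probability, but there the probability itself is at most `p ^ A` (`far_pair_le_farTerm`). The
existence of a good cutoff is a numerical matter (`le_or_exists_isCutoff`). In all, far pairs
contribute at most `3 / 4` of `n N ^ 2 / p`, and at most `0.69` of it if `κ ≥ 5 / 4`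
(`exists_far_bound`).

This is made up for by the near pairs, since two nodes within distance two are not both local
maxima. If `G` is a disjoint union of cliques, then all `P i` are `p` and no far pair is positively
correlated. Otherwise `κ ≥ 1 + 1 / (d_max + 1)`. If moreover all 2-hop balls are components, then at
most one node of a component is a local maximum and near pairs contribute at most about
`n N ^ 2 / (4 p)` (`exists_near_bound_of_component`). In the remaining case two nodes are at
distance three, whence `κ ^ 3 ≥ 2`, and near pairs contribute about half of the trivial bound
(`exists_near_bound`).
-/

namespace RGCR

/-! ### Treatment probabilities under complete randomization -/

/-- `E (M)_l`, where `(M)_l = M (M - 1) ⋯ (M - l + 1)` and `M` is `m + 1` with probability `f` and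
`m` otherwise. -/
noncomputable def mixedDescFactorial (m : ℕ) (f : ℝ) (l : ℕ) : ℝ :=
  (1 - f) * m.descFactorial l + f * (m + 1).descFactorial l

/-- The probability that `a` given clusters out of `K` are all treated under complete
randomization. -/
noncomputable def completeProb (p : ℝ) (K a : ℕ) : ℝ :=
  ∑ m ∈ Finset.range (K + 1),
    roundingProb (p * K) m * ((m.descFactorial a : ℝ) / K.descFactorial a)

theorem cast_descFactorial_succ (n l : ℕ) :
    ((n.descFactorial (l + 1) : ℕ) : ℝ) = ((n : ℝ) - l) * n.descFactorial l := by
  rw [Nat.descFactorial_succ]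
  rcases le_or_gt l n with h | h
  · push_cast [Nat.cast_sub h]; ring
  · rw [Nat.descFactorial_of_lt h]; simp

theorem cast_succ_descFactorial (n l : ℕ) :
    ((n : ℝ) + 1 - l) * (n + 1).descFactorial l = (n + 1) * n.descFactorial l := by
  rcases le_or_gt l (n + 1) with h | h
  · have := Nat.succ_descFactorial n l
    have h2 : ((n + 1 - l : ℕ) : ℝ) = (n : ℝ) + 1 - l := by push_cast [Nat.cast_sub h]; ring
    rw [← h2]
    exact_mod_cast this
  · rw [Nat.descFactorial_of_lt h, Nat.descFactorial_of_lt (by omega)]; simp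

theorem mixedDescFactorial_succ (m : ℕ) (f : ℝ) (l : ℕ) :
    mixedDescFactorial m f (l + 1) = (m + 1 - (1 - f) * (l + 1)) * m.descFactorial l := by
  have h := cast_succ_descFactorial m l
  unfold mixedDescFactorial
  rw [cast_descFactorial_succ, cast_descFactorial_succ]
  push_cast
  linear_combination f * h

theorem mixedDescFactorial_mul (m : ℕ) (f : ℝ) (l : ℕ) :
    mixedDescFactorial m f l * (m + 1 - l) = (m + 1 - (1 - f) * l) * m.descFactorial l := by
  have h := cast_succ_descFactorial m l
  unfold mixedDescFactorial
  linear_combination f * h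

theorem mixedDescFactorial_nonneg {m : ℕ} {f : ℝ} (h0 : 0 ≤ f) (h1 : f ≤ 1) (l : ℕ) :
    0 ≤ mixedDescFactorial m f l := by
  have : 0 ≤ 1 - f := by linarith
  unfold mixedDescFactorial; positivity

/-- The ratio of consecutive mixed falling factorials, compared with `(m + f) (1 - l / L)`. -/
theorem mixedDescFactorial_succ_mul_le {m : ℕ} {f L : ℝ} (h0 : 0 ≤ f) (h1 : f ≤ 1)
    (hL : (m : ℝ) + 1 ≤ L) {l : ℕ} (hl : (l : ℝ) ≤ L) :
    mixedDescFactorial m f (l + 1) * L ≤ (m + f) * (L - l) * mixedDescFactorial m f l := by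
  have hm : (0 : ℝ) ≤ m := Nat.cast_nonneg m
  have hl0 : (0 : ℝ) ≤ l := Nat.cast_nonneg l
  rcases le_or_gt l m with h | h
  · have hX : (0 : ℝ) ≤ m.descFactorial l := Nat.cast_nonneg _
    have h' : (l : ℝ) ≤ m := by exact_mod_cast h
    have hpos : (0 : ℝ) < m + 1 - l := by linarith
    refine le_of_mul_le_mul_right ?_ hpos
    have e1 := mixedDescFactorial_succ m f l
    have e2 := mixedDescFactorial_mul m f l
    have key : L * (m + 1 - l) * (m + 1 - (1 - f) * (l + 1)) ≤
        (m + f) * (L - l) * (m + 1 - (1 - f) * l) := by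
      have hG : 0 ≤ ((m : ℝ) + 1 - (1 - f) * l) := by nlinarith
      have a1 : ((m : ℝ) + 1) * (m + 1 - (1 - f) * (l + 1)) ≤ (m + f) * (m + 1 - (1 - f) * l) := by
        nlinarith [mul_nonneg (mul_nonneg (sub_nonneg.2 h1) (sub_nonneg.2 h1)) hl0]
      have a2 : ((m : ℝ) + 1 - l) * (m + 1 - (1 - f) * (l + 1)) ≤
          (m + f) * (m + 1 - (1 - f) * l) := by
        have : 0 ≤ ((m : ℝ) + 1 - (1 - f) * (l + 1)) := by nlinarith
        nlinarith
      nlinarith [mul_le_mul_of_nonneg_left a1 hpos.le,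
        mul_le_mul_of_nonneg_left a2 (sub_nonneg.2 hL)]
    calc mixedDescFactorial m f (l + 1) * L * (m + 1 - l)
        = L * (m + 1 - l) * (m + 1 - (1 - f) * (l + 1)) * m.descFactorial l := by rw [e1]; ring
      _ ≤ (m + f) * (L - l) * (m + 1 - (1 - f) * l) * m.descFactorial l :=
          mul_le_mul_of_nonneg_right key hX
      _ = _ := by rw [mul_assoc _ (mixedDescFactorial m f l), e2]; ring
  · rw [mixedDescFactorial_succ, Nat.descFactorial_of_lt h]
    have := mixedDescFactorial_nonneg (m := m) h0 h1 l
    have h3 : 0 ≤ L - l := by linarith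
    have : 0 ≤ (m + f) * (L - l) * mixedDescFactorial m f l := by positivity
    simpa using this

/-- The lower bound `m + f - l` for the ratio of consecutive mixed falling factorials. -/
theorem mixedDescFactorial_mul_le_succ {m : ℕ} {f : ℝ} (h0 : 0 ≤ f) (h1 : f ≤ 1) (l : ℕ) :
    (m + f - l) * mixedDescFactorial m f l ≤ mixedDescFactorial m f (l + 1) := by
  have h : ((m.descFactorial l : ℕ) : ℝ) ≤ (m + 1).descFactorial l := by
    exact_mod_cast Nat.descFactorial_le l (Nat.le_succ m)
  unfold mixedDescFactorial
  rw [cast_descFactorial_succ, cast_descFactorial_succ]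
  push_cast
  nlinarith [mul_nonneg (mul_nonneg h0 (sub_nonneg.2 h1)) (sub_nonneg.2 h)]

section

variable {p : ℝ} {K : ℕ}

theorem floor_lt_of_lt_one (h0 : 0 ≤ p) (h1 : p < 1) (hK : 0 < K) : ⌊p * K⌋₊ < K := by
  have hK' : (0 : ℝ) < K := by exact_mod_cast hK
  rw [Nat.floor_lt (by positivity)]
  nlinarith

theorem completeProb_eq (h0 : 0 ≤ p) (h1 : p < 1) (hK : 0 < K) (a : ℕ) :
    completeProb p K a =
      mixedDescFactorial ⌊p * K⌋₊ (p * K - ⌊p * K⌋₊) a / K.descFactorial a := by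
  have hf := floor_lt_of_lt_one h0 h1 hK
  have h : ∀ m, roundingProb (p * K) m =
      (if m = ⌊p * K⌋₊ then 1 - (p * K - ⌊p * K⌋₊) else 0) +
      (if m = ⌊p * K⌋₊ + 1 then p * K - ⌊p * K⌋₊ else 0) := by
    intro m
    unfold roundingProb
    split_ifs <;> first | omega | simp
  unfold completeProb mixedDescFactorial
  simp only [h, add_mul, Finset.sum_add_distrib, ite_mul, zero_mul, Finset.sum_ite_eq',
    Finset.mem_range]
  rw [if_pos (by omega), if_pos (by omega)]
  ring

theorem floor_add_fract (h0 : 0 ≤ p) : 0 ≤ p * K - ⌊p * K⌋₊ ∧ p * K - ⌊p * K⌋₊ ≤ 1 := by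
  have := Nat.floor_le (show 0 ≤ p * K by positivity)
  have := Nat.lt_floor_add_one (p * K)
  constructor <;> linarith

theorem descFactorial_cast_pos {K a : ℕ} (ha : a ≤ K) : (0 : ℝ) < K.descFactorial a := by
  have : K.descFactorial a ≠ 0 := by
    rw [Ne, Nat.descFactorial_eq_zero_iff_lt]; omega
  positivity

theorem completeProb_nonneg (h0 : 0 ≤ p) (K a : ℕ) : 0 ≤ completeProb p K a := by
  unfold completeProb
  exact Finset.sum_nonneg fun m _ => mul_nonneg (roundingProb_nonneg (by positivity) m)
    (by positivity)

theorem completeProb_zero (h0 : 0 ≤ p) (h1 : p < 1) (hK : 0 < K) : completeProb p K 0 = 1 := by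
  rw [completeProb_eq h0 h1 hK]; simp [mixedDescFactorial]

theorem completeProb_one (h0 : 0 ≤ p) (h1 : p < 1) (hK : 0 < K) : completeProb p K 1 = p := by
  rw [completeProb_eq h0 h1 hK]
  have : (K : ℝ) ≠ 0 := by positivity
  simp [mixedDescFactorial]
  field_simp
  ring

/-- Negative association of the treatment indicators of different clusters. -/
theorem completeProb_add_le (h0 : 0 ≤ p) (h1 : p < 1) {a b : ℕ} (hab : a + b ≤ K) :
    completeProb p K (a + b) ≤ completeProb p K a * completeProb p K b := by
  rcases Nat.eq_zero_or_pos K with rfl | hK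
  · obtain ⟨rfl, rfl⟩ : a = 0 ∧ b = 0 := by omega
    simp [completeProb, roundingProb]
  obtain ⟨f0, f1⟩ := floor_add_fract (K := K) h0
  have hm := floor_lt_of_lt_one h0 h1 hK
  simp only [completeProb_eq h0 h1 hK]
  set m := ⌊p * K⌋₊
  set f := p * K - m
  have hmK : (m : ℝ) + 1 ≤ K := by exact_mod_cast hm
  have hm0 : (0 : ℝ) ≤ m := Nat.cast_nonneg m
  induction b with
  | zero => simp [mixedDescFactorial]
  | succ b ih =>
    have ih := ih (by omega)
    have hb0 : (0 : ℝ) ≤ b := Nat.cast_nonneg b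
    have ha0 : (0 : ℝ) ≤ a := Nat.cast_nonneg a
    have hE := fun l => mixedDescFactorial_nonneg (m := m) f0 f1 l
    rcases Nat.lt_or_ge m (a + b) with h | h
    · rw [← add_assoc, mixedDescFactorial_succ, Nat.descFactorial_of_lt h]
      have := hE a
      have := hE (b + 1)
      simp only [Nat.cast_zero, mul_zero, zero_div]
      positivity
    · have habK : ((a + b : ℕ) : ℝ) + 1 ≤ K := by exact_mod_cast hab
      have habm : ((a + b : ℕ) : ℝ) ≤ m := by exact_mod_cast h
      push_cast at habK habm
      -- the ratio of consecutive terms is `(m + 1 - l) G (l + 1) / (G l (K - l))`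
      -- with `G l = m + 1 - (1 - f) * l`
      have ratio : ∀ l : ℕ, (l : ℝ) ≤ m → (l : ℝ) + 1 ≤ K →
          mixedDescFactorial m f (l + 1) / K.descFactorial (l + 1) =
          mixedDescFactorial m f l / K.descFactorial l *
            (((m + 1 - l) / (K - l)) * ((m + 1 - (1 - f) * (l + 1)) / (m + 1 - (1 - f) * l))) := by
        intro l hl hlK
        have hl0 : (0 : ℝ) ≤ l := Nat.cast_nonneg l
        have hG : 0 < ((m : ℝ) + 1 - (1 - f) * l) := by nlinarith
        have hKl : (0 : ℝ) < K - l := by linarith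
        have hD := descFactorial_cast_pos (K := K) (a := l) (by
          have : (l : ℝ) ≤ K := by linarith
          exact_mod_cast this)
        rw [cast_descFactorial_succ, mixedDescFactorial_succ]
        have e2 := mixedDescFactorial_mul m f l
        field_simp
        linear_combination (-1 : ℝ) * (m + 1 - (1 - f) * (l + 1)) * e2
      rw [← add_assoc, ratio (a + b) (by push_cast; linarith) (by push_cast; linarith),
        ratio b (by linarith) (by linarith)]
      have hG1 : 0 < ((m : ℝ) + 1 - (1 - f) * b) := by nlinarith
      have hG2 : 0 < ((m : ℝ) + 1 - (1 - f) * (a + b)) := by nlinarith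
      have hN : 0 ≤ ((m : ℝ) + 1 - (1 - f) * (a + b + 1)) := by nlinarith
      have hD := descFactorial_cast_pos (K := K) (a := a) (by omega)
      have hD' := descFactorial_cast_pos (K := K) (a := b) (by omega)
      refine (mul_le_mul ih (d := ((m + 1 - b) / (K - b)) *
        ((m + 1 - (1 - f) * (b + 1)) / (m + 1 - (1 - f) * b))) ?_ ?_ ?_).trans_eq (mul_assoc _ _ _)
      · push_cast
        refine mul_le_mul ?_ ?_ ?_ ?_
        · rw [div_le_div_iff₀ (by linarith) (by linarith)]
          nlinarith
        · rw [div_le_div_iff₀ hG2 hG1]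
          nlinarith [mul_nonneg (mul_nonneg (sub_nonneg.2 f1) (sub_nonneg.2 f1)) ha0]
        · exact div_nonneg hN hG2.le
        · exact div_nonneg (by linarith) (by linarith)
      · push_cast
        exact mul_nonneg (div_nonneg (by linarith) (by linarith)) (div_nonneg hN hG2.le)
      · have := hE a
        have := hE b
        positivity

theorem completeProb_succ_le (h0 : 0 ≤ p) (h1 : p < 1) {l : ℕ} (hl : l < K) :
    completeProb p K (l + 1) ≤ p * completeProb p K l := by
  have := completeProb_add_le h0 h1 (K := K) (a := l) (b := 1) (by omega)
  rw [completeProb_one h0 h1 (by omega)] at this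
  linarith

theorem completeProb_le_pow (h0 : 0 ≤ p) (h1 : p < 1) {a : ℕ} (ha : a ≤ K) (hK : 0 < K) :
    completeProb p K a ≤ p ^ a := by
  induction a with
  | zero => simp [completeProb_zero h0 h1 hK]
  | succ a ih =>
    have := ih (by omega)
    rw [pow_succ']
    exact (completeProb_succ_le h0 h1 (by omega)).trans (mul_le_mul_of_nonneg_left this h0)

/-- The deficit that one more cluster adds, relative to the independent randomization. -/
theorem mul_completeProb_sub_succ_le (h0 : 0 ≤ p) (h1 : p < 1) {l : ℕ} (hl : l < K) :
    p * completeProb p K l - completeProb p K (l + 1) ≤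
      completeProb p K l * (l * (1 - p) / (K - l)) := by
  have hK : 0 < K := by omega
  obtain ⟨f0, f1⟩ := floor_add_fract (K := K) h0
  have hlK : (l : ℝ) < K := by exact_mod_cast hl
  simp only [completeProb_eq h0 h1 hK]
  have key := mixedDescFactorial_mul_le_succ (m := ⌊p * K⌋₊) f0 f1 l
  have hD := descFactorial_cast_pos (K := K) (a := l) hl.le
  have hKl : (0 : ℝ) < K - l := by linarith
  rw [cast_descFactorial_succ]
  generalize mixedDescFactorial ⌊p * K⌋₊ (p * K - ⌊p * K⌋₊) l = E at *
  generalize mixedDescFactorial ⌊p * K⌋₊ (p * K - ⌊p * K⌋₊) (l + 1) = E' at *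
  have e : p * (E / K.descFactorial l) - E' / ((K - l) * K.descFactorial l) -
      E / K.descFactorial l * (l * (1 - p) / (K - l)) =
      ((p * K - l) * E - E') / ((K - l) * K.descFactorial l) := by
    field_simp
    ring
  have : ((p * K - l) * E - E') / ((K - l) * K.descFactorial l) ≤ 0 :=
    div_nonpos_of_nonpos_of_nonneg (by
      have : (⌊p * K⌋₊ : ℝ) + (p * K - ⌊p * K⌋₊) - l = p * K - l := by ring
      rw [this] at key; linarith) (by positivity)
  linarith

/-- The union bound for the event that some of the `a` clusters is not treated. -/
theorem one_sub_le_completeProb (h0 : 0 ≤ p) (h1 : p < 1) {a : ℕ} (ha : a ≤ K) (hK : 0 < K) :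
    1 - (1 - p) * a ≤ completeProb p K a := by
  induction a with
  | zero => simp [completeProb_zero h0 h1 hK]
  | succ l ih =>
    have ih := ih (by omega)
    have step : completeProb p K l - completeProb p K (l + 1) ≤ 1 - p := by
      obtain ⟨n, rfl⟩ : ∃ n, K = n + 1 := ⟨K - 1, by omega⟩
      obtain ⟨f0, f1⟩ := floor_add_fract (K := n + 1) h0
      have hm := floor_lt_of_lt_one h0 h1 hK
      simp only [completeProb_eq h0 h1 hK]
      obtain ⟨m, hmdef⟩ : ∃ m, m = ⌊p * ((n + 1 : ℕ) : ℝ)⌋₊ := ⟨_, rfl⟩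
      rw [← hmdef] at f0 f1 hm ⊢
      obtain ⟨f, hf⟩ : ∃ f, f = p * ((n + 1 : ℕ) : ℝ) - m := ⟨_, rfl⟩
      rw [← hf] at f0 f1 ⊢
      have hlK : (l : ℝ) + 1 ≤ (n + 1 : ℕ) := by exact_mod_cast ha
      have hD := descFactorial_cast_pos (K := n + 1) (a := l) (by omega)
      have hKl : (0 : ℝ) < (n + 1 : ℕ) - l := by linarith
      have hs := cast_succ_descFactorial n l
      have b1 : ((m.descFactorial l : ℕ) : ℝ) ≤ n.descFactorial l := by
        exact_mod_cast Nat.descFactorial_le l (by omega)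
      have b2 : ((n : ℝ) - m) * ((m + 1).descFactorial l : ℕ) ≤ (n - m) * n.descFactorial l := by
        rcases Nat.lt_or_ge m n with h | h
        · have : (m : ℝ) ≤ n := by exact_mod_cast h.le
          refine mul_le_mul_of_nonneg_left ?_ (by linarith)
          exact_mod_cast Nat.descFactorial_le l h
        · have : m = n := by omega
          subst this; simp
      have hmn : (m : ℝ) ≤ n := by exact_mod_cast (show m ≤ n by omega)
      have e : mixedDescFactorial m f l / (n + 1).descFactorial l -
          mixedDescFactorial m f (l + 1) / (n + 1).descFactorial (l + 1) =
          ((1 - f) * (n + 1 - m) * m.descFactorial l + f * ((n - m) * (m + 1).descFactorial l)) /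
            ((n + 1) * n.descFactorial l) := by
        rw [← hs, cast_descFactorial_succ]
        unfold mixedDescFactorial
        rw [cast_descFactorial_succ, cast_descFactorial_succ]
        push_cast at hKl ⊢
        have : (n : ℝ) + 1 - l ≠ 0 := hKl.ne'
        field_simp
        ring
      have hDn : (0 : ℝ) < n.descFactorial l := descFactorial_cast_pos (by omega)
      rw [e, div_le_iff₀ (by positivity)]
      have hp : (1 - p) * (n + 1) = (1 - f) * (n + 1 - m) + f * (n - m) := by
        rw [hf]; push_cast; ring
      rw [← mul_assoc (1 - p), hp]
      nlinarith [mul_le_mul_of_nonneg_left b1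
        (mul_nonneg (sub_nonneg.2 f1) (show (0 : ℝ) ≤ n + 1 - m by linarith)),
        mul_le_mul_of_nonneg_left b2 f0]
    push_cast
    linarith

/-- Since `(K)_l (K - l) / K = (K - 1)_l`, the left side is `E (M)_l / (K - 1)_l`, a product of `l`
ratios, each of which is at most `p K / (K - 1)`. -/
theorem completeProb_mul_div_le_pow (h0 : 0 ≤ p) (h1 : p < 1) (hq : 1 < (1 - p) * K) {l : ℕ}
    (hl : l < K) : completeProb p K l * (K / (K - l)) ≤ (p * K / (K - 1)) ^ l := by
  have hK : 0 < K := by omega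
  obtain ⟨f0, f1⟩ := floor_add_fract (K := K) h0
  obtain ⟨n, rfl⟩ : ∃ n, K = n + 1 := ⟨K - 1, by omega⟩
  have hKl : (0 : ℝ) < n + 1 - l := by
    have : (l : ℝ) < (n + 1 : ℕ) := by exact_mod_cast hl
    push_cast at this; linarith
  have hfl := Nat.floor_le (show 0 ≤ p * ((n + 1 : ℕ) : ℝ) by positivity)
  have hmn : (⌊p * ((n + 1 : ℕ) : ℝ)⌋₊ : ℝ) + 1 ≤ n := by
    have : (⌊p * ((n + 1 : ℕ) : ℝ)⌋₊ : ℝ) < n := by push_cast at *; linarith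
    have : ⌊p * ((n + 1 : ℕ) : ℝ)⌋₊ < n := by exact_mod_cast this
    exact_mod_cast this
  rw [completeProb_eq h0 h1 hK]
  have e : ∀ E : ℝ, E / ((n + 1).descFactorial l : ℕ) * (((n + 1 : ℕ) : ℝ) / ((n + 1 : ℕ) - l)) =
      E / n.descFactorial l := by
    intro E
    have hs := cast_succ_descFactorial n l
    have hD := descFactorial_cast_pos (K := n + 1) (a := l) hl.le
    have hDn : (0 : ℝ) < n.descFactorial l := descFactorial_cast_pos (by omega)
    push_cast
    field_simp
    linear_combination (-E) * hs
  rw [e]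
  have hpK : (⌊p * ((n + 1 : ℕ) : ℝ)⌋₊ : ℝ) + (p * ((n + 1 : ℕ) : ℝ) - ⌊p * ((n + 1 : ℕ) : ℝ)⌋₊) =
      p * ((n + 1 : ℕ) : ℝ) := by ring
  have hn0 : (0 : ℝ) < n := by
    have : (0 : ℝ) ≤ ⌊p * ((n + 1 : ℕ) : ℝ)⌋₊ := Nat.cast_nonneg _
    linarith
  have hy : (0 : ℝ) ≤ p * ((n + 1 : ℕ) : ℝ) / n := by positivity
  push_cast only [Nat.cast_add, Nat.cast_one, add_sub_cancel_right] at *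
  clear e hq hKl
  induction l with
  | zero => simp [mixedDescFactorial]
  | succ l ih =>
    have ih := ih (by omega)
    have hln : (l : ℝ) + 1 ≤ n := by exact_mod_cast (show l + 1 ≤ n by omega)
    have st := mixedDescFactorial_succ_mul_le f0 f1 hmn (l := l) (by linarith)
    rw [hpK] at st
    have hDn : (0 : ℝ) < n.descFactorial l := descFactorial_cast_pos (by omega)
    rw [cast_descFactorial_succ, pow_succ']
    refine le_trans ?_ (mul_le_mul_of_nonneg_left ih hy)
    rw [div_mul_div_comm, div_le_div_iff₀ (by nlinarith) (by positivity)]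
    nlinarith

end

/-! ### The deficit of complete against independent randomization -/

theorem one_sub_pow_le_bonferroni {q : ℝ} (h0 : 0 ≤ q) (h1 : q ≤ 1) (a : ℕ) :
    (1 - q) ^ a ≤ 1 - q * a + a * (a - 1) / 2 * q ^ 2 := by
  induction a with
  | zero => simp
  | succ a ih =>
    have ha : (0 : ℝ) ≤ a := Nat.cast_nonneg a
    have hC : (0 : ℝ) ≤ a * (a - 1) := by
      rcases Nat.eq_zero_or_pos a with rfl | h
      · simp
      · have : (1 : ℝ) ≤ a := by exact_mod_cast h
        exact mul_nonneg ha (by linarith)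
    rw [pow_succ]
    push_cast
    nlinarith [mul_le_mul_of_nonneg_right ih (sub_nonneg.2 h1),
      mul_nonneg hC (pow_nonneg h0 3)]

/-- The deficit `p ^ a - Q K a` is of order `1 / K`: the bound that all estimates of the complete
randomization rest on. -/
theorem mul_deficit_le {p : ℝ} {K : ℕ} (h0 : 0 ≤ p) (h1 : p < 1) {m : ℕ} (hm : m + 1 ≤ K)
    (hK : 2 ≤ K) :
    K * (p ^ (m + 1) - completeProb p K (m + 1)) ≤
      (1 - p) / 2 * (m + 1) * m * (p * K / (K - 1)) ^ m := by
  have hK2 : (2 : ℝ) ≤ K := by exact_mod_cast hK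
  have hq : 0 < 1 - p := by linarith
  -- Induction over `m` sums the deficits of the single steps. It needs an expected number of more
  -- than one untreated cluster; otherwise the base `p K / (K - 1)` is at least `1` and the
  -- inequalities of Bonferroni suffice.
  rcases lt_or_ge 1 ((1 - p) * K) with hc | hc
  · induction m with
    | zero => simp [completeProb_one h0 h1 (show 0 < K by omega)]
    | succ m ih =>
      have ih := ih (by omega)
      have hmK : (m : ℝ) + 1 < K := by exact_mod_cast (show m + 1 < K by omega)
      have hm0 : (0 : ℝ) ≤ m := Nat.cast_nonneg m
      have e1 := mul_completeProb_sub_succ_le h0 h1 (show m + 1 < K by omega)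
      have e2 := completeProb_mul_div_le_pow h0 h1 hc (show m + 1 < K by omega)
      push_cast at e1 e2 ⊢
      have hpy : p ≤ p * K / (K - 1) := by
        rw [le_div_iff₀ (by linarith)]; nlinarith
      have hy0 : 0 ≤ p * K / (K - 1) := h0.trans hpy
      generalize p * K / (K - 1) = y at *
      generalize completeProb p K (m + 1) = Q at *
      generalize completeProb p K (m + 1 + 1) = Q' at *
      have hKm : (0 : ℝ) < K - (m + 1) := by linarith
      have e3 : K * (Q * ((m + 1) * (1 - p) / (K - (m + 1)))) ≤
          (m + 1) * (1 - p) * y ^ (m + 1) := by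
        calc K * (Q * ((m + 1) * (1 - p) / (K - (m + 1))))
            = (m + 1) * (1 - p) * (Q * (K / (K - (m + 1)))) := by field_simp
          _ ≤ _ := mul_le_mul_of_nonneg_left e2 (by positivity)
      have e4 : p * ((1 - p) / 2 * (m + 1) * m * y ^ m) ≤ y * ((1 - p) / 2 * (m + 1) * m * y ^ m) :=
        mul_le_mul_of_nonneg_right hpy (by positivity)
      have e5 : K * (p ^ (m + 1 + 1) - Q') = p * (K * (p ^ (m + 1) - Q)) + K * (p * Q - Q') := by
        ring
      rw [e5]
      have e6 := mul_le_mul_of_nonneg_left ih h0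
      have e7 := mul_le_mul_of_nonneg_left e1 (show (0 : ℝ) ≤ K by linarith)
      have e8 : y * ((1 - p) / 2 * (m + 1) * m * y ^ m) + (m + 1) * (1 - p) * y ^ (m + 1) =
          (1 - p) / 2 * (m + 1 + 1) * (m + 1) * y ^ (m + 1) := by ring
      linarith
  · have b1 := one_sub_le_completeProb h0 h1 hm (by omega)
    have b2 := one_sub_pow_le_bonferroni hq.le (by linarith) (m + 1)
    rw [sub_sub_cancel] at b2
    push_cast at b1 b2
    have hy : (1 : ℝ) ≤ (p * K / (K - 1)) ^ m := by
      refine one_le_pow₀ ?_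
      rw [le_div_iff₀ (by linarith)]
      nlinarith
    have hm0 : (0 : ℝ) ≤ m := Nat.cast_nonneg m
    have hc2 : (0 : ℝ) ≤ (1 - p) / 2 * (m + 1) * m := by positivity
    calc K * (p ^ (m + 1) - completeProb p K (m + 1))
        ≤ K * ((m + 1) * (m + 1 - 1) / 2 * (1 - p) ^ 2) :=
          mul_le_mul_of_nonneg_left (by linarith) (by linarith)
      _ = ((1 - p) / 2 * (m + 1) * m) * ((1 - p) * K) := by ring
      _ ≤ ((1 - p) / 2 * (m + 1) * m) * 1 := mul_le_mul_of_nonneg_left hc hc2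
      _ ≤ _ := mul_le_mul_of_nonneg_left hy hc2

theorem le_exp_sub_one (x : ℝ) : x ≤ Real.exp (x - 1) := by
  have := Real.add_one_le_exp (x - 1); linarith

/-- A weighted arithmetic-geometric mean inequality, in the form in which `x ^ a * y ^ b` is
maximized along a line: `x, y` are the coordinates divided by those of the maximizer. -/
theorem pow_mul_pow_le_one {x y : ℝ} (hx : 0 ≤ x) (hy : 0 ≤ y) {a b : ℕ}
    (h : a * (x - 1) + b * (y - 1) ≤ 0) : x ^ a * y ^ b ≤ 1 := by
  calc x ^ a * y ^ b ≤ Real.exp (x - 1) ^ a * Real.exp (y - 1) ^ b :=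
        mul_le_mul (pow_le_pow_left₀ hx (le_exp_sub_one x) a)
          (pow_le_pow_left₀ hy (le_exp_sub_one y) b) (pow_nonneg hy b)
          (pow_nonneg (Real.exp_pos _).le a)
    _ = Real.exp (a * (x - 1) + b * (y - 1)) := by
        rw [← Real.exp_nat_mul, ← Real.exp_nat_mul, ← Real.exp_add]
    _ ≤ 1 := Real.exp_le_one_iff.2 h

/-- A bound for the deficit that is uniform in `p`; it is the maximum over `p` of the right side of
`mul_deficit_le`, with `K` replaced by its smallest value `m + 1`. -/
theorem mul_deficit_le_half {p : ℝ} {K : ℕ} (h0 : 0 ≤ p) (h1 : p < 1) {a : ℕ} (ha : 1 ≤ a)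
    (haK : a ≤ K) : K * (p ^ a - completeProb p K a) ≤ (a - 1) / 2 := by
  obtain ⟨m, rfl⟩ : ∃ m, a = m + 1 := ⟨a - 1, by omega⟩
  rcases Nat.eq_zero_or_pos m with rfl | hm
  · simp [completeProb_one h0 h1 (show 0 < K by omega)]
  refine (mul_deficit_le h0 h1 haK (by omega)).trans ?_
  obtain ⟨n, rfl⟩ : ∃ n, K = n + 1 := ⟨K - 1, by omega⟩
  have hmn : (m : ℝ) ≤ n := by exact_mod_cast (show m ≤ n by omega)
  have hm' : (1 : ℝ) ≤ m := by exact_mod_cast hm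
  have hq : 0 ≤ 1 - p := by linarith
  push_cast
  rw [add_sub_cancel_right, add_sub_cancel_right]
  have key := pow_mul_pow_le_one (x := (m + 1) * (1 - p)) (y := (m + 1) * p / m) (a := 1) (b := m)
    (by positivity) (by positivity) (le_of_eq (by field_simp; push_cast; ring))
  have hle : p * ((n : ℝ) + 1) / n ≤ (m + 1) * p / m := by
    rw [div_le_div_iff₀ (by linarith) (by linarith)]
    nlinarith
  have := pow_le_pow_left₀ (by positivity) hle m
  calc (1 - p) / 2 * (m + 1) * m * (p * ((n : ℝ) + 1) / n) ^ m
      ≤ (1 - p) / 2 * (m + 1) * m * ((m + 1) * p / m) ^ m :=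
        mul_le_mul_of_nonneg_left this (by positivity)
    _ = m / 2 * (((m + 1) * (1 - p)) ^ 1 * ((m + 1) * p / m) ^ m) := by ring
    _ ≤ m / 2 * 1 := mul_le_mul_of_nonneg_left key (by positivity)
    _ = m / 2 := by ring

/-! ### Numerical bounds for the deficit -/

/-- The factor `s` for which `p / (s N)` is used as lower bound of an exposure probability, where
`N` bounds the size of a 2-hop ball. For `p ≤ 1 / 2` only the event that the node is a local maximum
is used; for larger `p` the 1-hop balls that meet several clusters contribute as well. -/
noncomputable def massScale (p : ℝ) : ℝ := if p ≤ 1 / 2 then 1 else 2 * (1 - p)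

/-- The maximum of `s (1 - p) p ^ m` over `p`. For `m = 1` it is attained at `p = 1 / 2`, and for
`m ≥ 2` at `p = m / (m + 2)`. -/
noncomputable def peak (m : ℕ) : ℝ := if m = 1 then 1 / 4 else 8 * m ^ m / (m + 2) ^ (m + 2)

/-- A bound for `2 s K e / a`, where `e` is the deficit of `a = m + 1` clusters out of
`K = n + 1`. -/
noncomputable def relDeficit (p : ℝ) (m n : ℕ) : ℝ :=
  massScale p * (1 - p) * m * (p * (n + 1) / n) ^ m

theorem massScale_pos {p : ℝ} (h1 : p < 1) : 0 < massScale p := by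
  unfold massScale; split_ifs <;> linarith

theorem massScale_of_half_le {p : ℝ} (h : 1 / 2 ≤ p) : massScale p = 2 * (1 - p) := by
  unfold massScale; split_ifs with h'
  · have : p = 1 / 2 := le_antisymm h' h
    rw [this]; norm_num
  · rfl

theorem sq_mul_pow_le {p : ℝ} (h0 : 0 ≤ p) (h1 : p ≤ 1) {m : ℕ} (hm : 1 ≤ m) :
    2 * (1 - p) ^ 2 * p ^ m ≤ 8 * (m : ℝ) ^ m / (m + 2) ^ (m + 2) := by
  have hm' : (1 : ℝ) ≤ m := by exact_mod_cast hm
  have key := pow_mul_pow_le_one (x := (m + 2) * (1 - p) / 2) (y := (m + 2) * p / m) (a := 2)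
    (b := m) (by have : 0 ≤ 1 - p := by linarith
                 positivity) (by positivity) (le_of_eq (by field_simp; push_cast; ring))
  rw [le_div_iff₀ (by positivity)]
  have e : 2 * (1 - p) ^ 2 * p ^ m * ((m : ℝ) + 2) ^ (m + 2) =
      8 * (m : ℝ) ^ m * (((m + 2) * (1 - p) / 2) ^ 2 * ((m + 2) * p / m) ^ m) := by
    rw [div_pow _ (m : ℝ), mul_pow _ p, pow_add]
    field_simp
    ring
  rw [e]
  exact mul_le_of_le_one_right (by positivity) key

theorem one_sub_mul_pow_le_half_pow {p : ℝ} (h0 : 0 ≤ p) (h : p ≤ 1 / 2) {m : ℕ} (hm : 1 ≤ m) :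
    (1 - p) * p ^ m ≤ (1 / 2) ^ (m + 1) := by
  have hm' : (1 : ℝ) ≤ m := by exact_mod_cast hm
  have key := pow_mul_pow_le_one (x := 2 * (1 - p)) (y := 2 * p) (a := 1) (b := m)
    (by linarith) (by linarith) (by push_cast; nlinarith)
  have h2 : ((1 : ℝ) / 2) ^ m * 2 ^ m = 1 := by rw [← mul_pow]; norm_num
  calc (1 - p) * p ^ m = (1 / 2) ^ (m + 1) * ((2 * (1 - p)) ^ 1 * (2 * p) ^ m) := by
        rw [mul_pow, pow_succ]
        linear_combination (-(1 - p) * p ^ m) * h2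
    _ ≤ _ := mul_le_of_le_one_right (by positivity) key

theorem massScale_mul_pow_le {p : ℝ} (h0 : 0 ≤ p) (h1 : p ≤ 1) {m : ℕ} (hm : 1 ≤ m) :
    massScale p * (1 - p) * p ^ m ≤ peak m := by
  have hhalf : (1 / 2 : ℝ) ^ (m + 1) ≤ peak m := by
    unfold peak
    split_ifs with h
    · subst h; norm_num
    · refine le_trans (le_of_eq ?_) (sq_mul_pow_le (p := 1 / 2) (by norm_num) (by norm_num) hm)
      rw [pow_succ]; norm_num; ring
  rcases le_total p (1 / 2) with h | h
  · have hs : massScale p = 1 := if_pos h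
    rw [hs, one_mul]
    exact (one_sub_mul_pow_le_half_pow h0 h hm).trans hhalf
  · rw [massScale_of_half_le h]
    unfold peak
    split_ifs with hm1
    · subst hm1; rw [pow_one]; nlinarith [mul_nonneg (sub_nonneg.2 h) (sub_nonneg.2 h1)]
    · refine le_trans (le_of_eq (by ring)) (sq_mul_pow_le h0 h1 hm)

theorem peak_nonneg (m : ℕ) : 0 ≤ peak m := by
  unfold peak; split_ifs <;> positivity

theorem relDeficit_eq (p : ℝ) (m n : ℕ) :
    relDeficit p m n = m * (massScale p * (1 - p) * p ^ m) * ((n + 1) / n : ℝ) ^ m := by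
  unfold relDeficit; rw [mul_div_assoc, mul_pow]; ring

theorem succ_div_antitone {N n : ℕ} (hN : 1 ≤ N) (h : N ≤ n) :
    ((n : ℝ) + 1) / n ≤ (N + 1) / N := by
  have h1 : (1 : ℝ) ≤ N := by exact_mod_cast hN
  have h2 : (N : ℝ) ≤ n := by exact_mod_cast h
  rw [div_le_div_iff₀ (by linarith) (by linarith)]; nlinarith

theorem relDeficit_le_of_le {p c : ℝ} {m n N : ℕ}
    (hc : massScale p * (1 - p) * p ^ m ≤ c) (hc0 : 0 ≤ c) (hN : 1 ≤ N) (h : N ≤ n) :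
    relDeficit p m n ≤ m * c * (((N : ℝ) + 1) / N) ^ m := by
  rw [relDeficit_eq]
  refine mul_le_mul (mul_le_mul_of_nonneg_left hc (Nat.cast_nonneg m))
    (pow_le_pow_left₀ (by positivity) (succ_div_antitone hN h) m) (by positivity) (by positivity)

theorem quadratic_le_one_add_pow {x : ℝ} (hx : 0 ≤ x) (m : ℕ) :
    1 + m * x + m * (m - 1) / 2 * x ^ 2 ≤ (1 + x) ^ m := by
  induction m with
  | zero => simp
  | succ m ih =>
    rw [pow_succ (1 + x) m]
    have hC : (0 : ℝ) ≤ m * (m - 1) := by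
      rcases Nat.eq_zero_or_pos m with rfl | h
      · simp
      · have : (1 : ℝ) ≤ m := by exact_mod_cast h
        exact mul_nonneg (by linarith) (by linarith)
    have h1 := mul_le_mul_of_nonneg_right ih (show 0 ≤ 1 + x by linarith)
    have h2 := mul_nonneg hC (pow_nonneg hx 3)
    have h3 : (1 + m * x + m * (m - 1) / 2 * x ^ 2) * (1 + x) =
        1 + (m + 1) * x + (m + 1) * m / 2 * x ^ 2 + m * (m - 1) * x ^ 3 / 2 := by ring
    push_cast
    rw [add_sub_cancel_right]
    linarith

/-- The bound for large `m`, where `n ≥ m` makes the factor `(1 + 1 / n) ^ m` harmless. -/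
theorem relDeficit_le_of_large {p : ℝ} (h0 : 0 ≤ p) (h1 : p ≤ 1) {m n : ℕ} (hm : 9 ≤ m)
    (hmn : m ≤ n) : relDeficit p m n ≤
      16 * m * (m + 1) ^ 2 / ((m + 2) ^ 2 * (5 * m ^ 2 + 5 * m + 2)) := by
  have hm' : (9 : ℝ) ≤ m := by exact_mod_cast hm
  have hp := massScale_mul_pow_le h0 h1 (m := m) (by omega)
  refine (relDeficit_le_of_le hp (peak_nonneg m) (by omega) hmn).trans ?_
  have e : (m : ℝ) * peak m * (((m : ℝ) + 1) / m) ^ m =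
      8 * m / (m + 2) ^ 2 / (1 + 1 / ((m : ℝ) + 1)) ^ m := by
    have e1 : 1 + 1 / ((m : ℝ) + 1) = (m + 2) / (m + 1) := by field_simp; ring
    rw [e1, peak, if_neg (by omega), div_pow, div_pow, pow_add]
    field_simp
  rw [e]
  have hq := quadratic_le_one_add_pow (x := 1 / ((m : ℝ) + 1)) (by positivity) m
  have e2 : 1 + m * (1 / ((m : ℝ) + 1)) + m * (m - 1) / 2 * (1 / ((m : ℝ) + 1)) ^ 2 =
      (5 * m ^ 2 + 5 * m + 2) / (2 * (m + 1) ^ 2) := by field_simp; ring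
  rw [e2] at hq
  calc 8 * m / (m + 2) ^ 2 / (1 + 1 / ((m : ℝ) + 1)) ^ m
      ≤ 8 * m / (m + 2) ^ 2 / ((5 * m ^ 2 + 5 * m + 2) / (2 * (m + 1) ^ 2)) :=
        div_le_div_of_nonneg_left (by positivity) (by positivity) hq
    _ = _ := by field_simp; ring

theorem relDeficit_le_of_nine_le {p : ℝ} (h0 : 0 ≤ p) (h1 : p ≤ 1) {m n : ℕ} (hm : 9 ≤ m)
    (hmn : m ≤ n) : relDeficit p m n ≤ 0.2637 := by
  refine (relDeficit_le_of_large h0 h1 hm hmn).trans ?_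
  obtain ⟨j, rfl⟩ : ∃ j, m = 9 + j := ⟨m - 9, by omega⟩
  rw [div_le_iff₀ (by positivity), ← sub_nonneg]
  push_cast
  ring_nf
  positivity

theorem relDeficit_le_of_ten_le {p : ℝ} (h0 : 0 ≤ p) (h1 : p ≤ 1) {m n : ℕ} (hm : 10 ≤ m)
    (hmn : m ≤ n) : relDeficit p m n ≤ 0.244 := by
  refine (relDeficit_le_of_large h0 h1 (by omega) hmn).trans ?_
  obtain ⟨j, rfl⟩ : ∃ j, m = 10 + j := ⟨m - 10, by omega⟩
  rw [div_le_iff₀ (by positivity), ← sub_nonneg]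
  push_cast
  ring_nf
  positivity

/-- The uniform bound reduces to the finitely many values `m ≤ 8`. -/
theorem relDeficit_le_of_forall {p T : ℝ} (h0 : 0 ≤ p) (h1 : p ≤ 1) {N : ℕ} (hN : 1 ≤ N)
    (hT : 0.2637 ≤ T)
    (h : ∀ m : ℕ, 1 ≤ m → m ≤ 8 → m * peak m * (((max N m : ℕ) + 1 : ℝ) / (max N m : ℕ)) ^ m ≤ T)
    {m n : ℕ} (hm : 1 ≤ m) (hmn : m ≤ n) (hn : N ≤ n) : relDeficit p m n ≤ T := by
  rcases le_or_gt 9 m with h9 | h9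
  · exact (relDeficit_le_of_nine_le h0 h1 h9 hmn).trans hT
  · exact (relDeficit_le_of_le (massScale_mul_pow_le h0 h1 hm) (peak_nonneg m) (by omega)
      (max_le hn hmn)).trans (h m hm (by omega))

theorem relDeficit_le_four {p : ℝ} (h0 : 0 ≤ p) (h1 : p ≤ 1) {m n : ℕ} (hm : 1 ≤ m)
    (hmn : m ≤ n) (hn : 4 ≤ n) : relDeficit p m n ≤ 0.4287 := by
  refine relDeficit_le_of_forall h0 h1 (by norm_num) (by norm_num) ?_ hm hmn hn
  intro m h1 h2
  interval_cases m <;> norm_num [peak]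

theorem relDeficit_le_five {p : ℝ} (h0 : 0 ≤ p) (h1 : p ≤ 1) {m n : ℕ} (hm : 1 ≤ m)
    (hmn : m ≤ n) (hn : 5 ≤ n) : relDeficit p m n ≤ 0.3777 := by
  refine relDeficit_le_of_forall h0 h1 (by norm_num) (by norm_num) ?_ hm hmn hn
  intro m h1 h2
  interval_cases m <;> norm_num [peak]

theorem relDeficit_le_six {p : ℝ} (h0 : 0 ≤ p) (h1 : p ≤ 1) {m n : ℕ} (hm : 1 ≤ m)
    (hmn : m ≤ n) (hn : 6 ≤ n) : relDeficit p m n ≤ 49 / 144 := by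
  refine relDeficit_le_of_forall h0 h1 (by norm_num) (by norm_num) ?_ hm hmn hn
  intro m h1 h2
  interval_cases m <;> norm_num [peak]

theorem relDeficit_le_seven {p : ℝ} (h0 : 0 ≤ p) (h1 : p ≤ 1) {m n : ℕ} (hm : 1 ≤ m)
    (hmn : m ≤ n) (hn : 7 ≤ n) : relDeficit p m n ≤ 0.3266 := by
  refine relDeficit_le_of_forall h0 h1 (by norm_num) (by norm_num) ?_ hm hmn hn
  intro m h1 h2
  interval_cases m <;> norm_num [peak]

theorem relDeficit_le_eight {p : ℝ} (h0 : 0 ≤ p) (h1 : p ≤ 1) {m n : ℕ} (hm : 1 ≤ m)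
    (hmn : m ≤ n) (hn : 8 ≤ n) : relDeficit p m n ≤ 0.3165 := by
  refine relDeficit_le_of_forall h0 h1 (by norm_num) (by norm_num) ?_ hm hmn hn
  intro m h1 h2
  interval_cases m <;> norm_num [peak]

/-- For `m ≤ 6` the maximizer `m / (m + 2)` of `(1 - p) ^ 2 p ^ m` is at most `3 / 4`. -/
theorem massScale_mul_pow_le_of_three_quarters {p : ℝ} (h : 3 / 4 ≤ p) (h1 : p ≤ 1) {m : ℕ}
    (hm : m ≤ 6) : massScale p * (1 - p) * p ^ m ≤ 1 / 8 * (3 / 4) ^ m := by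
  have hm' : (m : ℝ) ≤ 6 := by exact_mod_cast hm
  have key := pow_mul_pow_le_one (x := 4 * (1 - p)) (y := 4 / 3 * p) (a := 2) (b := m)
    (by linarith) (by linarith) (by push_cast; nlinarith)
  have e : (4 / 3 : ℝ) ^ m * (3 / 4) ^ m = 1 := by rw [← mul_pow]; norm_num
  calc massScale p * (1 - p) * p ^ m
      = 1 / 8 * (3 / 4) ^ m * ((4 * (1 - p)) ^ 2 * (4 / 3 * p) ^ m) := by
        rw [massScale_of_half_le (by linarith), mul_pow (4 / 3)]
        linear_combination (-2 * (1 - p) ^ 2 * p ^ m) * e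
    _ ≤ 1 / 8 * (3 / 4) ^ m * 1 := mul_le_mul_of_nonneg_left key (by positivity)
    _ = _ := mul_one _

theorem relDeficit_le_of_three_quarters {p T : ℝ} (h : 3 / 4 ≤ p) (h1 : p ≤ 1) {N L : ℕ}
    (hN : 1 ≤ N)
    (hL : ∀ m n : ℕ, L ≤ m → m ≤ n → relDeficit p m n ≤ T)
    (ha : ∀ m : ℕ, m ≤ 6 → m * (1 / 8 * (3 / 4) ^ m) * ((N + 1 : ℝ) / N) ^ m ≤ T)
    (hb : ∀ m : ℕ, 7 ≤ m → m < L → m * peak m * ((N + 1 : ℝ) / N) ^ m ≤ T)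
    {m n : ℕ} (hm : 1 ≤ m) (hmn : m ≤ n) (hn : N ≤ n) : relDeficit p m n ≤ T := by
  rcases le_or_gt L m with h9 | h9
  · exact hL m n h9 hmn
  rcases le_or_gt m 6 with h6 | h6
  · exact (relDeficit_le_of_le (massScale_mul_pow_le_of_three_quarters h h1 h6) (by positivity)
      hN hn).trans (ha m h6)
  · exact (relDeficit_le_of_le (massScale_mul_pow_le (by linarith) h1 hm) (peak_nonneg m) hN
      hn).trans (hb m h6 h9)

theorem relDeficit_le_eight' {p : ℝ} (h : 3 / 4 ≤ p) (h1 : p ≤ 1) {m n : ℕ}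
    (hm : 1 ≤ m) (hmn : m ≤ n) (hn : 8 ≤ n) : relDeficit p m n ≤ 0.3 := by
  refine relDeficit_le_of_three_quarters (L := 9) h h1 (by norm_num)
    (fun m n h9 hmn => (relDeficit_le_of_nine_le (by linarith) h1 h9 hmn).trans (by norm_num))
    ?_ ?_ hm hmn hn
  · intro m h2
    interval_cases m <;> norm_num
  · intro m h1 h2
    interval_cases m <;> norm_num [peak]

theorem relDeficit_le_nine' {p : ℝ} (h : 3 / 4 ≤ p) (h1 : p ≤ 1) {m n : ℕ}
    (hm : 1 ≤ m) (hmn : m ≤ n) (hn : 9 ≤ n) : relDeficit p m n ≤ 0.264 := by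
  refine relDeficit_le_of_three_quarters (L := 9) h h1 (by norm_num)
    (fun m n h9 hmn => (relDeficit_le_of_nine_le (by linarith) h1 h9 hmn).trans (by norm_num))
    ?_ ?_ hm hmn hn
  · intro m h2
    interval_cases m <;> norm_num
  · intro m h1 h2
    interval_cases m <;> norm_num [peak]

theorem relDeficit_le_ten' {p : ℝ} (h : 3 / 4 ≤ p) (h1 : p ≤ 1) {m n : ℕ}
    (hm : 1 ≤ m) (hmn : m ≤ n) (hn : 10 ≤ n) : relDeficit p m n ≤ 0.244 := by
  refine relDeficit_le_of_three_quarters (L := 10) h h1 (by norm_num)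
    (fun m n h9 hmn => relDeficit_le_of_ten_le (by linarith) h1 h9 hmn)
    ?_ ?_ hm hmn hn
  · intro m h2
    interval_cases m <;> norm_num
  · intro m h1 h2
    interval_cases m <;> norm_num [peak]

/-! ### The cutoff for the number of clusters -/

/-- The two quadratic functions of `u` that bound the covariances of far pairs are at most `B` on
the unit interval. Here `u` is the share of an exposure probability that comes from the tail, where
the 1-hop ball meets many clusters. -/
def TailBound (t ξ c B : ℝ) : Prop :=
  ∀ u : ℝ, 0 ≤ u → u ≤ 1 → t * (1 + ξ * (1 - u) / 2) + c * (u * (1 - u)) ≤ B ∧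
    t * (1 + ξ) * (1 - u) + c * (u * (1 - u)) ≤ B

theorem TailBound.mono {t ξ c B t' ξ' c' : ℝ} (h : TailBound t' ξ' c' B) (ht0 : 0 ≤ t)
    (hξ0 : 0 ≤ ξ) (ht : t ≤ t') (hξ : ξ ≤ ξ') (hc : c ≤ c') : TailBound t ξ c B := by
  intro u hu hu'
  have hv : 0 ≤ 1 - u := by linarith
  have hc' := mul_le_mul_of_nonneg_right hc (mul_nonneg hu hv)
  have hξ' := mul_le_mul_of_nonneg_right hξ hv
  obtain ⟨h1, h2⟩ := h u hu hu'
  refine ⟨le_trans (add_le_add ?_ hc') h1, le_trans (add_le_add ?_ hc') h2⟩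
  · exact mul_le_mul ht (by linarith) (by have := mul_nonneg hξ0 hv; linarith) (by linarith)
  · exact mul_le_mul_of_nonneg_right
      (mul_le_mul ht (by linarith) (by linarith) (by linarith)) hv

/-- The pair `(A, ξ)` and the constant `t` control the deficits `p ^ a - completeProb p K a` for all
`K > n₀`: those with `a < A` are relatively small, the others are multiplied by the small number
`p ^ A`, and the resulting bound for the far pairs is good enough: `3 / 4` suffices if all 2-hop
balls are components, and otherwise `κ ≥ 5 / 4` gives the factor `4 / 5` and `0.69` suffices. -/
structure IsCutoff (p : ℝ) (n₀ A : ℕ) (ξ t : ℝ) : Prop where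
  xi_nonneg : 0 ≤ ξ
  t_nonneg : 0 ≤ t
  deficit_le_mul : ∀ K a : ℕ, n₀ + 1 ≤ K → 2 ≤ a → a < A → a ≤ K →
    p ^ a - completeProb p K a ≤ ξ * completeProb p K a
  deficit_le : ∀ K a : ℕ, n₀ + 1 ≤ K → 1 ≤ a → a ≤ K →
    2 * massScale p * K * (p ^ a - completeProb p K a) ≤ t * a
  tail : TailBound t ξ (massScale p * p ^ A * n₀) (3 / 4)
  tail' : TailBound t ξ (4 / 5 * (massScale p * p ^ A * n₀)) 0.69

theorem deficit_le_of_relDeficit_le {p t : ℝ} {n₀ : ℕ} (h0 : 0 < p) (h1 : p < 1) (hn₀ : 1 ≤ n₀)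
    (ht0 : 0 ≤ t) (ht : ∀ m n : ℕ, 1 ≤ m → m ≤ n → n₀ ≤ n → relDeficit p m n ≤ t)
    (K a : ℕ) (hK : n₀ + 1 ≤ K) (ha : 1 ≤ a) (haK : a ≤ K) :
    2 * massScale p * K * (p ^ a - completeProb p K a) ≤ t * a := by
  obtain ⟨m, rfl⟩ : ∃ m, a = m + 1 := ⟨a - 1, by omega⟩
  obtain ⟨n, rfl⟩ : ∃ n, K = n + 1 := ⟨K - 1, by omega⟩
  rcases Nat.eq_zero_or_pos m with rfl | hm
  · rw [zero_add, pow_one, completeProb_one h0.le h1 (Nat.succ_pos n), sub_self, mul_zero]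
    positivity
  have h := mul_deficit_le h0.le h1 (m := m) (K := n + 1) haK (by omega)
  have hr := ht m n hm (by omega) (by omega)
  have hs := massScale_pos h1
  unfold relDeficit at hr
  push_cast at h ⊢
  rw [add_sub_cancel_right] at h
  calc 2 * massScale p * (n + 1) * (p ^ (m + 1) - completeProb p (n + 1) (m + 1))
      = 2 * massScale p * ((n + 1) * (p ^ (m + 1) - completeProb p (n + 1) (m + 1))) := by ring
    _ ≤ 2 * massScale p * ((1 - p) / 2 * (m + 1) * m * (p * (n + 1) / n) ^ m) :=
        mul_le_mul_of_nonneg_left h (by positivity)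
    _ = massScale p * (1 - p) * m * (p * (n + 1) / n) ^ m * (m + 1) := by ring
    _ ≤ _ := mul_le_mul_of_nonneg_right hr (by positivity)

/-- The relative deficit of `a = m + 1` clusters. -/
theorem deficit_le_mul_of_ratio_le {p x : ℝ} {n₀ m K : ℕ} (h0 : 0 < p) (h1 : p < 1)
    (hn₀ : 1 ≤ n₀) (hm : 1 ≤ m) (hx : x < 1)
    (hr : m * (m + 1) / 2 * ((1 - p) / (p * n₀)) * ((n₀ + 1) / n₀ : ℝ) ^ (m - 1) ≤ x)
    (hK : n₀ + 1 ≤ K) (haK : m + 1 ≤ K) :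
    p ^ (m + 1) - completeProb p K (m + 1) ≤ x / (1 - x) * completeProb p K (m + 1) := by
  obtain ⟨n, rfl⟩ : ∃ n, K = n + 1 := ⟨K - 1, by omega⟩
  obtain ⟨l, rfl⟩ : ∃ l, m = l + 1 := ⟨m - 1, by omega⟩
  have h := mul_deficit_le h0.le h1 (m := l + 1) (K := n + 1) haK (by omega)
  rw [Nat.add_sub_cancel] at hr
  have hn : (1 : ℝ) ≤ n₀ := by exact_mod_cast hn₀
  have hnn : (n₀ : ℝ) ≤ n := by exact_mod_cast Nat.le_of_succ_le_succ hK
  have hn' : (0 : ℝ) < n := by linarith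
  have hq : 0 ≤ 1 - p := by linarith
  push_cast at h hr
  rw [add_sub_cancel_right] at h
  set Q := completeProb p (n + 1) (l + 1 + 1) with hQ
  have key : p ^ (l + 1 + 1) - Q ≤ x * p ^ (l + 1 + 1) := by
    have h2 : (l + 1 : ℝ) * (l + 1 + 1) / 2 * ((1 - p) / (p * n)) * ((n + 1) / n : ℝ) ^ l ≤ x := by
      refine le_trans ?_ hr
      refine mul_le_mul (mul_le_mul_of_nonneg_left ?_ (by positivity))
        (pow_le_pow_left₀ (by positivity) (succ_div_antitone hn₀ (by omega)) l)
        (by positivity) (by positivity)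
      exact div_le_div_of_nonneg_left hq (by positivity)
        (mul_le_mul_of_nonneg_left hnn h0.le)
    have e : (1 - p) / 2 * (l + 1 + 1) * (l + 1) * (p * (n + 1) / n) ^ (l + 1) =
        (n + 1) * ((l + 1 : ℝ) * (l + 1 + 1) / 2 * ((1 - p) / (p * n)) *
          ((n + 1) / n : ℝ) ^ l * p ^ (l + 1 + 1)) := by
      rw [mul_div_assoc, mul_pow, pow_succ ((n + 1) / n : ℝ), pow_succ p (l + 1)]
      field_simp
    rw [e] at h
    have h3 := le_of_mul_le_mul_left h (by positivity)
    exact h3.trans (mul_le_mul_of_nonneg_right h2 (by positivity))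
  rw [div_mul_eq_mul_div, le_div_iff₀ (by linarith)]
  have h0' : 0 ≤ p ^ (l + 1 + 1) := by positivity
  nlinarith

/-- The scaled version of `deficit_le_mul_of_ratio_le`: below the cutoff `1 / n₀` is at most
`(2 / 3) s p ^ (m + 1)`, and `B` bounds the factor `(1 + 1 / n₀) ^ (m - 1)`. -/
theorem ratio_le_of_cutoff {p w B : ℝ} {n₀ m : ℕ} (h0 : 0 < p) (h1 : p < 1) (hn₀ : 1 ≤ n₀)
    (hcut : 3 / 2 < massScale p * p ^ (m + 1) * n₀) (hm : 1 ≤ m)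
    (hw : m * (m + 1) * (massScale p * (1 - p) * p ^ m) ≤ w) (hw0 : 0 ≤ w)
    (hB : ((n₀ + 1) / n₀ : ℝ) ^ (m - 1) ≤ B) :
    m * (m + 1) / 2 * ((1 - p) / (p * n₀)) * ((n₀ + 1) / n₀ : ℝ) ^ (m - 1) ≤ w / 3 * B := by
  have hn : (1 : ℝ) ≤ n₀ := by exact_mod_cast hn₀
  refine mul_le_mul ?_ hB (by positivity) (by positivity)
  have hs := massScale_pos h1
  have hq : 0 < 1 - p := by linarith
  refine le_trans ?_ (div_le_div_of_nonneg_right hw (by norm_num))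
  have e : (1 - p) / (p * n₀) ≤ 2 / 3 * (massScale p * (1 - p) * p ^ m) := by
    rw [div_le_iff₀ (by positivity)]
    have : (1 - p) * (3 / 2) ≤ (1 - p) * (massScale p * p ^ (m + 1) * n₀) :=
      mul_le_mul_of_nonneg_left hcut.le hq.le
    rw [pow_succ] at this
    nlinarith
  have := mul_le_mul_of_nonneg_left e (show (0 : ℝ) ≤ m * (m + 1) / 2 by positivity)
  linarith

theorem inv_le_of_cutoff {p : ℝ} {n₀ m : ℕ} (hn₀ : 1 ≤ n₀)
    (hcut : 3 / 2 < massScale p * p ^ (m + 1) * n₀) :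
    (1 : ℝ) / n₀ ≤ 2 / 3 * (massScale p * p ^ (m + 1)) := by
  have hn : (1 : ℝ) ≤ n₀ := by exact_mod_cast hn₀
  rw [div_le_iff₀ (by positivity)]
  linarith

theorem succ_div_pow_le {n₀ k : ℕ} {y : ℝ} (hn₀ : 1 ≤ n₀) (hy : k * ((1 : ℝ) / n₀) ≤ y)
    (hy1 : y < 1) : ((n₀ + 1) / n₀ : ℝ) ^ k ≤ 1 / (1 - y) := by
  have hn : (1 : ℝ) ≤ n₀ := by exact_mod_cast hn₀
  have hb := one_add_mul_le_pow (a := -(1 / (n₀ + 1 : ℝ))) (by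
    have : 1 / (n₀ + 1 : ℝ) ≤ 1 := by rw [div_le_one (by positivity)]; linarith
    linarith) k
  have e : 1 + -(1 / (n₀ + 1 : ℝ)) = ((n₀ + 1) / n₀ : ℝ)⁻¹ := by field_simp; ring
  rw [e, inv_pow] at hb
  have h2 : (k : ℝ) * (1 / (n₀ + 1)) ≤ k * (1 / n₀) := by gcongr; linarith
  rw [le_div_iff₀ (by linarith)]
  have hpos : 0 < ((n₀ + 1) / n₀ : ℝ) ^ k := by positivity
  have h3 : 1 - y ≤ (((n₀ + 1) / n₀ : ℝ) ^ k)⁻¹ := by linarith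
  calc ((n₀ + 1) / n₀ : ℝ) ^ k * (1 - y)
      ≤ ((n₀ + 1) / n₀ : ℝ) ^ k * (((n₀ + 1) / n₀ : ℝ) ^ k)⁻¹ :=
        mul_le_mul_of_nonneg_left h3 hpos.le
    _ = 1 := mul_inv_cancel₀ hpos.ne'

theorem succ_div_pow_le_exp {n₀ k : ℕ} {y : ℝ} (hn₀ : 1 ≤ n₀) (hy : k * ((1 : ℝ) / n₀) ≤ y) :
    ((n₀ + 1) / n₀ : ℝ) ^ k ≤ Real.exp y := by
  have hn : (1 : ℝ) ≤ n₀ := by exact_mod_cast hn₀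
  have e : ((n₀ + 1) / n₀ : ℝ) = 1 / n₀ + 1 := by field_simp; ring
  calc ((n₀ + 1) / n₀ : ℝ) ^ k ≤ Real.exp (1 / n₀) ^ k := by
        rw [e]; exact pow_le_pow_left₀ (by positivity) (Real.add_one_le_exp _) k
    _ = Real.exp (k * (1 / n₀)) := (Real.exp_nat_mul _ k).symm
    _ ≤ _ := Real.exp_le_exp.2 hy

theorem isCutoff_of_ratio_le {p x t : ℝ} {n₀ A : ℕ} (h0 : 0 < p) (h1 : p < 1) (hn₀ : 1 ≤ n₀)
    (hx0 : 0 ≤ x) (hx : x < 1) (ht0 : 0 ≤ t)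
    (hr : ∀ m : ℕ, 1 ≤ m → m + 1 < A →
      m * (m + 1) / 2 * ((1 - p) / (p * n₀)) * ((n₀ + 1) / n₀ : ℝ) ^ (m - 1) ≤ x)
    (ht : ∀ m n : ℕ, 1 ≤ m → m ≤ n → n₀ ≤ n → relDeficit p m n ≤ t) {c : ℝ}
    (hc : massScale p * p ^ A * n₀ ≤ c) (hb : TailBound t (x / (1 - x)) c (3 / 4))
    (hb' : TailBound t (x / (1 - x)) (4 / 5 * c) 0.69) : IsCutoff p n₀ A (x / (1 - x)) t := by
  have hξ : 0 ≤ x / (1 - x) := div_nonneg hx0 (by linarith)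
  refine ⟨hξ, ht0, ?_, deficit_le_of_relDeficit_le h0 h1 hn₀ ht0 ht,
    hb.mono ht0 hξ le_rfl le_rfl hc, hb'.mono ht0 hξ le_rfl le_rfl (by linarith)⟩
  intro K a hK ha haA haK
  obtain ⟨m, rfl⟩ : ∃ m, a = m + 1 := ⟨a - 1, by omega⟩
  exact deficit_le_mul_of_ratio_le h0 h1 hn₀ (by omega) hx (hr m (by omega) haA) hK haK

/-- The smallest `A` with `s p ^ A n₀ ≤ 3 / 2`. -/
theorem exists_cutoff_le {p : ℝ} (n₀ : ℕ) (h0 : 0 < p) (h1 : p < 1) :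
    ∃ A, massScale p * p ^ A * n₀ ≤ 3 / 2 ∧
      ∀ m : ℕ, 1 ≤ m → m + 1 < A → 3 / 2 < massScale p * p ^ (m + 1) * n₀ := by
  have hex : ∃ A, massScale p * p ^ A * n₀ ≤ 3 / 2 := by
    have := ((tendsto_pow_atTop_nhds_zero_of_lt_one h0.le h1).const_mul (massScale p)).mul_const
      (n₀ : ℝ)
    rw [mul_zero, zero_mul] at this
    exact (this.eventually_le_const (by norm_num : (0 : ℝ) < 3 / 2)).exists
  classical
  exact ⟨Nat.find hex, Nat.find_spec hex, fun m _ hm => not_le.1 (Nat.find_min hex hm)⟩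

theorem seq_le_of_antitone {f : ℕ → ℝ} {c : ℝ} {M : ℕ} (h0 : f M ≤ c)
    (h : ∀ m, M ≤ m → f (m + 1) ≤ f m) {m : ℕ} (hm : M ≤ m) : f m ≤ c := by
  induction m, hm using Nat.le_induction with
  | base => exact h0
  | succ m hm ih => exact (h m hm).trans ih

theorem isCutoff_of_le_half {p : ℝ} {n₀ A : ℕ} (h0 : 0 < p) (h : p ≤ 1 / 2) (hn₀ : 6 ≤ n₀)
    (hc : massScale p * p ^ A * n₀ ≤ 3 / 2)
    (hcut : ∀ m : ℕ, 1 ≤ m → m + 1 < A → 3 / 2 < massScale p * p ^ (m + 1) * n₀) :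
    ∃ ξ t, IsCutoff p n₀ A ξ t := by
  have h1 : p < 1 := by linarith
  have hs : massScale p = 1 := if_pos h
  -- `3 / 11 = w / 3 * B` with the maximum `w = 3 / 4` of `m (m + 1) / 2 ^ (m + 1)` and
  -- `B = 1 / (1 - 1 / 12)`
  refine ⟨_, 49 / 144, isCutoff_of_ratio_le (x := 3 / 11) h0 h1 (by omega) (by norm_num)
    (by norm_num) (by norm_num) ?_ (fun m n hm hmn hn => relDeficit_le_six h0.le h1.le hm hmn
      (hn₀.trans hn)) hc ?_ ?_⟩
  · intro m hm hmA
    refine (ratio_le_of_cutoff (w := 3 / 4) (B := 12 / 11) h0 h1 (by omega) (hcut m hm hmA) hm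
      ?_ (by norm_num) ?_).trans (by norm_num)
    · rw [hs, one_mul]
      refine (mul_le_mul_of_nonneg_left (one_sub_mul_pow_le_half_pow h0.le h hm)
        (by positivity)).trans ?_
      rcases le_or_gt m 1 with hm1 | hm1
      · interval_cases m; norm_num
      refine seq_le_of_antitone (f := fun m : ℕ => (m : ℝ) * (m + 1) * (1 / 2) ^ (m + 1)) (M := 2)
        (by norm_num) ?_ hm1
      intro m hm
      have hm' : (2 : ℝ) ≤ m := by exact_mod_cast hm
      have : (0 : ℝ) < (1 / 2) ^ (m + 1) := by positivity
      simp only [pow_succ (1 / 2 : ℝ) (m + 1)]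
      push_cast
      nlinarith [mul_nonneg (mul_nonneg (by linarith : (0 : ℝ) ≤ m + 1)
        (by linarith : (0 : ℝ) ≤ m - 2)) this.le]
    · refine (succ_div_pow_le (y := 1 / 12) (by omega) ?_ (by norm_num)).trans (by norm_num)
      obtain ⟨k, rfl⟩ : ∃ k, m = k + 1 := ⟨m - 1, by omega⟩
      have hz := inv_le_of_cutoff (p := p) (by omega) (hcut _ hm hmA)
      rw [hs, one_mul] at hz
      have h2 : p ^ (k + 1 + 1) ≤ (1 / 2) ^ (k + 1 + 1) := pow_le_pow_left₀ h0.le h _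
      have h3 : (k : ℝ) * (1 / 2) ^ (k + 1 + 1) ≤ 1 / 8 := by
        rcases Nat.eq_zero_or_pos k with rfl | hk
        · norm_num
        refine seq_le_of_antitone (f := fun k : ℕ => (k : ℝ) * (1 / 2) ^ (k + 1 + 1)) (M := 1)
          (by norm_num) ?_ hk
        intro k hk
        have hk' : (1 : ℝ) ≤ k := by exact_mod_cast hk
        have : (0 : ℝ) < (1 / 2) ^ (k + 1 + 1) := by positivity
        simp only [pow_succ (1 / 2 : ℝ) (k + 1 + 1)]
        push_cast
        nlinarith [mul_nonneg (by linarith : (0 : ℝ) ≤ k - 1) this.le]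
      rw [Nat.add_sub_cancel]
      have := mul_le_mul_of_nonneg_left (hz.trans (mul_le_mul_of_nonneg_left h2 (by norm_num)))
        (Nat.cast_nonneg (α := ℝ) k)
      linarith
  · intro u hu hu'
    constructor <;> nlinarith [sq_nonneg (u - 0.48), sq_nonneg (u - 0.35)]
  · intro u hu hu'
    constructor <;> nlinarith [sq_nonneg (u - 0.48), sq_nonneg (u - 0.35)]

theorem isCutoff_of_le_three_quarters {p : ℝ} {n₀ A : ℕ} (h : 1 / 2 ≤ p) (h' : p ≤ 3 / 4)
    (hn₀ : 8 ≤ n₀) (hc : massScale p * p ^ A * n₀ ≤ 3 / 2)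
    (hcut : ∀ m : ℕ, 1 ≤ m → m + 1 < A → 3 / 2 < massScale p * p ^ (m + 1) * n₀) :
    ∃ ξ t, IsCutoff p n₀ A ξ t := by
  have h0 : 0 < p := by linarith
  have h1 : p < 1 := by linarith
  have hs : massScale p = 2 * (1 - p) := massScale_of_half_le h
  have e1 : ∀ k : ℕ, (4 / 3 : ℝ) ^ k * (3 / 4) ^ k = 1 := by
    intro k; rw [← mul_pow]; norm_num
  have hpow1 : ∀ k : ℕ, 3 ≤ k → (1 - p) * p ^ k ≤ 1 / 4 * (3 / 4) ^ k := by
    intro k hk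
    have hk' : (3 : ℝ) ≤ k := by exact_mod_cast hk
    have key := pow_mul_pow_le_one (x := 4 * (1 - p)) (y := 4 / 3 * p) (a := 1) (b := k)
      (by linarith) (by linarith) (by push_cast; nlinarith)
    calc (1 - p) * p ^ k = 1 / 4 * (3 / 4) ^ k * ((4 * (1 - p)) ^ 1 * (4 / 3 * p) ^ k) := by
          rw [mul_pow]
          linear_combination (-(1 - p) * p ^ k) * e1 k
      _ ≤ _ := mul_le_of_le_one_right (by positivity) key
  have hpow2 : ∀ k : ℕ, 6 ≤ k → (1 - p) ^ 2 * p ^ k ≤ 1 / 16 * (3 / 4) ^ k := by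
    intro k hk
    have hk' : (6 : ℝ) ≤ k := by exact_mod_cast hk
    have key := pow_mul_pow_le_one (x := 4 * (1 - p)) (y := 4 / 3 * p) (a := 2) (b := k)
      (by linarith) (by linarith) (by push_cast; nlinarith)
    calc (1 - p) ^ 2 * p ^ k = 1 / 16 * (3 / 4) ^ k * ((4 * (1 - p)) ^ 2 * (4 / 3 * p) ^ k) := by
          rw [mul_pow]
          linear_combination (-(1 - p) ^ 2 * p ^ k) * e1 k
      _ ≤ _ := mul_le_of_le_one_right (by positivity) key
  -- `x` is `w / 3 * B`, where `w` bounds `m (m + 1) s (1 - p) p ^ m` and the number `0.356` in `B`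
  -- bounds `(m - 1) s p ^ (m + 1)`
  refine ⟨_, 0.3165, isCutoff_of_ratio_le (x := 0.4085) h0 h1 (by omega) (by norm_num)
    (by norm_num) (by norm_num) ?_ (fun m n hm hmn hn => relDeficit_le_eight h0.le h1.le hm hmn
      (hn₀.trans hn)) hc ?_ ?_⟩
  · intro m hm hmA
    refine (ratio_le_of_cutoff (w := 0.9345) (B := 1 / (1 - 2 / 3 * 0.356)) h0 h1 (by omega)
      (hcut m hm hmA) hm ?_ (by norm_num) ?_).trans (by norm_num)
    · rcases le_or_gt m 5 with h6 | h6
      · refine (mul_le_mul_of_nonneg_left (massScale_mul_pow_le h0.le h1.le hm)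
          (by positivity)).trans ?_
        interval_cases m <;> norm_num [peak]
      rw [hs]
      have h2 := hpow2 m h6
      have h3 : (m : ℝ) * (m + 1) * (3 / 4) ^ m ≤ 7.476 := by
        refine seq_le_of_antitone (f := fun m : ℕ => (m : ℝ) * (m + 1) * (3 / 4) ^ m) (M := 6)
          (by norm_num) ?_ h6
        intro m hm
        have hm' : (6 : ℝ) ≤ m := by exact_mod_cast hm
        have : (0 : ℝ) < (3 / 4) ^ m := by positivity
        simp only [pow_succ (3 / 4 : ℝ) m]
        push_cast
        nlinarith [mul_nonneg (mul_nonneg (by linarith : (0 : ℝ) ≤ m + 1)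
          (by linarith : (0 : ℝ) ≤ m - 6)) this.le]
      have h4 := mul_le_mul_of_nonneg_left h2 (show (0 : ℝ) ≤ m * (m + 1) by positivity)
      linarith
    · refine succ_div_pow_le (by omega) ?_ (by norm_num)
      obtain ⟨k, rfl⟩ : ∃ k, m = k + 1 := ⟨m - 1, by omega⟩
      have hz := inv_le_of_cutoff (p := p) (by omega) (hcut _ hm hmA)
      rw [hs] at hz
      rw [Nat.add_sub_cancel]
      rcases Nat.eq_zero_or_pos k with rfl | hk
      · norm_num
      have h3 : (k : ℝ) * (3 / 4) ^ (k + 1 + 1) ≤ 0.712 := by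
        rcases le_or_gt k 3 with h4 | h4
        · interval_cases k <;> norm_num
        refine seq_le_of_antitone (f := fun k : ℕ => (k : ℝ) * (3 / 4) ^ (k + 1 + 1)) (M := 4)
          (by norm_num) ?_ h4
        intro k hk
        have hk' : (4 : ℝ) ≤ k := by exact_mod_cast hk
        have : (0 : ℝ) < (3 / 4) ^ (k + 1 + 1) := by positivity
        simp only [pow_succ (3 / 4 : ℝ) (k + 1 + 1)]
        push_cast
        nlinarith [mul_nonneg (by linarith : (0 : ℝ) ≤ k - 4) this.le]
      have h2 := hpow1 (k + 1 + 1) (by omega)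
      have h5 : (1 : ℝ) / n₀ ≤ 2 / 3 * (2 * (1 / 4 * (3 / 4) ^ (k + 1 + 1))) := by linarith
      have := mul_le_mul_of_nonneg_left h5 (Nat.cast_nonneg (α := ℝ) k)
      linarith
  · intro u hu hu'
    constructor <;> nlinarith [sq_nonneg (u - 0.4636), sq_nonneg (u - 0.32)]
  · intro u hu hu'
    constructor <;> nlinarith [sq_nonneg (u - 0.45), sq_nonneg (u - 0.28)]

theorem mul_exp_neg_le (x : ℝ) : x * Real.exp (-x) ≤ Real.exp (-1) := by
  have := le_exp_sub_one x
  calc x * Real.exp (-x) ≤ Real.exp (x - 1) * Real.exp (-x) :=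
        mul_le_mul_of_nonneg_right this (Real.exp_nonneg _)
    _ = Real.exp (-1) := by rw [← Real.exp_add]; congr 1; ring

theorem mul_pow_le_exp {p : ℝ} (h0 : 0 ≤ p) (h1 : p ≤ 1) (k : ℕ) :
    k * ((1 - p) * p ^ k) ≤ Real.exp (-1) := by
  have h : p ^ k ≤ Real.exp (-(k * (1 - p))) := by
    have := le_exp_sub_one p
    calc p ^ k ≤ Real.exp (p - 1) ^ k := pow_le_pow_left₀ h0 this k
      _ = _ := by rw [← Real.exp_nat_mul]; congr 1; ring
  refine le_trans ?_ (mul_exp_neg_le (k * (1 - p)))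
  rw [← mul_assoc]
  exact mul_le_mul_of_nonneg_left h (mul_nonneg (Nat.cast_nonneg k) (by linarith))

theorem div_pow_le_exp {m : ℕ} (hm : 1 ≤ m) :
    ((m : ℝ) / (m + 2)) ^ (m + 1) ≤ Real.exp (-2) := by
  have hm' : (1 : ℝ) ≤ m := by exact_mod_cast hm
  have hl := Real.le_log_one_add_of_nonneg (x := 2 / m) (by positivity)
  have e : 2 * (2 / (m : ℝ)) / (2 / m + 2) = 2 / (m + 1) := by field_simp; ring
  rw [e] at hl
  have e2 : (m : ℝ) / (m + 2) = (1 + 2 / (m : ℝ))⁻¹ := by field_simp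
  rw [e2, inv_pow, Real.exp_neg]
  refine inv_anti₀ (Real.exp_pos 2) ?_
  rw [← Real.log_le_log_iff (Real.exp_pos 2) (by positivity), Real.log_exp, Real.log_pow]
  rw [div_le_iff₀ (by positivity)] at hl
  push_cast
  linarith

theorem isCutoff_of_three_quarters_le {p : ℝ} {n₀ A : ℕ} (h : 3 / 4 ≤ p) (h1 : p < 1)
    (hn₀ : 10 ≤ n₀) (hc : massScale p * p ^ A * n₀ ≤ 3 / 2)
    (hcut : ∀ m : ℕ, 1 ≤ m → m + 1 < A → 3 / 2 < massScale p * p ^ (m + 1) * n₀) :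
    ∃ ξ t, IsCutoff p n₀ A ξ t := by
  have h0 : 0 < p := by linarith
  have hs : massScale p = 2 * (1 - p) := massScale_of_half_le (by linarith)
  have hexp : Real.exp (-1) < 0.367880 := by
    rw [Real.exp_neg]
    refine inv_lt_of_inv_lt₀ (by norm_num) (lt_trans (by norm_num) Real.exp_one_gt_d9)
  have hexp2 : Real.exp (-2) < 0.13534 := by
    have : Real.exp (-2) = Real.exp (-1) * Real.exp (-1) := by rw [← Real.exp_add]; norm_num
    rw [this]
    have := Real.exp_pos (-1)
    nlinarith
  have hexp3 : Real.exp (1 / 2) ≤ 1.65 := by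
    have e : Real.exp (1 / 2) ^ 2 = Real.exp 1 := by
      rw [← Real.exp_nat_mul]; norm_num
    have := Real.exp_one_lt_d9
    exact (pow_le_pow_iff_left₀ (Real.exp_nonneg _) (by norm_num) two_ne_zero).1
      (by rw [e]; norm_num; linarith)
  -- `x` is `w / 3 * B` with `w = 8 e⁻²` and `B = e ^ (1 / 2)`
  refine ⟨_, 0.244, isCutoff_of_ratio_le (x := 0.5956) h0 h1 (by omega) (by norm_num)
    (by norm_num) (by norm_num) ?_ (fun m n hm hmn hn => relDeficit_le_ten' h h1.le hm hmn
      (hn₀.trans hn)) hc ?_ ?_⟩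
  · intro m hm hmA
    refine (ratio_le_of_cutoff (w := 8 * 0.13534) (B := 1.65) h0 h1 (by omega)
      (hcut m hm hmA) hm ?_ (by norm_num) ?_).trans (by norm_num)
    · have h2 := sq_mul_pow_le h0.le h1.le hm
      have h3 := div_pow_le_exp hm
      rw [hs]
      have h4 := mul_le_mul_of_nonneg_left h2 (show (0 : ℝ) ≤ m * (m + 1) by positivity)
      have e : (m : ℝ) * (m + 1) * (8 * (m : ℝ) ^ m / (m + 2) ^ (m + 2)) =
          8 * ((m : ℝ) / (m + 2)) ^ (m + 1) * ((m + 1) / (m + 2)) := by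
        rw [div_pow, pow_succ (m : ℝ), pow_succ _ (m + 1)]
        field_simp
      rw [e] at h4
      have h5 : ((m : ℝ) + 1) / (m + 2) ≤ 1 := by
        rw [div_le_one (by positivity)]; linarith
      have h6 := mul_le_mul_of_nonneg_left h5
        (show 0 ≤ 8 * ((m : ℝ) / (m + 2)) ^ (m + 1) by positivity)
      linarith
    · refine (succ_div_pow_le_exp (by omega) (y := 1 / 2) ?_).trans hexp3
      obtain ⟨k, rfl⟩ : ∃ k, m = k + 1 := ⟨m - 1, by omega⟩
      have hz := inv_le_of_cutoff (p := p) (by omega) (hcut _ hm hmA)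
      rw [hs] at hz
      rw [Nat.add_sub_cancel]
      have h2 := mul_pow_le_exp h0.le h1.le (k + 1 + 1)
      have h3 : 0 ≤ (1 - p) * p ^ (k + 1 + 1) := mul_nonneg (by linarith) (by positivity)
      have := mul_le_mul_of_nonneg_left hz (Nat.cast_nonneg (α := ℝ) k)
      push_cast at h2
      nlinarith
  · intro u hu hu'
    constructor <;> nlinarith [sq_nonneg (u - 0.44), sq_nonneg (u - 0.3)]
  · intro u hu hu'
    constructor <;> nlinarith [sq_nonneg (u - 0.44), sq_nonneg (u - 0.25)]

theorem massScale_mul_sq_le {p : ℝ} (h0 : 0 < p) (h1 : p < 1) :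
    massScale p * p ^ 2 ≤ 8 / 27 := by
  unfold massScale
  split_ifs with h
  · nlinarith
  · nlinarith [mul_nonneg (sq_nonneg (p - 2 / 3)) (show 0 ≤ p + 1 / 3 by linarith)]

theorem massScale_mul_cube_le {p : ℝ} (h : 1 / 2 ≤ p) : massScale p * p ^ 3 ≤ 27 / 128 := by
  rw [massScale_of_half_le h]
  nlinarith [mul_nonneg (sq_nonneg (p - 3 / 4)) (show 0 ≤ p ^ 2 + p / 2 + 3 / 16 by positivity)]

theorem isCutoff_two {p t : ℝ} {n₀ : ℕ} (h0 : 0 < p) (h1 : p < 1) (hn₀ : 1 ≤ n₀) (ht0 : 0 ≤ t)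
    (ht : ∀ m n : ℕ, 1 ≤ m → m ≤ n → n₀ ≤ n → relDeficit p m n ≤ t)
    (hb : TailBound t (0 / (1 - 0)) (8 / 27 * n₀) (3 / 4))
    (hb' : TailBound t (0 / (1 - 0)) (4 / 5 * (8 / 27 * n₀)) 0.69) : ∃ A ξ t, IsCutoff p n₀ A ξ t :=
  ⟨2, _, t, isCutoff_of_ratio_le (x := 0) h0 h1 hn₀ le_rfl (by norm_num) ht0
    (fun m hm hm2 => by omega) ht
    (mul_le_mul_of_nonneg_right (massScale_mul_sq_le h0 h1) (Nat.cast_nonneg n₀)) hb hb'⟩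

theorem isCutoff_three {p t x : ℝ} {n₀ : ℕ} (h : 1 / 2 ≤ p) (h1 : p < 1) (hn₀ : 1 ≤ n₀)
    (ht0 : 0 ≤ t) (hx0 : 0 ≤ x) (hx : x < 1) (hr : (1 - p) / (p * n₀) ≤ x)
    (ht : ∀ m n : ℕ, 1 ≤ m → m ≤ n → n₀ ≤ n → relDeficit p m n ≤ t)
    (hb : TailBound t (x / (1 - x)) (27 / 128 * n₀) (3 / 4))
    (hb' : TailBound t (x / (1 - x)) (4 / 5 * (27 / 128 * n₀)) 0.69) :
    ∃ A ξ t, IsCutoff p n₀ A ξ t :=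
  ⟨3, _, t, isCutoff_of_ratio_le (x := x) (by linarith) h1 hn₀ hx0 hx ht0
    (fun m hm hm2 => by
      obtain rfl : m = 1 := by omega
      norm_num
      exact hr) ht
    (mul_le_mul_of_nonneg_right (massScale_mul_cube_le h) (Nat.cast_nonneg n₀)) hb hb'⟩

/-- Either the trivial bound for far pairs suffices, or there is a good cutoff. For small `n₀` the
cutoff is `2` or `3`; for large `n₀` it is the smallest `A` with `s p ^ A n₀ ≤ 3 / 2`. -/
theorem le_or_exists_isCutoff {p : ℝ} {n₀ : ℕ} (h0 : 0 < p) (h1 : p < 1) :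
    massScale p * p * n₀ ≤ 3 / 2 ∨ ∃ A ξ t, IsCutoff p n₀ A ξ t := by
  by_cases hT : massScale p * p * n₀ ≤ 3 / 2
  · exact Or.inl hT
  refine Or.inr ?_
  have hsp : massScale p * p ≤ 1 / 2 := by
    unfold massScale
    split_ifs with h
    · linarith
    · nlinarith [sq_nonneg (p - 1 / 2)]
  have h4 : 4 ≤ n₀ := by
    by_contra! h
    have : (n₀ : ℝ) ≤ 3 := by exact_mod_cast Nat.le_of_lt_succ h
    exact hT (by nlinarith [mul_pos (massScale_pos h1) h0])
  obtain ⟨A, hc, hcut⟩ := exists_cutoff_le n₀ h0 h1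
  have hdiv : ∀ {r x : ℝ} {n : ℕ}, r ≤ p → 1 ≤ n → 1 - r ≤ x * (r * n) → 0 ≤ x →
      (1 - p) / (p * n) ≤ x := by
    intro r x n hr hn hx hx0
    have hn' : (1 : ℝ) ≤ n := by exact_mod_cast hn
    rw [div_le_iff₀ (by positivity)]
    have : x * (r * n) ≤ x * (p * n) := by gcongr
    linarith
  -- the squares in the following estimates are centred near the maximizers of the quadratic
  -- functions
  by_cases h5 : n₀ ≤ 5
  · interval_cases n₀
    · refine isCutoff_two (t := 0.4287) h0 h1 (by norm_num) (by norm_num)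
        (fun m n hm hmn hn => relDeficit_le_four h0.le h1.le hm hmn hn) ?_ ?_
      · intro u hu hu'
        constructor <;> nlinarith [sq_nonneg (u - 0.5), sq_nonneg (u - 0.32)]
      · intro u hu hu'
        constructor <;> nlinarith [sq_nonneg (u - 0.5), sq_nonneg (u - 0.32)]
    · refine isCutoff_two (t := 0.3777) h0 h1 (by norm_num) (by norm_num)
        (fun m n hm hmn hn => relDeficit_le_five h0.le h1.le hm hmn hn) ?_ ?_
      · intro u hu hu'
        constructor <;> nlinarith [sq_nonneg (u - 0.5), sq_nonneg (u - 0.32)]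
      · intro u hu hu'
        constructor <;> nlinarith [sq_nonneg (u - 0.5), sq_nonneg (u - 0.32)]
  rcases le_or_gt p (1 / 2) with hp | hp
  · exact ⟨A, isCutoff_of_le_half h0 hp (by omega) hc hcut⟩
  by_cases h7 : n₀ ≤ 7
  · interval_cases n₀
    · refine isCutoff_three (t := 49 / 144) (x := 1 / 6) hp.le h1 (by norm_num) (by norm_num)
        (by norm_num) (by norm_num) (hdiv hp.le (by norm_num) (by norm_num) (by norm_num))
        (fun m n hm hmn hn => relDeficit_le_six h0.le h1.le hm hmn hn) ?_ ?_
      · intro u hu hu'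
        constructor <;> nlinarith [sq_nonneg (u - 0.5), sq_nonneg (u - 0.32)]
      · intro u hu hu'
        constructor <;> nlinarith [sq_nonneg (u - 0.5), sq_nonneg (u - 0.32)]
    · refine isCutoff_three (t := 0.3266) (x := 1 / 7) hp.le h1 (by norm_num) (by norm_num)
        (by norm_num) (by norm_num) (hdiv hp.le (by norm_num) (by norm_num) (by norm_num))
        (fun m n hm hmn hn => relDeficit_le_seven h0.le h1.le hm hmn hn) ?_ ?_
      · intro u hu hu'
        constructor <;> nlinarith [sq_nonneg (u - 0.5), sq_nonneg (u - 0.32)]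
      · intro u hu hu'
        constructor <;> nlinarith [sq_nonneg (u - 0.5), sq_nonneg (u - 0.32)]
  rcases le_or_gt p (3 / 4) with hp' | hp'
  · exact ⟨A, isCutoff_of_le_three_quarters hp.le hp' (by omega) hc hcut⟩
  by_cases h9 : n₀ ≤ 9
  · interval_cases n₀
    · refine isCutoff_three (t := 0.3) (x := 1 / 24) hp.le h1 (by norm_num) (by norm_num)
        (by norm_num) (by norm_num) (hdiv hp'.le (by norm_num) (by norm_num) (by norm_num))
        (fun m n hm hmn hn => relDeficit_le_eight' hp'.le h1.le hm hmn hn) ?_ ?_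
      · intro u hu hu'
        constructor <;> nlinarith [sq_nonneg (u - 0.5), sq_nonneg (u - 0.4)]
      · intro u hu hu'
        constructor <;> nlinarith [sq_nonneg (u - 0.5), sq_nonneg (u - 0.4)]
    · refine isCutoff_three (t := 0.264) (x := 1 / 27) hp.le h1 (by norm_num) (by norm_num)
        (by norm_num) (by norm_num) (hdiv hp'.le (by norm_num) (by norm_num) (by norm_num))
        (fun m n hm hmn hn => relDeficit_le_nine' hp'.le h1.le hm hmn hn) ?_ ?_
      · intro u hu hu'
        constructor <;> nlinarith [sq_nonneg (u - 0.5), sq_nonneg (u - 0.43)]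
      · intro u hu hu'
        constructor <;> nlinarith [sq_nonneg (u - 0.5), sq_nonneg (u - 0.43)]
  exact ⟨A, isCutoff_of_three_quarters_le hp'.le h1 (by omega) hc hcut⟩

/-! ### Balls in graphs of restricted growth -/

section Balls

variable {V : Type*} [Fintype V] (G : SimpleGraph V)

theorem mem_hopBall {r : ℕ} {i j : V} : j ∈ hopBall G r i ↔ G.edist i j ≤ r := by
  simp [hopBall]

theorem mem_hopBall_comm {r : ℕ} {i j : V} : j ∈ hopBall G r i ↔ i ∈ hopBall G r j := by
  rw [mem_hopBall, mem_hopBall, SimpleGraph.edist_comm]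

theorem self_mem_hopBall (r : ℕ) (i : V) : i ∈ hopBall G r i := by simp [mem_hopBall]

theorem mem_hopBall_add {r s : ℕ} {i j k : V} (h : j ∈ hopBall G r i) (h' : k ∈ hopBall G s j) :
    k ∈ hopBall G (r + s) i := by
  rw [mem_hopBall] at *
  push_cast
  exact (SimpleGraph.edist_triangle (v := j)).trans (add_le_add h h')

theorem hopBall_mono {r s : ℕ} (h : r ≤ s) (i : V) : hopBall G r i ⊆ hopBall G s i := by
  intro j hj
  rw [mem_hopBall] at *
  exact hj.trans (by exact_mod_cast h)

/-- A ball of radius `r + 1` consists of the neighbours of a ball of radius `r`. -/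
theorem exists_mem_hopBall_of_succ {r : ℕ} {i k : V} (h : k ∈ hopBall G (r + 1) i) :
    ∃ j ∈ hopBall G r i, k ∈ hopBall G 1 j := by
  rw [mem_hopBall] at h
  have hne : G.edist i k ≠ ⊤ := ne_top_of_le_ne_top (by simp) h
  obtain ⟨w, hw⟩ := SimpleGraph.exists_walk_of_edist_ne_top hne
  have hl : w.length ≤ r + 1 := by rw [← hw] at h; exact_mod_cast h
  rcases Nat.eq_zero_or_pos w.length with h0 | h0
  · obtain rfl := SimpleGraph.Walk.eq_of_length_eq_zero h0
    exact ⟨i, self_mem_hopBall G r i, self_mem_hopBall G 1 i⟩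
  refine ⟨w.penultimate, ?_, ?_⟩
  · rw [mem_hopBall]
    refine (SimpleGraph.edist_le w.dropLast).trans ?_
    rw [SimpleGraph.Walk.length_dropLast]
    exact_mod_cast (by omega : w.length - 1 ≤ r)
  · rw [mem_hopBall]
    have := w.adj_penultimate (by rwa [SimpleGraph.Walk.not_nil_iff_lt_length])
    exact_mod_cast (SimpleGraph.edist_le this.toWalk).trans (by simp)

theorem hopBall_one_card_le [DecidableRel G.Adj] (i : V) :
    (hopBall G 1 i).card ≤ G.maxDegree + 1 := by
  classical
  have h : hopBall G 1 i ⊆ insert i (G.neighborFinset i) := by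
    intro j hj
    rw [mem_hopBall] at hj
    rw [Finset.mem_insert, SimpleGraph.mem_neighborFinset]
    by_contra! hcon
    have h0 : G.edist i j ≠ 0 := fun h => hcon.1 (SimpleGraph.edist_eq_zero_iff.1 h).symm
    have h1 : G.edist i j = 1 := le_antisymm (by exact_mod_cast hj)
      (Order.one_le_iff_pos.2 (pos_iff_ne_zero.2 h0))
    exact hcon.2 (SimpleGraph.edist_eq_one_iff_adj.1 h1)
  refine (Finset.card_le_card h).trans ((Finset.card_insert_le _ _).trans ?_)
  rw [SimpleGraph.card_neighborFinset_eq_degree]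
  exact Nat.add_le_add_right (G.degree_le_maxDegree i) 1

theorem disjoint_hopBall {r s : ℕ} {i j : V} (h : j ∉ hopBall G (r + s) i) :
    Disjoint (hopBall G r i) (hopBall G s j) :=
  Finset.disjoint_left.2 fun _ hk hk' =>
    h (mem_hopBall_add G hk ((mem_hopBall_comm G).1 hk'))

theorem one_le_hopBall_card (r : ℕ) (i : V) : (1 : ℝ) ≤ (hopBall G r i).card := by
  exact_mod_cast (hopBall_nonempty G r i).card_pos

variable {G}

theorem RestrictedGrowth.one_le [Nonempty V] {κ : ℝ} (h : RestrictedGrowth G κ) : 1 ≤ κ := by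
  obtain ⟨i⟩ := ‹Nonempty V›
  have h1 := h i 1 le_rfl
  have h2 : ((hopBall G 1 i).card : ℝ) ≤ (hopBall G (1 + 1) i).card := by
    exact_mod_cast Finset.card_le_card (hopBall_mono G (by norm_num) i)
  have h3 := one_le_hopBall_card G 1 i
  by_contra! hcon
  nlinarith

theorem RestrictedGrowth.card_two_le [DecidableRel G.Adj] [Nonempty V] {κ : ℝ}
    (h : RestrictedGrowth G κ) (i : V) :
    ((hopBall G 2 i).card : ℝ) ≤ κ * (G.maxDegree + 1) := by
  refine (h i 1 le_rfl).trans (mul_le_mul_of_nonneg_left ?_ (by linarith [h.one_le]))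
  exact_mod_cast hopBall_one_card_le G i

theorem RestrictedGrowth.card_four_le [Nonempty V] {κ : ℝ} (h : RestrictedGrowth G κ) (i : V) :
    ((hopBall G 4 i).card : ℝ) ≤ κ ^ 2 * (hopBall G 2 i).card := by
  have h1 := h.one_le
  calc ((hopBall G 4 i).card : ℝ) ≤ κ * (hopBall G 3 i).card := h i 3 (by norm_num)
    _ ≤ κ * (κ * (hopBall G 2 i).card) :=
        mul_le_mul_of_nonneg_left (h i 2 (by norm_num)) (by linarith)
    _ = _ := by ring

/-- Outside disjoint unions of cliques the growth coefficient is bounded away from `1`. -/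
theorem RestrictedGrowth.le_of_not_clique [DecidableRel G.Adj] [Nonempty V] {κ : ℝ}
    (h : RestrictedGrowth G κ) (hne : ∃ i, hopBall G 2 i ≠ hopBall G 1 i) :
    1 + 1 / (G.maxDegree + 1 : ℝ) ≤ κ ∧ 2 ≤ G.maxDegree := by
  obtain ⟨i, hi⟩ := hne
  have hss : hopBall G 1 i ⊂ hopBall G 2 i :=
    Finset.ssubset_iff_subset_ne.2 ⟨hopBall_mono G (by norm_num) i, hi.symm⟩
  have hc : ((hopBall G 1 i).card : ℝ) + 1 ≤ (hopBall G 2 i).card := by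
    exact_mod_cast Finset.card_lt_card hss
  have h1 := h i 1 le_rfl
  have hD : ((hopBall G 1 i).card : ℝ) ≤ G.maxDegree + 1 := by
    exact_mod_cast hopBall_one_card_le G i
  have hpos := one_le_hopBall_card G 1 i
  constructor
  · have h2 : 1 + 1 / ((hopBall G 1 i).card : ℝ) ≤ κ := by
      have : (1 + 1 / ((hopBall G 1 i).card : ℝ)) * (hopBall G 1 i).card ≤
          κ * (hopBall G 1 i).card := by
        have e : (1 + 1 / ((hopBall G 1 i).card : ℝ)) * (hopBall G 1 i).card =
          (hopBall G 1 i).card + 1 := by field_simp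
        rw [e]; exact hc.trans h1
      exact le_of_mul_le_mul_right this (by linarith)
    refine le_trans ?_ h2
    gcongr
  · classical
    obtain ⟨k, hk, hk'⟩ := Finset.exists_of_ssubset hss
    obtain ⟨j, hj, hkj⟩ := exists_mem_hopBall_of_succ G hk
    have hji : j ≠ i := by rintro rfl; exact hk' hkj
    have hjk : j ≠ k := by rintro rfl; exact hk' hj
    have hik : i ≠ k := by rintro rfl; exact hk' (self_mem_hopBall G 1 _)
    have hsub : ({i, j, k} : Finset V) ⊆ hopBall G 1 j := by
      intro l hl
      simp only [Finset.mem_insert, Finset.mem_singleton] at hl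
      rcases hl with rfl | rfl | rfl
      · exact (mem_hopBall_comm G).1 hj
      · exact self_mem_hopBall G 1 _
      · exact hkj
    have h3 := Finset.card_le_card hsub
    rw [Finset.card_eq_three.2 ⟨i, j, k, hji.symm, hik, hjk, rfl⟩] at h3
    have := hopBall_one_card_le G j
    omega

/-- If the 2-hop balls are not yet whole components, then some node has another node at distance
exactly three, and the two disjoint 1-hop balls around them give a growth by a factor of two. -/
theorem RestrictedGrowth.two_le_cube [Nonempty V] {κ : ℝ} (h : RestrictedGrowth G κ)
    (hne : ∃ i, hopBall G 4 i ≠ hopBall G 2 i) : 2 ≤ κ ^ 3 := by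
  have hκ := h.one_le
  obtain ⟨i, hi⟩ := hne
  have hss : ¬ hopBall G 3 i ⊆ hopBall G 2 i := by
    intro hsub
    refine hi (Finset.Subset.antisymm ?_ (hopBall_mono G (by norm_num) i))
    intro k hk
    obtain ⟨j, hj, hkj⟩ := exists_mem_hopBall_of_succ G hk
    exact hsub (mem_hopBall_add G (hsub hj) hkj)
  obtain ⟨j, hj, hj'⟩ := Finset.not_subset.1 hss
  have key : ∀ i j : V, j ∈ hopBall G 3 i → j ∉ hopBall G 2 i →
      (hopBall G 1 i).card ≤ (hopBall G 1 j).card → 2 ≤ κ ^ 3 := by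
    intro i j hj hj' hc
    classical
    have hsub : hopBall G 1 i ∪ hopBall G 1 j ⊆ hopBall G 4 i :=
      Finset.union_subset (hopBall_mono G (by norm_num) i)
        fun k hk => mem_hopBall_add G hj hk
    have h1 := Finset.card_le_card hsub
    rw [Finset.card_union_of_disjoint (disjoint_hopBall G hj')] at h1
    have h2 : (2 : ℝ) * (hopBall G 1 i).card ≤ (hopBall G 4 i).card := by
      exact_mod_cast (by omega : 2 * (hopBall G 1 i).card ≤ (hopBall G 4 i).card)
    have h3 := h.card_four_le i
    have h4 := mul_le_mul_of_nonneg_left (h i 1 le_rfl) (sq_nonneg κ)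
    have h5 := one_le_hopBall_card G 1 i
    norm_num at h4
    have h6 : 2 * ((hopBall G 1 i).card : ℝ) ≤ κ ^ 3 * (hopBall G 1 i).card := by
      calc _ ≤ _ := h2
        _ ≤ _ := h3
        _ ≤ _ := h4
        _ = _ := by ring
    exact le_of_mul_le_mul_right h6 (by linarith)
  rcases le_total (hopBall G 1 i).card (hopBall G 1 j).card with hc | hc
  · exact key i j hj hj' hc
  · exact key j i ((mem_hopBall_comm G).1 hj) (fun hh => hj' ((mem_hopBall_comm G).1 hh)) hc

end Balls

/-! ### The combinatorics of 1-hop-max clusters -/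

section Clusters

variable {V : Type*} [Fintype V] (G : SimpleGraph V) (x : V → ℝ)

/-- The number of clusters: clusters correspond to the values of the 1-hop maximum. -/
noncomputable def clusterCount : ℕ := (Finset.univ.image (oneHopMax G x)).card

/-- The number of clusters that meet `S`. -/
noncomputable def clusterHits (S : Finset V) : ℕ := (S.image (oneHopMax G x)).card

/-- The rank of the number of node `i` among the numbers in `B_2(i)`, counted from the top. -/
noncomputable def rank (i : V) : ℕ := ((hopBall G 2 i).filter fun l => x i ≤ x l).card

theorem le_oneHopMax {i j : V} (h : j ∈ hopBall G 1 i) : x j ≤ oneHopMax G x i :=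
  Finset.le_sup' x h

theorem exists_eq_oneHopMax (i : V) : ∃ l ∈ hopBall G 1 i, oneHopMax G x i = x l :=
  Finset.exists_mem_eq_sup' (hopBall_nonempty G 1 i) x

theorem clusterHits_mono {S T : Finset V} (h : S ⊆ T) : clusterHits G x S ≤ clusterHits G x T :=
  Finset.card_le_card (Finset.image_subset_image h)

theorem clusterHits_le_clusterCount (S : Finset V) : clusterHits G x S ≤ clusterCount G x :=
  clusterHits_mono G x (Finset.subset_univ S)

theorem clusterHits_pos {S : Finset V} (h : S.Nonempty) : 0 < clusterHits G x S :=
  (h.image _).card_pos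

theorem clusterCount_pos [Nonempty V] : 0 < clusterCount G x :=
  clusterHits_pos G x Finset.univ_nonempty

theorem rank_le (i : V) : rank G x i ≤ (hopBall G 2 i).card := Finset.card_filter_le _ _

/-- The label of a cluster that meets `B_1(i)` is the number of a node of `B_2(i)`, and it is at
least that of `i`. -/
theorem mem_image_oneHopMax {i : V} {v : ℝ} (h : v ∈ (hopBall G 1 i).image (oneHopMax G x)) :
    ∃ l ∈ hopBall G 2 i, x i ≤ x l ∧ v = x l := by
  obtain ⟨k, hk, rfl⟩ := Finset.mem_image.1 h
  obtain ⟨l, hl, e⟩ := exists_eq_oneHopMax G x k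
  exact ⟨l, mem_hopBall_add G hk hl, e ▸ le_oneHopMax G x ((mem_hopBall_comm G).1 hk), e⟩

theorem clusterHits_le_rank (i : V) : clusterHits G x (hopBall G 1 i) ≤ rank G x i := by
  have : (hopBall G 1 i).image (oneHopMax G x) ⊆
      ((hopBall G 2 i).filter fun l => x i ≤ x l).image x := by
    intro v hv
    obtain ⟨l, hl, hle, rfl⟩ := mem_image_oneHopMax G x hv
    exact Finset.mem_image_of_mem x (Finset.mem_filter.2 ⟨hl, hle⟩)
  exact (Finset.card_le_card this).trans Finset.card_image_le

theorem clusterHits_eq_one_of_rank {i : V} (h : rank G x i = 1) :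
    clusterHits G x (hopBall G 1 i) = 1 :=
  le_antisymm (h ▸ clusterHits_le_rank G x i) (clusterHits_pos G x (hopBall_nonempty G 1 i))

/-- A node of rank one has the strictly largest number in its 2-hop ball. -/
theorem rank_eq_one_iff {i : V} : rank G x i = 1 ↔ ∀ l ∈ hopBall G 2 i, l ≠ i → x l < x i := by
  unfold rank
  rw [Finset.card_eq_one]
  constructor
  · rintro ⟨k, hk⟩ l hl hli
    by_contra! hcon
    have h1 : l ∈ ((hopBall G 2 i).filter fun l => x i ≤ x l) := Finset.mem_filter.2 ⟨hl, hcon⟩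
    have h2 : i ∈ ((hopBall G 2 i).filter fun l => x i ≤ x l) := by simp [self_mem_hopBall]
    rw [hk, Finset.mem_singleton] at h1 h2
    exact hli (h1.trans h2.symm)
  · intro h
    refine ⟨i, Finset.eq_singleton_iff_unique_mem.2 ⟨by simp [self_mem_hopBall], ?_⟩⟩
    intro l hl
    rw [Finset.mem_filter] at hl
    by_contra hne
    exact absurd hl.2 (not_le.2 (h l hl.1 hne))

theorem oneHopMax_of_rank {i : V} (h : rank G x i = 1) : oneHopMax G x i = x i := by
  obtain ⟨l, hl, e⟩ := exists_eq_oneHopMax G x i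
  rw [e]
  by_contra hne
  have hli : l ≠ i := by rintro rfl; exact hne rfl
  have := (rank_eq_one_iff G x).1 h l (hopBall_mono G (by norm_num) i hl) hli
  linarith [e ▸ le_oneHopMax G x (self_mem_hopBall G 1 i)]

/-- Two distinct nodes within distance two cannot both have rank one. -/
theorem not_rank_eq_one {i j : V} (hj : j ∈ hopBall G 2 i) (hij : j ≠ i)
    (hi : rank G x i = 1) : rank G x j ≠ 1 := by
  intro h
  have h1 := (rank_eq_one_iff G x).1 hi j hj hij
  have h2 := (rank_eq_one_iff G x).1 h i ((mem_hopBall_comm G).1 hj) hij.symm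
  linarith

variable {x}

/-- The 1-hop balls of far nodes meet disjoint sets of clusters. -/
theorem oneHopMax_disjoint (hx : Function.Injective x) {i j : V} (h : j ∉ hopBall G 4 i) :
    Disjoint ((hopBall G 1 i).image (oneHopMax G x)) ((hopBall G 1 j).image (oneHopMax G x)) := by
  rw [Finset.disjoint_left]
  intro v hv hv'
  obtain ⟨l, hl, -, rfl⟩ := mem_image_oneHopMax G x hv
  obtain ⟨l', hl', -, e⟩ := mem_image_oneHopMax G x hv'
  obtain rfl := hx e
  exact Finset.disjoint_left.1 (disjoint_hopBall G (r := 2) (s := 2) h) hl hl'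

theorem clusterHits_union_of_far [DecidableEq V] (hx : Function.Injective x) {i j : V}
    (h : j ∉ hopBall G 4 i) :
    clusterHits G x (hopBall G 1 i ∪ hopBall G 1 j) =
      clusterHits G x (hopBall G 1 i) + clusterHits G x (hopBall G 1 j) := by
  unfold clusterHits
  rw [Finset.image_union, Finset.card_union_of_disjoint (oneHopMax_disjoint G hx h)]

/-- Each cluster, represented by the node whose number is its label, meets only the 1-hop balls of
the nodes in the 2-hop ball of the representative. -/
theorem sum_clusterHits_le (hx : Function.Injective x) {N : ℝ}
    (hN : ∀ i, ((hopBall G 2 i).card : ℝ) ≤ N) :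
    ∑ j, (clusterHits G x (hopBall G 1 j) : ℝ) ≤ N * clusterCount G x := by
  classical
  have e : ∀ j, (clusterHits G x (hopBall G 1 j) : ℝ) =
      ∑ v ∈ Finset.univ.image (oneHopMax G x),
        if v ∈ (hopBall G 1 j).image (oneHopMax G x) then (1 : ℝ) else 0 := by
    intro j
    rw [Finset.sum_ite_mem, Finset.inter_eq_right.2
      (Finset.image_subset_image (Finset.subset_univ _))]
    simp [clusterHits]
  simp_rw [e]
  rw [Finset.sum_comm]
  calc ∑ v ∈ Finset.univ.image (oneHopMax G x),
        ∑ j, (if v ∈ (hopBall G 1 j).image (oneHopMax G x) then (1 : ℝ) else 0)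
      ≤ ∑ v ∈ Finset.univ.image (oneHopMax G x), N := by
        refine Finset.sum_le_sum fun v hv => ?_
        obtain ⟨k, -, rfl⟩ := Finset.mem_image.1 hv
        obtain ⟨l, hl, e⟩ := exists_eq_oneHopMax G x k
        rw [Finset.sum_boole]
        refine le_trans ?_ (hN l)
        refine Nat.cast_le.2 (Finset.card_le_card fun j hj => ?_)
        rw [Finset.mem_filter] at hj
        obtain ⟨l', hl', -, e'⟩ := mem_image_oneHopMax G x hj.2
        rw [e] at e'
        obtain rfl := hx e'
        exact (mem_hopBall_comm G).1 hl'
    _ = N * clusterCount G x := by rw [Finset.sum_const, nsmul_eq_mul, mul_comm]; rfl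

/-- The nodes far from `i` lie in clusters other than that of `i`, and a cluster is contained in the
1-hop ball of its representative. -/
theorem card_far_le [DecidableEq V] [DecidableRel G.Adj] (hx : Function.Injective x) (i : V) :
    ((hopBall G 4 i)ᶜ : Finset V).card ≤ (clusterCount G x - 1) * (G.maxDegree + 1) := by
  set I := (Finset.univ.image (oneHopMax G x)).erase (oneHopMax G x i) with hI
  have hIc : I.card = clusterCount G x - 1 :=
    Finset.card_erase_of_mem (Finset.mem_image_of_mem _ (Finset.mem_univ i))
  rw [← hIc, mul_comm]
  refine Finset.card_le_mul_card_image_of_maps_to (f := oneHopMax G x) ?_ _ ?_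
  · intro j hj
    rw [Finset.mem_compl] at hj
    refine Finset.mem_erase.2 ⟨fun e => ?_, Finset.mem_image_of_mem _ (Finset.mem_univ j)⟩
    exact Finset.disjoint_left.1 (oneHopMax_disjoint G hx hj)
      (Finset.mem_image_of_mem _ (self_mem_hopBall G 1 i))
      (e ▸ Finset.mem_image_of_mem _ (self_mem_hopBall G 1 j))
  · intro v hv
    obtain ⟨k, -, rfl⟩ := Finset.mem_image.1 (Finset.mem_of_mem_erase hv)
    obtain ⟨l, hl, e⟩ := exists_eq_oneHopMax G x k
    refine (Finset.card_le_card fun j hj => ?_).trans (hopBall_one_card_le G l)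
    rw [Finset.mem_filter] at hj
    obtain ⟨l', hl', e'⟩ := exists_eq_oneHopMax G x j
    rw [← hj.2, e'] at e
    obtain rfl := hx e
    exact (mem_hopBall_comm G).1 hl'

/-- In a disjoint union of cliques every 1-hop ball lies in a single cluster. -/
theorem clusterHits_eq_one_of_clique (h : ∀ i, hopBall G 2 i = hopBall G 1 i) (i : V) :
    clusterHits G x (hopBall G 1 i) = 1 := by
  refine le_antisymm (Finset.card_le_one.2 ?_) (clusterHits_pos G x (hopBall_nonempty G 1 i))
  have key : ∀ j k : V, j ∈ hopBall G 1 i → k ∈ hopBall G 1 i →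
      oneHopMax G x j ≤ oneHopMax G x k := by
    intro j k hj hk
    obtain ⟨l, hl, e⟩ := exists_eq_oneHopMax G x j
    rw [e]
    have h1 : l ∈ hopBall G 1 i := by rw [← h i]; exact mem_hopBall_add G hj hl
    have h2 : l ∈ hopBall G 1 k := by
      rw [← h k]; exact mem_hopBall_add G ((mem_hopBall_comm G).1 hk) h1
    exact le_oneHopMax G x h2
  intro v hv w hw
  obtain ⟨j, hj, rfl⟩ := Finset.mem_image.1 hv
  obtain ⟨k, hk, rfl⟩ := Finset.mem_image.1 hw
  exact le_antisymm (key j k hj hk) (key k j hk hj)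

end Clusters

/-! ### Independent uniform numbers -/

/-- A random variable with values in the unit interval. -/
structure IsUnitVariable {Ω : Type*} [MeasurableSpace Ω] (F : Ω → ℝ) : Prop where
  measurable : Measurable F
  nonneg : ∀ x, 0 ≤ F x
  le_one : ∀ x, F x ≤ 1

namespace IsUnitVariable

variable {Ω : Type*} [MeasurableSpace Ω] {F F' : Ω → ℝ} {μ : Measure Ω}

theorem integrable [IsFiniteMeasure μ] (h : IsUnitVariable F) : Integrable F μ :=
  Integrable.of_bound h.measurable.aestronglyMeasurable 1
    (Filter.Eventually.of_forall fun x => by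
      rw [Real.norm_of_nonneg (h.nonneg x)]; exact h.le_one x)

theorem mul (h : IsUnitVariable F) (h' : IsUnitVariable F') :
    IsUnitVariable fun x => F x * F' x :=
  ⟨h.measurable.mul h'.measurable, fun x => mul_nonneg (h.nonneg x) (h'.nonneg x),
    fun x => mul_le_one₀ (h.le_one x) (h'.nonneg x) (h'.le_one x)⟩

theorem sub (h : IsUnitVariable F) (h' : IsUnitVariable F') (hle : ∀ x, F' x ≤ F x) :
    IsUnitVariable fun x => F x - F' x :=
  ⟨h.measurable.sub h'.measurable, fun x => sub_nonneg.2 (hle x),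
    fun x => by have := h.le_one x; have := h'.nonneg x; linarith⟩

theorem integral_nonneg (h : IsUnitVariable F) : 0 ≤ ∫ x, F x ∂μ :=
  MeasureTheory.integral_nonneg h.nonneg

theorem integral_mono_ae [IsFiniteMeasure μ] (h : IsUnitVariable F) (h' : IsUnitVariable F')
    (hle : ∀ᵐ x ∂μ, F x ≤ F' x) : ∫ x, F x ∂μ ≤ ∫ x, F' x ∂μ :=
  MeasureTheory.integral_mono_ae h.integrable h'.integrable hle

end IsUnitVariable

section Uniform

variable {V : Type*} [Fintype V]

/-- The numbers are almost surely pairwise distinct, as each hyperplane `x i = x j` is a null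
set. -/
theorem ae_injective : ∀ᵐ x ∂uniformNumbers V, Function.Injective x := by
  have hle : uniformNumbers V ≤ volume := by
    unfold uniformNumbers
    rw [← Measure.restrict_pi_pi]
    exact Measure.restrict_le_self
  have h : ∀ i j : V, i ≠ j → ∀ᵐ x ∂uniformNumbers V, x i ≠ x j := by
    intro i j hij
    classical
    let W : Submodule ℝ (V → ℝ) := LinearMap.ker
      (LinearMap.proj (R := ℝ) (φ := fun _ : V => ℝ) i - LinearMap.proj j)
    have hW : W ≠ ⊤ := by
      intro hW
      have : (Pi.single i 1 : V → ℝ) ∈ W := hW ▸ Submodule.mem_top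
      simp [W, hij.symm] at this
    have h0 := Measure.addHaar_submodule (volume : Measure (V → ℝ)) W hW
    have : {x : V → ℝ | ¬ x i ≠ x j} = W := by
      ext x; simp [W, sub_eq_zero]
    rw [ae_iff, this]
    exact le_antisymm ((hle _).trans h0.le) bot_le
  have h2 : ∀ᵐ x ∂uniformNumbers V, ∀ i j : V, i ≠ j → x i ≠ x j := by
    rw [ae_all_iff]; intro i
    rw [ae_all_iff]; intro j
    by_cases hij : i = j
    · simp [hij]
    · filter_upwards [h i j hij] with x hx _ using hx
  filter_upwards [h2] with x hx i j hij
  by_contra hne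
  exact hx i j hne hij

theorem exists_injective : ∃ x : V → ℝ, Function.Injective x :=
  (ae_injective (V := V)).exists

/-- Random variables that depend on the numbers of disjoint sets of nodes are independent. -/
theorem integral_mul_of_dependsOn {F F' : (V → ℝ) → ℝ} (hF : Measurable F) (hF' : Measurable F')
    {S T : Finset V} (hS : DependsOn F S) (hT : DependsOn F' T) (hd : Disjoint S T) :
    ∫ x, F x * F' x ∂uniformNumbers V =
      (∫ x, F x ∂uniformNumbers V) * ∫ x, F' x ∂uniformNumbers V := by
  classical
  have : IsProbabilityMeasure ((volume : Measure ℝ).restrict (Set.Ioo (0 : ℝ) 1)) := ⟨by simp⟩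
  have hI : iIndepFun (fun (i : V) (x : V → ℝ) => x i) (uniformNumbers V) :=
    iIndepFun_pi (X := fun _ => id) (fun _ => aemeasurable_id)
  have hI2 := hI.indepFun_finset S T hd (fun i => measurable_pi_apply i)
  let ext : ∀ S : Finset V, (S → ℝ) → V → ℝ := fun S y l => if h : l ∈ S then y ⟨l, h⟩ else 0
  have hext : ∀ S, Measurable (ext S) := by
    intro S
    refine measurable_pi_lambda _ fun l => ?_
    by_cases h : l ∈ S
    · simpa [ext, h] using measurable_pi_apply _
    · simp [ext, h]
  have h1 : F = (F ∘ ext S) ∘ fun x (i : S) => x i := by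
    funext x
    refine hS fun i hi => ?_
    simp [ext, Finset.mem_coe.1 hi]
  have h2 : F' = (F' ∘ ext T) ∘ fun x (i : T) => x i := by
    funext x
    refine hT fun i hi => ?_
    simp [ext, Finset.mem_coe.1 hi]
  have hI3 : IndepFun F F' (uniformNumbers V) := by
    rw [h1, h2]
    exact hI2.comp (hF.comp (hext S)) (hF'.comp (hext T))
  exact hI3.integral_mul_eq_mul_integral hF.aestronglyMeasurable hF'.aestronglyMeasurable

theorem integral_comp_perm (F : (V → ℝ) → ℝ) (σ : Equiv.Perm V) :
    ∫ x, F (x ∘ σ) ∂uniformNumbers V = ∫ x, F x ∂uniformNumbers V := by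
  have : IsProbabilityMeasure ((volume : Measure ℝ).restrict (Set.Ioo (0 : ℝ) 1)) := ⟨by simp⟩
  have h := measurePreserving_piCongrLeft
    (fun _ : V => (volume : Measure ℝ).restrict (Set.Ioo (0 : ℝ) 1)) σ.symm
  have e : (fun x : V → ℝ => x ∘ σ) = MeasurableEquiv.piCongrLeft (fun _ : V => ℝ) σ.symm := by
    funext x i
    have := MeasurableEquiv.piCongrLeft_apply_apply (β := fun _ : V => ℝ) (e := σ.symm) x (σ i)
    simpa using this.symm
  have h2 := h.integral_comp (MeasurableEquiv.measurableEmbedding _) F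
  unfold uniformNumbers
  rw [← h2, ← e]

/-- Symmetrization: if the variables `Φ k`, `k ∈ S`, arise from each other by exchanging the
numbers of two nodes, then they have the same expectation. -/
theorem card_mul_integral [DecidableEq V] {Φ : V → (V → ℝ) → ℝ} {S : Finset V} {i : V}
    (hΦ : ∀ k ∈ S, IsUnitVariable (Φ k))
    (h : ∀ k ∈ S, ∀ x : V → ℝ, Φ i (x ∘ Equiv.swap i k) = Φ k x) :
    S.card * ∫ x, Φ i x ∂uniformNumbers V = ∫ x, ∑ k ∈ S, Φ k x ∂uniformNumbers V := by
  rw [integral_finsetSum _ fun k hk => (hΦ k hk).integrable, ← nsmul_eq_mul,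
    ← Finset.sum_const]
  refine Finset.sum_congr rfl fun k hk => ?_
  rw [← integral_comp_perm _ (Equiv.swap i k)]
  simp_rw [h k hk]

end Uniform

section Ranks

theorem swap_apply_mem {V : Type*} [DecidableEq V] {S : Finset V} {i k l : V} (hi : i ∈ S)
    (hk : k ∈ S) (hl : l ∈ S) : Equiv.swap i k l ∈ S := by
  by_cases hli : l = i
  · rwa [hli, Equiv.swap_apply_left]
  by_cases hlk : l = k
  · rwa [hlk, Equiv.swap_apply_right]
  rwa [Equiv.swap_apply_of_ne_of_ne hli hlk]

theorem measurable_card_filter_le {V : Type*} (S : Finset V) (i : V) :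
    Measurable fun x : V → ℝ => (S.filter fun l => x i ≤ x l).card := by
  simp_rw [Finset.card_filter]
  exact Finset.measurable_sum _ fun l _ => Measurable.ite
    (measurableSet_le (measurable_pi_apply i) (measurable_pi_apply l)) measurable_const
    measurable_const

variable {V : Type*} [Fintype V] (G : SimpleGraph V)

theorem clusterHits_eq_card_image_mk (x : V → ℝ) (S : Finset V)
    [DecidableEq (Quotient (oneHopMaxClustering G x))] :
    clusterHits G x S = (S.image (Quotient.mk (oneHopMaxClustering G x))).card := by
  unfold clusterHits
  let φ := Quotient.lift (s := oneHopMaxClustering G x) (oneHopMax G x) fun a b h => h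
  have hφ : Function.Injective φ := by
    intro a b
    induction a using Quotient.inductionOn
    induction b using Quotient.inductionOn
    intro h
    exact Quotient.sound h
  rw [← Finset.card_image_of_injective _ hφ, Finset.image_image]
  rfl

theorem measurable_clusterHits (S : Finset V) :
    Measurable fun x : V → ℝ => clusterHits G x S := by
  classical
  have hfin : Finite (Setoid V) :=
    Finite.of_injective (fun (c : Setoid V) (i j : V) => c i j)
      fun a b h => Setoid.ext fun i j => iff_of_eq (congrFun (congrFun h i) j)
  refine measurable_to_countable' fun n => ?_
  have h : (fun x : V → ℝ => clusterHits G x S) ⁻¹' {n} =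
      ⋃ c : {c : Setoid V // (S.image (Quotient.mk c)).card = n},
        {x | oneHopMaxClustering G x = c} := by
    ext x
    simp only [Set.mem_preimage, Set.mem_singleton_iff, Set.mem_iUnion,
      clusterHits_eq_card_image_mk]
    constructor
    · intro h; exact ⟨⟨_, h⟩, rfl⟩
    · rintro ⟨⟨c, hc⟩, h⟩
      change oneHopMaxClustering G x = c at h
      subst h; exact hc
  rw [h]
  exact MeasurableSet.iUnion fun c => measurableSet_oneHopMaxClustering_eq G c

theorem measurable_clusterCount : Measurable fun x : V → ℝ => clusterCount G x :=
  measurable_clusterHits G Finset.univ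

theorem measurable_rank (i : V) : Measurable fun x : V → ℝ => rank G x i :=
  measurable_card_filter_le _ i

theorem measurable_of_hits_rank (φ : ℕ → ℕ → ℕ → ℝ) (S : Finset V) (i : V) :
    Measurable fun x : V → ℝ => φ (clusterCount G x) (clusterHits G x S) (rank G x i) :=
  (measurable_of_countable fun z : ℕ × ℕ × ℕ => φ z.1 z.2.1 z.2.2).comp
    ((measurable_clusterCount G).prodMk ((measurable_clusterHits G S).prodMk (measurable_rank G i)))

/-- The number of clusters that meet `B_1(i)` and the rank of `i` are local quantities. -/
theorem dependsOn_hits_rank (φ : ℕ → ℕ → ℝ) (i : V) :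
    DependsOn (fun x : V → ℝ => φ (clusterHits G x (hopBall G 1 i)) (rank G x i))
      (hopBall G 2 i : Set V) := by
  intro x y h
  have h1 : ∀ k ∈ hopBall G 1 i, oneHopMax G x k = oneHopMax G y k := by
    intro k hk
    refine Finset.sup'_congr _ rfl fun l hl => h l ?_
    exact mem_hopBall_add G hk hl
  have h2 : clusterHits G x (hopBall G 1 i) = clusterHits G y (hopBall G 1 i) := by
    unfold clusterHits
    rw [Finset.image_congr h1]
  have h3 : rank G x i = rank G y i := by
    unfold rank
    congr 1
    refine Finset.filter_congr fun l hl => ?_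
    rw [h i (self_mem_hopBall G 2 i), h l hl]
  simp only [h2, h3]

/-- The rank of a node is uniformly distributed. -/
theorem card_mul_integral_rank {h : ℕ → ℝ} (h0 : ∀ r, 0 ≤ h r) (h1 : ∀ r, h r ≤ 1) (i : V) :
    (hopBall G 2 i).card * ∫ x, h (rank G x i) ∂uniformNumbers V =
      ∑ r ∈ Finset.range (hopBall G 2 i).card, h (r + 1) := by
  classical
  set S := hopBall G 2 i with hS
  have hi : i ∈ S := self_mem_hopBall G 2 i
  have := card_mul_integral (S := S) (i := i)
    (Φ := fun k x => h (S.filter fun l => x k ≤ x l).card)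
    (fun k _ => ⟨(measurable_of_countable h).comp (measurable_card_filter_le S k),
      fun x => h0 _, fun x => h1 _⟩) (by
      intro k hk x
      simp only [Function.comp_apply, Equiv.swap_apply_left]
      congr 1
      refine Finset.card_bij (fun l _ => Equiv.swap i k l) ?_ ?_ ?_
      · intro l hl
        rw [Finset.mem_filter] at hl ⊢
        exact ⟨swap_apply_mem hi hk hl.1, hl.2⟩
      · intro a _ b _ e; exact (Equiv.swap i k).injective e
      · intro l hl
        rw [Finset.mem_filter] at hl
        refine ⟨Equiv.swap i k l, ?_, Equiv.swap_apply_self _ _ _⟩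
        rw [Finset.mem_filter, Equiv.swap_apply_self]
        exact ⟨swap_apply_mem hi hk hl.1, hl.2⟩)
  refine this.trans ?_
  -- for pairwise distinct numbers the ranks of the nodes of `S` are exactly `1, …, |S|`
  have hae : ∀ᵐ x ∂uniformNumbers V, ∑ k ∈ S, h (S.filter fun l => x k ≤ x l).card =
      ∑ r ∈ Finset.range S.card, h (r + 1) := by
    filter_upwards [ae_injective] with x hx
    have hlt : ∀ a ∈ S, ∀ b ∈ S, x a < x b →
        (S.filter fun l => x b ≤ x l).card < (S.filter fun l => x a ≤ x l).card := by
      intro a ha b hb hab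
      refine Finset.card_lt_card (Finset.ssubset_iff_subset_ne.2 ⟨?_, ?_⟩)
      · intro l hl
        rw [Finset.mem_filter] at hl ⊢
        exact ⟨hl.1, hab.le.trans hl.2⟩
      · intro e
        have : a ∈ S.filter fun l => x a ≤ x l := Finset.mem_filter.2 ⟨ha, le_rfl⟩
        rw [← e, Finset.mem_filter] at this
        linarith [this.2]
    have hinj : Set.InjOn (fun k => (S.filter fun l => x k ≤ x l).card - 1) S := by
      intro a ha b hb e
      have hpos : ∀ c ∈ S, 0 < (S.filter fun l => x c ≤ x l).card := fun c hc =>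
        Finset.card_pos.2 ⟨c, Finset.mem_filter.2 ⟨hc, le_rfl⟩⟩
      have pa := hpos a ha
      have pb := hpos b hb
      simp only at e
      by_contra hne
      rcases lt_or_gt_of_ne (fun hh => hne (hx hh) : x a ≠ x b) with hl | hl
      · have := hlt a ha b hb hl; omega
      · have := hlt b hb a ha hl; omega
    have himg : S.image (fun k => (S.filter fun l => x k ≤ x l).card - 1) =
        Finset.range S.card := by
      refine Finset.eq_of_subset_of_card_le ?_ ?_
      · intro r hr
        obtain ⟨k, hk, rfl⟩ := Finset.mem_image.1 hr
        have h1 := Finset.card_filter_le S fun l => x k ≤ x l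
        have h2 : 0 < S.card := Finset.card_pos.2 ⟨k, hk⟩
        rw [Finset.mem_range]; omega
      · rw [Finset.card_image_of_injOn hinj, Finset.card_range]
    rw [← himg, Finset.sum_image hinj]
    refine Finset.sum_congr rfl fun k hk => ?_
    congr 1
    have : 0 < (S.filter fun l => x k ≤ x l).card :=
      Finset.card_pos.2 ⟨k, Finset.mem_filter.2 ⟨hk, le_rfl⟩⟩
    omega
  rw [integral_congr_ae hae]
  simp

/-- The indicator of the event that node `i` has the largest number in its 2-hop ball. -/
noncomputable def localMax (i : V) (x : V → ℝ) : ℝ := if rank G x i = 1 then 1 else 0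

theorem isUnitVariable_localMax (i : V) : IsUnitVariable (localMax G i) := by
  refine ⟨(measurable_of_countable fun r : ℕ => if r = 1 then (1 : ℝ) else 0).comp
    (measurable_rank G i), ?_, ?_⟩
  · intro x; unfold localMax; split_ifs <;> norm_num
  · intro x; unfold localMax; split_ifs <;> norm_num

theorem integral_localMax (i : V) :
    ∫ x, localMax G i x ∂uniformNumbers V = 1 / (hopBall G 2 i).card := by
  have h := card_mul_integral_rank G (h := fun r => if r = 1 then 1 else 0)
    (fun r => by split_ifs <;> norm_num) (fun r => by split_ifs <;> norm_num) i
  have hc := one_le_hopBall_card G 2 i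
  have e : ∫ x, localMax G i x ∂uniformNumbers V =
      ∫ x, (if rank G x i = 1 then (1 : ℝ) else 0) ∂uniformNumbers V := by
    simp only [localMax]
  rw [e, eq_div_iff (by linarith), mul_comm, h]
  simp only [Nat.add_eq_right, Finset.sum_ite_eq', Finset.mem_range]
  exact if_pos (hopBall_nonempty G 2 i).card_pos

theorem localMax_of_rank {i : V} {x : V → ℝ} (h : rank G x i = 1) : localMax G i x = 1 := if_pos h

theorem localMax_of_rank_ne {i : V} {x : V → ℝ} (h : rank G x i ≠ 1) : localMax G i x = 0 :=
  if_neg h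

/-- Two local maxima that are not within distance two: once the largest number in the union of the
balls `B_2(i)` and `B_2(j)` is that of `i`, each node of `B_2(j)` is equally likely to have the
largest number in `B_2(j)`. -/
theorem integral_localMax_mul_lt {i j : V} (h : j ∉ hopBall G 2 i) :
    (hopBall G 2 i).card * ((hopBall G 2 j).card *
      ∫ x, (if x j < x i then localMax G i x * localMax G j x else 0) ∂uniformNumbers V) ≤ 1 := by
  classical
  set S := hopBall G 2 j with hS
  set U := hopBall G 2 i ∪ S with hU
  have hj : j ∈ S := self_mem_hopBall G 2 j
  have hiS : i ∉ S := fun hh => h ((mem_hopBall_comm G).1 hh)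
  -- `E k`: the largest number of `U` is that of `i`, and the largest number of `S` is that of `k`
  let E : V → Set (V → ℝ) := fun k =>
    {x | (∀ l ∈ U, l ≠ i → x l < x i) ∧ ∀ l ∈ S, l ≠ k → x l < x k}
  have hmeas : ∀ (W : Finset V) (k : V),
      MeasurableSet {x : V → ℝ | ∀ l ∈ W, l ≠ k → x l < x k} := by
    intro W k
    have : {x : V → ℝ | ∀ l ∈ W, l ≠ k → x l < x k} =
        ⋂ l ∈ W, ⋂ (_ : l ≠ k), {x : V → ℝ | x l < x k} := by
      ext x; simp
    rw [this]
    exact Finset.measurableSet_biInter _ fun l _ => MeasurableSet.iInter fun _ =>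
      measurableSet_lt (measurable_pi_apply l) (measurable_pi_apply k)
  have hE : ∀ k, IsUnitVariable ((E k).indicator fun _ => (1 : ℝ)) := by
    intro k
    refine ⟨measurable_const.indicator ((hmeas U i).inter (hmeas S k)), ?_, ?_⟩
    · intro x; exact Set.indicator_nonneg (fun _ _ => zero_le_one) x
    · intro x; exact Set.indicator_le_self' (fun _ _ => zero_le_one) x
  have hSU : S ⊆ U := Finset.subset_union_right
  have hmain := card_mul_integral (S := S) (i := j) (Φ := fun k => (E k).indicator fun _ => (1 : ℝ))
    (fun k _ => hE k) (by
      intro k hk x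
      have hiff : x ∘ Equiv.swap j k ∈ E j ↔ x ∈ E k := by
        have hi : Equiv.swap j k i = i := Equiv.swap_apply_of_ne_of_ne
          (fun e => hiS (e ▸ hj)) (fun e => hiS (e ▸ hk))
        constructor
        · rintro ⟨h1, h2⟩
          simp only [Function.comp_apply, hi, Equiv.swap_apply_left] at h1 h2
          refine ⟨fun l hl hli => ?_, fun l hl hlk => ?_⟩
          · have := h1 _ (swap_apply_mem (hSU hj) (hSU hk) hl)
              (fun e => hli (by rw [← hi] at e; exact (Equiv.swap j k).injective e))
            rwa [Equiv.swap_apply_self] at this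
          · have := h2 _ (swap_apply_mem hj hk hl)
              (fun e => hlk
                ((Equiv.swap j k).injective (e.trans (Equiv.swap_apply_right j k).symm)))
            rwa [Equiv.swap_apply_self] at this
        · rintro ⟨h1, h2⟩
          refine ⟨fun l hl hli => ?_, fun l hl hlk => ?_⟩
          · simp only [Function.comp_apply, hi]
            exact h1 _ (swap_apply_mem (hSU hj) (hSU hk) hl)
              (fun e => hli (by rw [← hi] at e; exact (Equiv.swap j k).injective e))
          · simp only [Function.comp_apply, Equiv.swap_apply_left]
            exact h2 _ (swap_apply_mem hj hk hl)
              (fun e => hlk ((Equiv.swap j k).injective (e.trans (Equiv.swap_apply_left j k).symm)))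
      by_cases hx : x ∈ E k
      · rw [Set.indicator_of_mem (hiff.2 hx), Set.indicator_of_mem hx]
      · rw [Set.indicator_of_notMem (fun hh => hx (hiff.1 hh)), Set.indicator_of_notMem hx])
  have hle : ∫ x, ∑ k ∈ S, (E k).indicator (fun _ => (1 : ℝ)) x ∂uniformNumbers V ≤
      ∫ x, localMax G i x ∂uniformNumbers V := by
    refine integral_mono (integrable_finsetSum _ fun k _ => (hE k).integrable)
      (isUnitVariable_localMax G i).integrable fun x => ?_
    by_cases hx : ∃ k ∈ S, x ∈ E k
    · obtain ⟨k, hk, hxk⟩ := hx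
      rw [localMax_of_rank G ((rank_eq_one_iff G x).2 fun l hl hli =>
        hxk.1 l (Finset.mem_union_left _ hl) hli)]
      refine (Finset.sum_le_sum (g := fun l => if l = k then (1 : ℝ) else 0) fun l hl => ?_).trans
        (by rw [Finset.sum_ite_eq', if_pos hk])
      by_cases hlk : l = k
      · rw [if_pos hlk]; exact (hE l).le_one x
      · rw [if_neg hlk, Set.indicator_of_notMem]
        intro hxl
        exact lt_asymm (hxk.2 l hl hlk) (hxl.2 k hk (Ne.symm hlk))
    · rw [Finset.sum_eq_zero fun k hk => Set.indicator_of_notMem (fun hh => hx ⟨k, hk, hh⟩) _]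
      exact (isUnitVariable_localMax G i).nonneg x
  have hle2 : ∫ x, (if x j < x i then localMax G i x * localMax G j x else 0) ∂uniformNumbers V ≤
      ∫ x, (E j).indicator (fun _ => (1 : ℝ)) x ∂uniformNumbers V := by
    refine integral_mono_of_nonneg (Filter.Eventually.of_forall fun x => ?_) (hE j).integrable
      (Filter.Eventually.of_forall fun x => ?_)
    · change 0 ≤ ite _ _ _
      split_ifs
      · exact mul_nonneg ((isUnitVariable_localMax G i).nonneg x)
          ((isUnitVariable_localMax G j).nonneg x)
      · exact le_rfl
    · change ite _ _ _ ≤ _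
      split_ifs with hlt
      · by_cases hi : rank G x i = 1
        · by_cases hj' : rank G x j = 1
          · have h1 := (rank_eq_one_iff G x).1 hi
            have h2 := (rank_eq_one_iff G x).1 hj'
            rw [Set.indicator_of_mem, localMax_of_rank G hi, localMax_of_rank G hj', one_mul]
            refine ⟨fun l hl hli => ?_, h2⟩
            rcases Finset.mem_union.1 hl with hl | hl
            · exact h1 l hl hli
            · by_cases hlj : l = j
              · rwa [hlj]
              · exact (h2 l hl hlj).trans hlt
          · rw [localMax_of_rank_ne G hj', mul_zero]; exact (hE j).nonneg x
        · rw [localMax_of_rank_ne G hi, zero_mul]; exact (hE j).nonneg x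
      · exact (hE j).nonneg x
  have hc := one_le_hopBall_card G 2 i
  rw [integral_localMax, ← hmain, le_div_iff₀ (by linarith)] at hle
  refine le_trans ?_ hle
  rw [mul_comm]
  exact mul_le_mul_of_nonneg_right (mul_le_mul_of_nonneg_left hle2 (Nat.cast_nonneg _))
    (by linarith)

/-- Beyond distance two, two nodes are both local maxima with at most twice the product of the
probabilities. -/
theorem integral_localMax_mul {i j : V} (h : j ∉ hopBall G 2 i) :
    ∫ x, localMax G i x * localMax G j x ∂uniformNumbers V ≤
      2 * (1 / (hopBall G 2 i).card * (1 / (hopBall G 2 j).card)) := by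
  have h1 := integral_localMax_mul_lt G h
  have h2 := integral_localMax_mul_lt G
    (fun hh => h ((mem_hopBall_comm G).1 hh) : i ∉ hopBall G 2 j)
  have hi := one_le_hopBall_card G 2 i
  have hj := one_le_hopBall_card G 2 j
  have hu : ∀ i j : V, IsUnitVariable fun x : V → ℝ =>
      if x j < x i then localMax G i x * localMax G j x else 0 := by
    intro i j
    have hm := (isUnitVariable_localMax G i).mul (isUnitVariable_localMax G j)
    refine ⟨Measurable.ite (measurableSet_lt (measurable_pi_apply j) (measurable_pi_apply i))
      hm.measurable measurable_const, fun x => ?_, fun x => ?_⟩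
    · split_ifs
      · exact hm.nonneg x
      · exact le_rfl
    · split_ifs
      · exact hm.le_one x
      · exact zero_le_one
  have h3 : ∫ x, localMax G i x * localMax G j x ∂uniformNumbers V =
      ∫ x, (if x j < x i then localMax G i x * localMax G j x else 0) ∂uniformNumbers V +
      ∫ x, (if x i < x j then localMax G j x * localMax G i x else 0) ∂uniformNumbers V := by
    rw [← integral_add (hu i j).integrable (hu j i).integrable]
    refine integral_congr_ae ?_
    filter_upwards [ae_injective] with x hx
    have hij : x i ≠ x j := fun e => h (hx e ▸ self_mem_hopBall G 2 i)
    rcases lt_or_gt_of_ne hij with hl | hl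
    · rw [if_neg (not_lt.2 hl.le), if_pos hl, zero_add, mul_comm]
    · rw [if_pos hl, if_neg (not_lt.2 hl.le), add_zero]
  have e : 2 * (1 / ((hopBall G 2 i).card : ℝ) * (1 / (hopBall G 2 j).card)) =
      2 / ((hopBall G 2 i).card * (hopBall G 2 j).card) := by field_simp
  rw [h3, e, le_div_iff₀ (by positivity)]
  linarith

end Ranks

/-! ### Exposure probabilities -/

section Exposure

universe u

/-- `Q K a` is the probability that `a` given clusters out of `K` are all treated under the
cluster-level randomization `R`. -/
def HasTreatmentProb (R : (C : Type u) → [Fintype C] → PMF (Finset C)) (Q : ℕ → ℕ → ℝ) : Prop :=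
  ∀ (C : Type u) [Fintype C] (S : Finset C),
    (R C).toOuterMeasure {T | S ⊆ T} = ENNReal.ofReal (Q (Fintype.card C) S.card)

theorem hasTreatmentProb_independent (p : unitInterval) :
    HasTreatmentProb (independentRandomization p) fun _ a => (p : ℝ) ^ a := by
  classical
  intro C _ S
  have h0 : (0 : ℝ) ≤ p := p.2.1
  have h1 : (0 : ℝ) ≤ 1 - p := sub_nonneg.2 p.2.2
  have key := Finset.prod_add (fun _ : C => (p : ℝ)) (fun c => if c ∈ S then 0 else 1 - (p : ℝ))
    Finset.univ
  have e1 : ∏ c, ((p : ℝ) + if c ∈ S then 0 else 1 - (p : ℝ)) = (p : ℝ) ^ S.card := by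
    have : ∀ c, ((p : ℝ) + if c ∈ S then 0 else 1 - (p : ℝ)) = if c ∈ S then (p : ℝ) else 1 := by
      intro c; split_ifs <;> ring
    simp_rw [this, Finset.prod_ite_mem, Finset.univ_inter, Finset.prod_const]
  rw [e1] at key
  simp only
  rw [PMF.toOuterMeasure_apply_fintype, key, Finset.powerset_univ, ENNReal.ofReal_sum_of_nonneg]
  · refine Finset.sum_congr rfl fun T _ => ?_
    by_cases hST : S ⊆ T
    · have e2 : ∏ c ∈ Finset.univ \ T, (if c ∈ S then 0 else 1 - (p : ℝ)) =
          (1 - (p : ℝ)) ^ (Fintype.card C - T.card) := by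
        rw [← Finset.card_univ_sdiff, ← Finset.prod_const]
        refine Finset.prod_congr rfl fun c hc => if_neg fun hcS => ?_
        exact (Finset.mem_sdiff.1 hc).2 (hST hcS)
      rw [Set.indicator_of_mem (show T ∈ {T | S ⊆ T} from hST), e2, Finset.prod_const,
        ENNReal.ofReal_mul (by positivity), ENNReal.ofReal_pow h0, ENNReal.ofReal_pow h1]
      rfl
    · obtain ⟨c, hc, hc'⟩ := Finset.not_subset.1 hST
      have hz : ∏ c ∈ Finset.univ \ T, (if c ∈ S then 0 else 1 - (p : ℝ)) = 0 :=
        Finset.prod_eq_zero (Finset.mem_sdiff.2 ⟨Finset.mem_univ c, hc'⟩) (if_pos hc)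
      rw [Set.indicator_of_notMem (show T ∉ {T | S ⊆ T} from hST), hz, mul_zero,
        ENNReal.ofReal_zero]
  · intro T _
    refine mul_nonneg (Finset.prod_nonneg fun _ _ => h0) (Finset.prod_nonneg fun c _ => ?_)
    split_ifs
    · exact le_rfl
    · exact h1

theorem hasTreatmentProb_complete (p : unitInterval) :
    HasTreatmentProb (completeRandomization p) (completeProb p) := by
  classical
  intro C _ S
  set K := Fintype.card C with hK
  have h0 : (0 : ℝ) ≤ p * K := mul_nonneg p.2.1 (Nat.cast_nonneg _)
  rw [PMF.toOuterMeasure_apply_fintype]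
  have e : ∀ T : Finset C, ({T | S ⊆ T} : Set (Finset C)).indicator (completeRandomization p C) T =
      ENNReal.ofReal (if S ⊆ T then roundingProb (p * K) T.card / K.choose T.card else 0) := by
    intro T
    by_cases hST : S ⊆ T
    · rw [Set.indicator_of_mem (show T ∈ {T | S ⊆ T} from hST), if_pos hST]
      rfl
    · rw [Set.indicator_of_notMem (show T ∉ {T | S ⊆ T} from hST), if_neg hST,
        ENNReal.ofReal_zero]
  simp_rw [e]
  rw [← ENNReal.ofReal_sum_of_nonneg]
  swap
  · intro T _
    split_ifs
    · exact div_nonneg (roundingProb_nonneg h0 _) (Nat.cast_nonneg _)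
    · exact le_rfl
  congr 1
  unfold completeProb
  rw [← Finset.powerset_univ, Finset.sum_powerset, Finset.card_univ]
  refine Finset.sum_congr rfl fun m hm => ?_
  have hm' : m ≤ K := Nat.lt_succ_iff.1 (Finset.mem_range.1 hm)
  have hs : S.card ≤ K := Finset.card_le_univ S
  have e2 : ∑ T ∈ Finset.powersetCard m Finset.univ,
      (if S ⊆ T then roundingProb (p * K) T.card / K.choose T.card else 0) =
      ((Finset.powersetCard m Finset.univ).filter (S ⊆ ·)).card *
        (roundingProb (p * K) m / K.choose m) := by
    rw [← Finset.sum_filter, ← nsmul_eq_mul, ← Finset.sum_const]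
    refine Finset.sum_congr rfl fun T hT => ?_
    rw [(Finset.mem_powersetCard.1 (Finset.mem_filter.1 hT).1).2]
  rw [e2]
  have hd := descFactorial_cast_pos hs
  have hc : (0 : ℝ) < K.choose m := by exact_mod_cast Nat.choose_pos hm'
  rcases le_or_gt S.card m with hsm | hsm
  · have h1 : ((Finset.powersetCard m Finset.univ).filter (S ⊆ ·)).card =
        (K - S.card).choose (m - S.card) := by
      rw [Finset.card_filter_powersetCard_subset _ _ _ (Finset.subset_univ S) hsm, Finset.card_univ]
    have h2 : (K.choose m : ℝ) * m.choose S.card =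
        K.choose S.card * (K - S.card).choose (m - S.card) := by
      exact_mod_cast Nat.choose_mul hsm
    have h3 : (m.descFactorial S.card : ℝ) = S.card.factorial * m.choose S.card := by
      exact_mod_cast Nat.descFactorial_eq_factorial_mul_choose m S.card
    have h4 : (K.descFactorial S.card : ℝ) = S.card.factorial * K.choose S.card := by
      exact_mod_cast Nat.descFactorial_eq_factorial_mul_choose K S.card
    rw [h1, mul_div_assoc', mul_comm, mul_div_assoc]
    congr 1
    rw [div_eq_div_iff hc.ne' hd.ne', h3, h4]
    linear_combination -(S.card.factorial : ℝ) * h2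
  · have h1 : ((Finset.powersetCard m Finset.univ).filter (S ⊆ ·)).card = 0 := by
      rw [Finset.card_eq_zero, Finset.filter_eq_empty_iff]
      intro T hT hST
      have := Finset.card_le_card hST
      rw [(Finset.mem_powersetCard.1 hT).2] at this
      omega
    rw [h1, Nat.descFactorial_eq_zero_iff_lt.2 hsm]
    simp

variable {V : Type u} [Fintype V] (G : SimpleGraph V)

/-- The probability that all nodes of `S` are treated, for a cluster-level randomization with
treatment probabilities `Q`. -/
noncomputable def treatProb (Q : ℕ → ℕ → ℝ) (S : Finset V) : ℝ :=
  ∫ x, Q (clusterCount G x) (clusterHits G x S) ∂uniformNumbers V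

/-- The design and its numbers give the same probabilities: the clusters of the random clustering
correspond to the values of the 1-hop maximum. -/
theorem design_real_eq_treatProb {R : (C : Type u) → [Fintype C] → PMF (Finset C)}
    {Q : ℕ → ℕ → ℝ} (hR : HasTreatmentProb R Q) (hQ : ∀ K a, 0 ≤ Q K a) (S : Finset V) :
    (design (oneHopMaxLaw G) R).toMeasure.real {z | ∀ j ∈ S, z j = true} = treatProb G Q S := by
  classical
  have hfin : Finite (Setoid V) :=
    Finite.of_injective (fun (c : Setoid V) (i j : V) => c i j)
      fun a b h => Setoid.ext fun i j => iff_of_eq (congrFun (congrFun h i) j)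
  let mS : MeasurableSpace (Setoid V) := ⊤
  have hclust : Measurable (oneHopMaxClustering G) :=
    measurable_to_countable' fun c => measurableSet_oneHopMaxClustering_eq G c
  let g : Setoid V → ℝ≥0∞ := fun c =>
    ENNReal.ofReal (Q (Fintype.card (Quotient c)) (S.image (Quotient.mk c)).card)
  have e1 : (design (oneHopMaxLaw G) R).toMeasure {z | ∀ j ∈ S, z j = true} =
      ∑' c, oneHopMaxLaw G c * g c := by
    rw [PMF.toMeasure_apply_eq_toOuterMeasure, design, PMF.toOuterMeasure_bind_apply]
    refine tsum_congr fun c => ?_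
    congr 1
    rw [PMF.toOuterMeasure_map_apply]
    refine Eq.trans ?_ (hR (Quotient c) (S.image (Quotient.mk c)))
    congr 1
    ext T
    simp [Finset.subset_iff]
  have e2 : ∫⁻ x, g (oneHopMaxClustering G x) ∂uniformNumbers V =
      ∑' c, oneHopMaxLaw G c * g c := by
    rw [← lintegral_map (f := g) (measurable_of_countable g) hclust, lintegral_countable']
    refine tsum_congr fun c => ?_
    rw [Measure.map_apply hclust (measurableSet_singleton c), mul_comm]
    rfl
  have e3 : ∀ x, g (oneHopMaxClustering G x) =
      ENNReal.ofReal (Q (clusterCount G x) (clusterHits G x S)) := by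
    intro x
    have hK : Fintype.card (Quotient (oneHopMaxClustering G x)) = clusterCount G x := by
      change _ = clusterHits G x Finset.univ
      rw [clusterHits_eq_card_image_mk, Finset.image_univ_of_surjective Quotient.mk_surjective,
        Finset.card_univ]
    simp only [g]
    rw [clusterHits_eq_card_image_mk, ← hK]
  unfold treatProb
  rw [Measure.real, e1, ← e2, integral_eq_lintegral_of_nonneg_ae
    (Filter.Eventually.of_forall fun x => hQ _ _)]
  · simp_rw [e3]
  · exact ((measurable_of_countable fun z : ℕ × ℕ => Q z.1 z.2).comp
      ((measurable_clusterCount G).prodMk (measurable_clusterHits G S))).aestronglyMeasurable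

/-- The variance of the Horvitz-Thompson estimator is at most the sum of the normalized
covariances of the exposure indicators. -/
theorem htVariance_le {D : PMF (V → Bool)} {Y : V → (V → Bool) → ℝ} {Ybar : ℝ}
    (hY : ExposureModel G Y) (hbound : ∀ i z, Y i z ∈ Set.Icc 0 Ybar) {U : V → V → ℝ}
    (hU0 : ∀ i j, 0 ≤ U i j)
    (hU : ∀ i j, D.toMeasure.real (exposed G i ∩ exposed G j) -
        D.toMeasure.real (exposed G i) * D.toMeasure.real (exposed G j) ≤
      U i j * (D.toMeasure.real (exposed G i) * D.toMeasure.real (exposed G j))) :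
    htVariance G D Y ≤ (1 / (Fintype.card V : ℝ)) ^ 2 * (Ybar ^ 2 * ∑ i, ∑ j, U i j) := by
  classical
  set μ := D.toMeasure
  set c : V → ℝ := fun i => Y i (fun _ => true) / μ.real (exposed G i) with hc
  have hX : htMean G D Y = fun z => (1 / (Fintype.card V : ℝ)) *
      ∑ i, c i * (exposed G i).indicator (fun _ => (1 : ℝ)) z := by
    funext z
    unfold htMean
    congr 1
    refine Finset.sum_congr rfl fun i _ => ?_
    by_cases hz : z ∈ exposed G i
    · rw [Set.indicator_of_mem hz, Set.indicator_of_mem hz, mul_one,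
        hY i z (fun _ => true) hz fun _ _ => rfl]
    · rw [Set.indicator_of_notMem hz, Set.indicator_of_notMem hz, mul_zero]
  unfold htVariance
  rw [hX, variance_const_mul]
  refine mul_le_mul_of_nonneg_left ?_ (sq_nonneg _)
  have hm : ∀ s : Set (V → Bool), MeasurableSet s := fun s => (Set.toFinite s).measurableSet
  have hint : ∀ s : Set (V → Bool), Integrable (s.indicator fun _ => (1 : ℝ)) μ := fun s =>
    (integrable_const 1).indicator (hm s)
  have hmem : MemLp (fun z => ∑ i, c i * (exposed G i).indicator (fun _ => (1 : ℝ)) z) 2 μ :=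
    MemLp.of_discrete
  rw [variance_eq_sub hmem]
  have e1 : μ[(fun z => ∑ i, c i * (exposed G i).indicator (fun _ => (1 : ℝ)) z) ^ 2] =
      ∑ i, ∑ j, c i * c j * μ.real (exposed G i ∩ exposed G j) := by
    have : ∀ z, ((fun z => ∑ i, c i * (exposed G i).indicator (fun _ => (1 : ℝ)) z) ^ 2) z =
        ∑ i, ∑ j, c i * c j * (exposed G i ∩ exposed G j).indicator (fun _ => (1 : ℝ)) z := by
      intro z
      rw [Pi.pow_apply, sq, Finset.sum_mul_sum]
      refine Finset.sum_congr rfl fun i _ => Finset.sum_congr rfl fun j _ => ?_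
      by_cases hi : z ∈ exposed G i <;> by_cases hj : z ∈ exposed G j <;> simp [hi, hj]
    simp_rw [this]
    rw [integral_finsetSum _ fun i _ => integrable_finsetSum _ fun j _ => (hint _).const_mul _]
    refine Finset.sum_congr rfl fun i _ => ?_
    rw [integral_finsetSum _ fun j _ => (hint _).const_mul _]
    refine Finset.sum_congr rfl fun j _ => ?_
    rw [integral_const_mul, integral_indicator_const _ (hm _), smul_eq_mul, mul_one]
  have e2 : μ[fun z => ∑ i, c i * (exposed G i).indicator (fun _ => (1 : ℝ)) z] ^ 2 =
      ∑ i, ∑ j, c i * c j * (μ.real (exposed G i) * μ.real (exposed G j)) := by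
    rw [integral_finsetSum _ fun i _ => (hint _).const_mul _, sq, Finset.sum_mul_sum]
    refine Finset.sum_congr rfl fun i _ => Finset.sum_congr rfl fun j _ => ?_
    rw [integral_const_mul, integral_const_mul, integral_indicator_const _ (hm _),
      integral_indicator_const _ (hm _), smul_eq_mul, smul_eq_mul]
    ring
  rw [e1, e2, ← Finset.sum_sub_distrib, Finset.mul_sum]
  refine Finset.sum_le_sum fun i _ => ?_
  rw [← Finset.sum_sub_distrib, Finset.mul_sum]
  refine Finset.sum_le_sum fun j _ => ?_
  rw [← mul_sub]
  obtain ⟨yi0, yi1⟩ := hbound i fun _ => true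
  obtain ⟨yj0, yj1⟩ := hbound j fun _ => true
  have hci : 0 ≤ c i := div_nonneg yi0 measureReal_nonneg
  have hcj : 0 ≤ c j := div_nonneg yj0 measureReal_nonneg
  have hdiv : ∀ k : V, c k * μ.real (exposed G k) ≤ Ybar := by
    intro k
    obtain ⟨y0, y1⟩ := hbound k fun _ => true
    by_cases h : μ.real (exposed G k) = 0
    -- a node that is never exposed contributes `0`, by `x / 0 = 0`
    · rw [h, mul_zero]; exact y0.trans y1
    · rw [hc, div_mul_cancel₀ _ h]; exact y1
  calc c i * c j * _ ≤ c i * c j *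
        (U i j * (μ.real (exposed G i) * μ.real (exposed G j))) :=
        mul_le_mul_of_nonneg_left (hU i j) (mul_nonneg hci hcj)
    _ = U i j * ((c i * μ.real (exposed G i)) * (c j * μ.real (exposed G j))) := by ring
    _ ≤ U i j * (Ybar * Ybar) := mul_le_mul_of_nonneg_left
        (mul_le_mul (hdiv i) (hdiv j) (mul_nonneg hcj measureReal_nonneg) (yi0.trans yi1))
        (hU0 i j)
    _ = Ybar ^ 2 * U i j := by ring

/-- The variance bound in terms of the treatment probabilities of 1-hop balls. -/
theorem htVariance_le_of_treatProb [DecidableEq V]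
    {R : (C : Type u) → [Fintype C] → PMF (Finset C)}
    {Q : ℕ → ℕ → ℝ} (hR : HasTreatmentProb R Q) (hQ : ∀ K a, 0 ≤ Q K a)
    {Y : V → (V → Bool) → ℝ} {Ybar : ℝ} (hY : ExposureModel G Y)
    (hbound : ∀ i z, Y i z ∈ Set.Icc 0 Ybar) {U : V → V → ℝ} (hU0 : ∀ i j, 0 ≤ U i j)
    (hU : ∀ i j, treatProb G Q (hopBall G 1 i ∪ hopBall G 1 j) -
        treatProb G Q (hopBall G 1 i) * treatProb G Q (hopBall G 1 j) ≤
      U i j * (treatProb G Q (hopBall G 1 i) * treatProb G Q (hopBall G 1 j))) :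
    htVariance G (design (oneHopMaxLaw G) R) Y ≤
      (1 / (Fintype.card V : ℝ)) ^ 2 * (Ybar ^ 2 * ∑ i, ∑ j, U i j) := by
  refine htVariance_le G hY hbound hU0 fun i j => ?_
  have h1 : exposed G i ∩ exposed G j =
      {z | ∀ k ∈ hopBall G 1 i ∪ hopBall G 1 j, z k = true} := by
    ext z
    simp only [exposed, Set.mem_inter_iff, Set.mem_ofPred_eq, Finset.mem_union]
    exact ⟨fun h k hk => hk.elim (h.1 k) (h.2 k), fun h => ⟨fun k hk => h k (Or.inl hk),
      fun k hk => h k (Or.inr hk)⟩⟩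
  rw [h1, exposed, exposed, design_real_eq_treatProb G hR hQ, design_real_eq_treatProb G hR hQ,
    design_real_eq_treatProb G hR hQ]
  exact hU i j

end Exposure

/-! ### Independent cluster-level randomization -/

section Independent

universe u

variable {V : Type u} [Fintype V] (G : SimpleGraph V)

/-- It remains to bound the normalized covariances by numbers `U i j` whose sum is at most
`n κ ^ 2 N ^ 2 / p`, where `N = κ (d_max + 1)`. -/
theorem htVariance_le_of_sum_le [DecidableEq V] [DecidableRel G.Adj] {κ p : ℝ}
    {R : (C : Type u) → [Fintype C] → PMF (Finset C)}
    {Q : ℕ → ℕ → ℝ} (hR : HasTreatmentProb R Q) (hQ : ∀ K a, 0 ≤ Q K a)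
    {Y : V → (V → Bool) → ℝ} {Ybar : ℝ} (hY : ExposureModel G Y)
    (hbound : ∀ i z, Y i z ∈ Set.Icc 0 Ybar) {U : V → V → ℝ} (hU0 : ∀ i j, 0 ≤ U i j)
    (hU : ∀ i j, treatProb G Q (hopBall G 1 i ∪ hopBall G 1 j) -
        treatProb G Q (hopBall G 1 i) * treatProb G Q (hopBall G 1 j) ≤
      U i j * (treatProb G Q (hopBall G 1 i) * treatProb G Q (hopBall G 1 j)))
    (hsum : ∑ i, ∑ j, U i j ≤
      Fintype.card V * (κ ^ 2 * (κ * (G.maxDegree + 1)) ^ 2 * p⁻¹)) :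
    htVariance G (design (oneHopMaxLaw G) R) Y ≤
      1 / (Fintype.card V : ℝ) *
        (Ybar ^ 2 * ((G.maxDegree : ℝ) + 1) ^ 2 * κ ^ 4 * p⁻¹) := by
  refine (htVariance_le_of_treatProb G hR hQ hY hbound hU0 hU).trans ?_
  refine (mul_le_mul_of_nonneg_left (mul_le_mul_of_nonneg_left hsum (sq_nonneg Ybar))
    (sq_nonneg _)).trans (le_of_eq ?_)
  rcases eq_or_ne (Fintype.card V : ℝ) 0 with h | h
  · simp [h]
  · field_simp

/-- The exposure probability is at least the probability that node `i` has the largest number in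
its 2-hop ball and that its cluster is treated. -/
theorem le_treatProb {p : ℝ} {Q : ℕ → ℕ → ℝ} (hQ0 : ∀ K a, 0 ≤ Q K a)
    (hQ1 : ∀ K, 0 < K → Q K 1 = p) {i : V}
    (hu : IsUnitVariable fun x : V → ℝ => Q (clusterCount G x) (clusterHits G x (hopBall G 1 i))) :
    p * (1 / (hopBall G 2 i).card) ≤ treatProb G Q (hopBall G 1 i) := by
  have : Nonempty V := ⟨i⟩
  rw [← integral_localMax, ← integral_const_mul]
  refine integral_mono ((isUnitVariable_localMax G i).integrable.const_mul p) hu.integrable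
    fun x => ?_
  change p * localMax G i x ≤ _
  by_cases h : rank G x i = 1
  · simp only [localMax_of_rank G h, clusterHits_eq_one_of_rank G x h,
      hQ1 _ (clusterCount_pos G x), mul_one, le_refl]
  · rw [localMax_of_rank_ne G h, mul_zero]
    exact hQ0 _ _

/-- Far pairs are uncorrelated, and near pairs are bounded trivially with `1 / P ≤ N / p`, where `N`
bounds the sizes of the 2-hop balls. -/
theorem exists_bound_independent [DecidableEq V] [DecidableRel G.Adj] {κ : ℝ}
    (hκ : RestrictedGrowth G κ) {p : ℝ} (h0 : 0 < p) (h1 : p ≤ 1) :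
    ∃ U : V → V → ℝ, (∀ i j, 0 ≤ U i j) ∧
      (∀ i j, treatProb G (fun _ a => p ^ a) (hopBall G 1 i ∪ hopBall G 1 j) -
        treatProb G (fun _ a => p ^ a) (hopBall G 1 i) *
          treatProb G (fun _ a => p ^ a) (hopBall G 1 j) ≤
        U i j * (treatProb G (fun _ a => p ^ a) (hopBall G 1 i) *
          treatProb G (fun _ a => p ^ a) (hopBall G 1 j))) ∧
      ∑ i, ∑ j, U i j ≤ Fintype.card V * (κ ^ 2 * (κ * (G.maxDegree + 1)) ^ 2 * p⁻¹) := by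
  rcases isEmpty_or_nonempty V with hV | hV
  · exact ⟨fun _ _ => 0, fun _ _ => le_rfl, fun i => hV.elim i, by simp⟩
  set N : ℝ := κ * (G.maxDegree + 1) with hN
  have hN2 : ∀ i, ((hopBall G 2 i).card : ℝ) ≤ N := hκ.card_two_le
  have hNpos : 0 < N := lt_of_lt_of_le
    (by linarith [one_le_hopBall_card G 2 (Classical.arbitrary V)])
    (hN2 (Classical.arbitrary V))
  have hu : ∀ S : Finset V, IsUnitVariable fun x : V → ℝ => p ^ clusterHits G x S := fun S =>
    ⟨(measurable_of_countable fun a : ℕ => p ^ a).comp (measurable_clusterHits G S),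
      fun x => by positivity, fun x => pow_le_one₀ h0.le h1⟩
  set P : V → ℝ := fun i => treatProb G (fun _ a => p ^ a) (hopBall G 1 i) with hP
  have hPN : ∀ i, 1 ≤ N / p * P i := by
    intro i
    have h := le_treatProb G (p := p) (Q := fun _ a => p ^ a) (fun _ _ => by positivity)
      (fun _ _ => pow_one p) (i := i) (hu _)
    have hc := one_le_hopBall_card G 2 i
    have h2 : p / N ≤ P i := by
      refine le_trans ?_ h
      rw [mul_one_div]
      exact div_le_div_of_nonneg_left h0.le (by linarith) (hN2 i)
    rw [div_le_iff₀ hNpos] at h2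
    rw [div_mul_eq_mul_div, le_div_iff₀ h0]
    linarith
  have hP0 : ∀ i, 0 ≤ P i := fun i => (hu _).integral_nonneg
  refine ⟨fun i j => if j ∈ hopBall G 4 i then N / p else 0, ?_, ?_, ?_⟩
  · intro i j; dsimp only; split_ifs <;> positivity
  · intro i j
    change _ - P i * P j ≤ (if j ∈ hopBall G 4 i then N / p else 0) * (P i * P j)
    by_cases hj : j ∈ hopBall G 4 i
    · rw [if_pos hj]
      have h2 : treatProb G (fun _ a => p ^ a) (hopBall G 1 i ∪ hopBall G 1 j) ≤ P i :=
        integral_mono (hu _).integrable (hu _).integrable fun x =>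
          pow_le_pow_of_le_one h0.le h1 (clusterHits_mono G x Finset.subset_union_left)
      have h3 := mul_le_mul_of_nonneg_left (hPN j) (hP0 i)
      have h4 := mul_nonneg (hP0 i) (hP0 j)
      linarith
    · rw [if_neg hj, zero_mul, sub_nonpos]
      have e : treatProb G (fun _ a => p ^ a) (hopBall G 1 i ∪ hopBall G 1 j) =
          ∫ x, p ^ clusterHits G x (hopBall G 1 i) * p ^ clusterHits G x (hopBall G 1 j)
            ∂uniformNumbers V := by
        refine integral_congr_ae ?_
        filter_upwards [ae_injective] with x hx
        rw [clusterHits_union_of_far G hx hj, pow_add]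
      rw [e]
      refine le_of_eq (integral_mul_of_dependsOn (hu _).measurable (hu _).measurable
        (dependsOn_hits_rank G (fun a _ => p ^ a) i) (dependsOn_hits_rank G (fun a _ => p ^ a) j)
        (disjoint_hopBall G hj))
  · have h2 : ∀ i, ∑ j, (if j ∈ hopBall G 4 i then N / p else 0) ≤ κ ^ 2 * N ^ 2 * p⁻¹ := by
      intro i
      rw [Finset.sum_ite_mem, Finset.univ_inter, Finset.sum_const, nsmul_eq_mul]
      have h4 := (hκ.card_four_le i).trans (mul_le_mul_of_nonneg_left (hN2 i) (sq_nonneg κ))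
      calc ((hopBall G 4 i).card : ℝ) * (N / p) ≤ κ ^ 2 * N * (N / p) :=
            mul_le_mul_of_nonneg_right h4 (by positivity)
        _ = _ := by ring
    refine (Finset.sum_le_sum fun i _ => h2 i).trans (le_of_eq ?_)
    rw [Finset.sum_const, nsmul_eq_mul, Finset.card_univ]

end Independent

/-! ### Lower bounds for exposure probabilities -/

theorem sum_one_sub_mul (q : ℝ) (n : ℕ) :
    ∑ r ∈ Finset.range n, (1 - q * ((r + 1 : ℕ) : ℝ)) = n - q * n * (n + 1) / 2 := by
  induction n with
  | zero => simp
  | succ n ih => rw [Finset.sum_range_succ, ih]; push_cast; ring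

theorem le_sum_posPart (q : ℝ) (n : ℕ) :
    n - q * n * (n + 1) / 2 ≤ ∑ r ∈ Finset.range n, max (1 - q * ((r + 1 : ℕ) : ℝ)) 0 := by
  rw [← sum_one_sub_mul]
  exact Finset.sum_le_sum fun r _ => le_max_left _ _

/-- If `1 / q ≤ N`, then the mean of `(1 - q r)⁺` over `r = 1, …, n` is at least
`(1 - q) / (2 q N)`: the first `⌊1 / q⌋` terms suffice. -/
theorem le_sum_posPart_of_one_le {q N : ℝ} {n : ℕ} (hq : 0 < q) (hq1 : q ≤ 1) (hn : (n : ℝ) ≤ N)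
    (hqN : 1 ≤ q * N) :
    n * ((1 - q) / (2 * q * N)) ≤ ∑ r ∈ Finset.range n, max (1 - q * ((r + 1 : ℕ) : ℝ)) 0 := by
  have hN : 0 < N := by
    by_contra! h
    nlinarith
  set R := ⌊1 / q⌋₊ with hR
  have hR1 : (R : ℝ) ≤ 1 / q := Nat.floor_le (by positivity)
  have hR2 : 1 / q < R + 1 := Nat.lt_floor_add_one _
  rw [le_div_iff₀ hq] at hR1
  rw [div_lt_iff₀ hq] at hR2
  rcases le_or_gt R n with h | h
  · have h1 : ∑ r ∈ Finset.range R, max (1 - q * ((r + 1 : ℕ) : ℝ)) 0 ≤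
        ∑ r ∈ Finset.range n, max (1 - q * ((r + 1 : ℕ) : ℝ)) 0 :=
      Finset.sum_le_sum_of_subset_of_nonneg (Finset.range_mono h) fun _ _ _ => le_max_right _ _
    refine le_trans ?_ ((le_sum_posPart q R).trans h1)
    have h2 : (1 - q) / (2 * q) ≤ R - q * R * (R + 1) / 2 := by
      rw [div_le_iff₀ (by positivity)]
      nlinarith [mul_nonneg (sub_nonneg.2 hR1) (sub_nonneg.2 hR2.le)]
    refine le_trans ?_ h2
    rw [mul_div_assoc', div_le_div_iff₀ (by positivity) (by positivity)]
    have : 0 ≤ (1 - q) * (2 * q) := mul_nonneg (by linarith) (by positivity)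
    nlinarith
  · refine le_trans ?_ (le_sum_posPart q n)
    have h1 : (n : ℝ) + 1 ≤ R := by exact_mod_cast h
    have h2 : q * (n + 1) ≤ 1 := by nlinarith
    have h3 : (1 - q) / (2 * q * N) ≤ 1 / 2 := by
      rw [div_le_div_iff₀ (by positivity) (by norm_num)]; nlinarith
    have h4 := mul_le_mul_of_nonneg_left h3 (Nat.cast_nonneg (α := ℝ) n)
    have h5 := mul_le_mul_of_nonneg_left h2 (Nat.cast_nonneg (α := ℝ) n)
    nlinarith

/-- If `X` is at most `c (1 - v)` and `c (1 - w)` and `c (v (1 - w) + w (1 - v)) + d`, then it is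
at most `c / 2 + d`. -/
theorem le_half_add {X c d v w : ℝ} (hc : 0 ≤ c) (hd : 0 ≤ d) (hv : X ≤ c * (1 - v))
    (hw : X ≤ c * (1 - w)) (hvw : X ≤ c * (v * (1 - w) + w * (1 - v)) + d) : X ≤ c / 2 + d := by
  rcases le_or_gt (1 / 2) v with h | h
  · nlinarith
  rcases le_or_gt (1 / 2) w with h' | h'
  · nlinarith
  have : v * (1 - w) + w * (1 - v) ≤ 1 / 2 := by nlinarith
  nlinarith

/-- The real-number core of the bounds for pairs: `v` and `w` are the relative excesses of the
exposure probabilities `P` and `P'` over `α` and `α'`. -/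
theorem le_of_excess {X P P' α α' c r B d : ℝ} (hc : 0 < c) (hr : 0 ≤ r) (hd : 0 ≤ d)
    (hα : 1 ≤ c * α) (hα' : 1 ≤ c * α') (hP : α ≤ P) (hP' : α' ≤ P') (hX : X ≤ r * P)
    (hX' : X ≤ r * P') (hB : B ≤ d * (P * P'))
    (hXB : X ≤ B + r * (P - α) + r * (P' - α')) :
    X ≤ (r * c / 2 + d) * (P * P') := by
  have a0 : 0 < α := by by_contra! h; nlinarith
  have a0' : 0 < α' := by by_contra! h; nlinarith
  have p0 : 0 < P := by linarith
  have p0' : 0 < P' := by linarith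
  have hpp : 0 < P * P' := by positivity
  rw [← div_le_iff₀ hpp]
  have e1 : 1 - (P - α) / P = α / P := by field_simp; ring
  have e2 : 1 - (P' - α') / P' = α' / P' := by field_simp; ring
  have k1 : r * P ≤ r * c * (α * P) := by
    have := mul_le_mul_of_nonneg_left hα (mul_nonneg hr p0.le); linarith
  have k2 : r * P' ≤ r * c * (α' * P') := by
    have := mul_le_mul_of_nonneg_left hα' (mul_nonneg hr p0'.le); linarith
  refine le_half_add (v := (P - α) / P) (w := (P' - α') / P') (by positivity) hd ?_ ?_ ?_
  · rw [e1, div_le_iff₀ hpp]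
    have : r * c * (α / P) * (P * P') = r * c * (α * P') := by field_simp
    rw [this]
    have := mul_le_mul_of_nonneg_left hα (mul_nonneg hr p0'.le)
    linarith
  · rw [e2, div_le_iff₀ hpp]
    have : r * c * (α' / P') * (P * P') = r * c * (α' * P) := by field_simp
    rw [this]
    have := mul_le_mul_of_nonneg_left hα' (mul_nonneg hr p0.le)
    linarith
  · rw [e1, e2, div_le_iff₀ hpp]
    have : (r * c * ((P - α) / P * (α' / P') + (P' - α') / P' * (α / P)) + d) * (P * P') =
        r * (P - α) * (c * α') + r * (P' - α') * (c * α) + d * (P * P') := by field_simp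
    rw [this]
    have h1 := mul_le_mul_of_nonneg_left hα' (mul_nonneg hr (sub_nonneg.2 hP))
    have h2 := mul_le_mul_of_nonneg_left hα (mul_nonneg hr (sub_nonneg.2 hP'))
    linarith

/-- Of two numbers in the unit interval, `v (1 - w)` or `w (1 - v)` is at most the mean of
`v (1 - v)` and `w (1 - w)`. -/
theorem min_mul_one_sub_le {v w : ℝ} (hv : 0 ≤ v) (hv' : v ≤ 1) (hw : 0 ≤ w) (hw' : w ≤ 1) :
    v * (1 - w) ≤ (v * (1 - v) + w * (1 - w)) / 2 ∨
      w * (1 - v) ≤ (v * (1 - v) + w * (1 - w)) / 2 := by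
  rcases le_total v w with h | h
  · left; nlinarith [mul_nonneg (sub_nonneg.2 h) (by linarith : 0 ≤ 1 - (w - v))]
  · right; nlinarith [mul_nonneg (sub_nonneg.2 h) (by linarith : 0 ≤ 1 - (v - w))]

/-! ### Complete cluster-level randomization: pairs of far nodes -/

theorem completeProb_antitone {p : ℝ} (h0 : 0 ≤ p) (h1 : p < 1) {K a b : ℕ} (hab : a ≤ b)
    (hb : b ≤ K) : completeProb p K b ≤ completeProb p K a := by
  induction b, hab using Nat.le_induction with
  | base => exact le_rfl
  | succ b hab ih =>
    refine le_trans ?_ (ih (by omega))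
    refine (completeProb_succ_le h0 h1 (by omega)).trans ?_
    exact mul_le_of_le_one_left (completeProb_nonneg h0 K b) h1.le

theorem integral_le_linear {Ω : Type*} [MeasurableSpace Ω] {μ : Measure Ω} [IsFiniteMeasure μ]
    {X A B C D : Ω → ℝ} (hX : IsUnitVariable X) (hA : IsUnitVariable A) (hB : IsUnitVariable B)
    (hC : IsUnitVariable C) (hD : IsUnitVariable D) (b c d : ℝ)
    (h : ∀ᵐ x ∂μ, X x ≤ A x + b * B x + c * C x + d * D x) :
    ∫ x, X x ∂μ ≤ ∫ x, A x ∂μ + b * ∫ x, B x ∂μ + c * ∫ x, C x ∂μ + d * ∫ x, D x ∂μ := by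
  have hB' := hB.integrable (μ := μ).const_mul b
  have hC' := hC.integrable (μ := μ).const_mul c
  have hD' := hD.integrable (μ := μ).const_mul d
  have hA' := hA.integrable (μ := μ)
  have h2 : Integrable (fun x => A x + b * B x) μ := hA'.add hB'
  have h3 : Integrable (fun x => A x + b * B x + c * C x) μ := h2.add hC'
  have h4 : Integrable (fun x => A x + b * B x + c * C x + d * D x) μ := h3.add hD'
  rw [← integral_const_mul, ← integral_const_mul, ← integral_const_mul, ← integral_add hA' hB',
    ← integral_add h2 hC', ← integral_add h3 hD']
  exact integral_mono_ae hX.integrable h4 h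

section Far

universe u

variable {V : Type u} [Fintype V] (G : SimpleGraph V)

/-- The conditional probability under complete randomization that all nodes of `S` are treated,
given the generated numbers. -/
noncomputable def condProb (p : ℝ) (S : Finset V) (x : V → ℝ) : ℝ :=
  completeProb p (clusterCount G x) (clusterHits G x S)

/-- The exposure probability of node `i` under complete randomization. -/
noncomputable def nodeProb (p : ℝ) (i : V) : ℝ :=
  ∫ x, condProb G p (hopBall G 1 i) x ∂uniformNumbers V

variable {p : ℝ}

theorem one_le_hits (x : V → ℝ) (i : V) : 1 ≤ clusterHits G x (hopBall G 1 i) :=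
  clusterHits_pos G x (hopBall_nonempty G 1 i)

theorem condProb_nonneg (h0 : 0 ≤ p) (S : Finset V) (x : V → ℝ) : 0 ≤ condProb G p S x :=
  completeProb_nonneg h0 _ _

theorem condProb_le_pow [Nonempty V] (h0 : 0 ≤ p) (h1 : p < 1) (S : Finset V) (x : V → ℝ) :
    condProb G p S x ≤ p ^ clusterHits G x S :=
  completeProb_le_pow h0 h1 (clusterHits_le_clusterCount G x S) (clusterCount_pos G x)

theorem condProb_mono (h0 : 0 ≤ p) (h1 : p < 1) {S T : Finset V} (h : S ⊆ T) (x : V → ℝ) :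
    condProb G p T x ≤ condProb G p S x :=
  completeProb_antitone h0 h1 (clusterHits_mono G x h) (clusterHits_le_clusterCount G x T)

theorem isUnitVariable_condProb [Nonempty V] (h0 : 0 ≤ p) (h1 : p < 1) (S : Finset V) :
    IsUnitVariable (condProb G p S) :=
  ⟨measurable_of_hits_rank G (fun K a _ => completeProb p K a) S (Classical.arbitrary V),
    condProb_nonneg G h0 S,
    fun x => (condProb_le_pow G h0 h1 S x).trans (pow_le_one₀ h0 h1.le)⟩

theorem isUnitVariable_pow_hits (h0 : 0 ≤ p) (h1 : p < 1) (S : Finset V) :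
    IsUnitVariable fun x : V → ℝ => p ^ clusterHits G x S :=
  ⟨(measurable_of_countable fun a : ℕ => p ^ a).comp (measurable_clusterHits G S),
    fun x => by positivity, fun x => pow_le_one₀ h0 h1.le⟩

theorem condProb_ball_le (h0 : 0 ≤ p) (h1 : p < 1) (i : V) (x : V → ℝ) :
    condProb G p (hopBall G 1 i) x ≤ p := by
  have : Nonempty V := ⟨i⟩
  refine (condProb_le_pow G h0 h1 _ x).trans ?_
  conv_rhs => rw [← pow_one p]
  exact pow_le_pow_of_le_one h0 h1.le (one_le_hits G x i)

theorem condProb_union_le_of_far [DecidableEq V] (h0 : 0 ≤ p) (h1 : p < 1) {x : V → ℝ}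
    (hx : Function.Injective x) {i j : V} (h : j ∉ hopBall G 4 i) :
    condProb G p (hopBall G 1 i ∪ hopBall G 1 j) x ≤
      condProb G p (hopBall G 1 i) x * condProb G p (hopBall G 1 j) x := by
  have e := clusterHits_union_of_far G hx h
  unfold condProb
  rw [e]
  exact completeProb_add_le h0 h1 (e ▸ clusterHits_le_clusterCount G x _)

/-- A lower bound `h` of the conditional exposure probability that depends only on the rank of the
node, so that it is local, and has mean at least `p / (s N)`. -/
structure IsMinorant (p s N : ℝ) (h : ℕ → ℝ) : Prop where
  nonneg : ∀ r, 0 ≤ h r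
  le_one : ∀ r, h r ≤ 1
  le_completeProb : ∀ K a r : ℕ, 1 ≤ a → a ≤ K → a ≤ r → h r ≤ completeProb p K a
  one_le : ∀ i : V, 1 ≤ s * N / p * ∫ x, h (rank G x i) ∂uniformNumbers V

/-- For `p ≤ 1 / 2` the minorant is `p` on local maxima and `0` elsewhere; for larger `p` it is the
union bound `1 - (1 - p) r`, cut off at `0`. -/
theorem exists_isMinorant {N : ℝ} (h0 : 0 < p) (h1 : p < 1)
    (hN : ∀ i, ((hopBall G 2 i).card : ℝ) ≤ N) (hp : p ≤ 1 / 2 ∨ 1 ≤ (1 - p) * N) :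
    ∃ h, IsMinorant G p (massScale p) N h := by
  rcases le_or_gt p (1 / 2) with hp2 | hp2
  · refine ⟨fun r => if r = 1 then p else 0, fun r => ?_, fun r => ?_, fun K a r ha haK har => ?_,
      fun i => ?_⟩
    · split_ifs <;> linarith
    · split_ifs <;> linarith
    · split_ifs with hr
      · obtain rfl : a = 1 := by omega
        rw [completeProb_one h0.le h1 haK]
      · exact completeProb_nonneg h0.le K a
    · have e : ∫ x, (if rank G x i = 1 then p else 0) ∂uniformNumbers V =
          p * (1 / (hopBall G 2 i).card) := by
        rw [← integral_localMax, ← integral_const_mul]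
        refine integral_congr_ae (Filter.Eventually.of_forall fun x => ?_)
        simp [localMax]
      have hs : massScale p = 1 := if_pos hp2
      have hc := one_le_hopBall_card G 2 i
      have e2 : 1 * N / p * (p * (1 / ((hopBall G 2 i).card : ℝ))) = N / (hopBall G 2 i).card := by
        field_simp
      rw [e, hs, e2, le_div_iff₀ (by linarith), one_mul]
      exact hN i
  · have hqN : 1 ≤ (1 - p) * N := hp.resolve_left (not_le.2 hp2)
    have hq : 0 < 1 - p := by linarith
    refine ⟨fun r => max (1 - (1 - p) * (r : ℝ)) 0, fun r => le_max_right _ _, fun r => ?_,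
      fun K a r ha haK har => ?_, fun i => ?_⟩
    · refine max_le ?_ zero_le_one
      have : 0 ≤ (1 - p) * (r : ℝ) := by positivity
      linarith
    · refine max_le ?_ (completeProb_nonneg h0.le K a)
      refine le_trans ?_ (one_sub_le_completeProb h0.le h1 haK (by omega))
      have : (a : ℝ) ≤ r := by exact_mod_cast har
      nlinarith
    · have hr := card_mul_integral_rank G (h := fun r => max (1 - (1 - p) * (r : ℝ)) 0)
        (fun r => le_max_right _ _) (fun r => max_le (by
          have : 0 ≤ (1 - p) * (r : ℝ) := by positivity
          linarith) zero_le_one) i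
      have hS := le_sum_posPart_of_one_le hq (by linarith) (hN i) hqN
      rw [← hr, sub_sub_cancel] at hS
      have hc := one_le_hopBall_card G 2 i
      have h2 := le_of_mul_le_mul_left hS (by linarith)
      have hNpos : 0 < N := by linarith [hN i]
      rw [div_le_iff₀ (by positivity)] at h2
      rw [massScale_of_half_le hp2.le, div_mul_eq_mul_div, le_div_iff₀ h0]
      linarith

theorem IsMinorant.isUnitVariable {s N : ℝ} {h : ℕ → ℝ} (hm : IsMinorant G p s N h) (i : V) :
    IsUnitVariable fun x : V → ℝ => h (rank G x i) :=
  ⟨(measurable_of_countable h).comp (measurable_rank G i), fun _ => hm.nonneg _,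
    fun _ => hm.le_one _⟩

theorem IsMinorant.le_condProb {s N : ℝ} {h : ℕ → ℝ} (hm : IsMinorant G p s N h) (x : V → ℝ)
    (i : V) : h (rank G x i) ≤ condProb G p (hopBall G 1 i) x :=
  hm.le_completeProb _ _ _ (one_le_hits G x i) (clusterHits_le_clusterCount G x _)
    (clusterHits_le_rank G x i)

/-- The normalized covariance of a far pair is at most half of the trivial bound. -/
theorem far_pair_le_half [DecidableEq V] {s N : ℝ} {h : ℕ → ℝ} (h0 : 0 < p) (h1 : p < 1)
    (hs : 0 < s) (hN : 0 < N) (hm : IsMinorant G p s N h) {i j : V} (hij : j ∉ hopBall G 4 i) :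
    treatProb G (completeProb p) (hopBall G 1 i ∪ hopBall G 1 j) -
      nodeProb G p i * nodeProb G p j ≤ s * N / 2 * (nodeProb G p i * nodeProb G p j) := by
  have : Nonempty V := ⟨i⟩
  have hf := fun i => isUnitVariable_condProb G h0.le h1 (hopBall G 1 i)
  have hH := hm.isUnitVariable G
  have hfH := fun i => (hf i).sub (hH i) fun x => hm.le_condProb G x i
  have hU := isUnitVariable_condProb G h0.le h1 (hopBall G 1 i ∪ hopBall G 1 j)
  have hα : ∀ k, ∫ x, h (rank G x k) ∂uniformNumbers V ≤ nodeProb G p k := fun k =>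
    integral_mono (hH k).integrable (hf k).integrable fun x => hm.le_condProb G x k
  have hα0 : ∀ k, 0 ≤ ∫ x, h (rank G x k) ∂uniformNumbers V := fun k => (hH k).integral_nonneg
  have hX1 : treatProb G (completeProb p) (hopBall G 1 i ∪ hopBall G 1 j) ≤ p * nodeProb G p i := by
    unfold nodeProb
    rw [← integral_const_mul]
    refine integral_mono_ae hU.integrable ((hf i).integrable.const_mul p) ?_
    filter_upwards [ae_injective] with x hx
    refine (condProb_union_le_of_far G h0.le h1 hx hij).trans ?_
    rw [mul_comm]
    exact mul_le_mul_of_nonneg_right (condProb_ball_le G h0.le h1 j x) ((hf i).nonneg x)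
  have hX2 : treatProb G (completeProb p) (hopBall G 1 i ∪ hopBall G 1 j) ≤ p * nodeProb G p j := by
    unfold nodeProb
    rw [← integral_const_mul]
    refine integral_mono_ae hU.integrable ((hf j).integrable.const_mul p) ?_
    filter_upwards [ae_injective] with x hx
    refine (condProb_union_le_of_far G h0.le h1 hx hij).trans ?_
    exact mul_le_mul_of_nonneg_right (condProb_ball_le G h0.le h1 i x) ((hf j).nonneg x)
  have hXB : treatProb G (completeProb p) (hopBall G 1 i ∪ hopBall G 1 j) ≤
      (∫ x, h (rank G x i) ∂uniformNumbers V) * (∫ x, h (rank G x j) ∂uniformNumbers V) +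
      p * (nodeProb G p i - ∫ x, h (rank G x i) ∂uniformNumbers V) +
      p * (nodeProb G p j - ∫ x, h (rank G x j) ∂uniformNumbers V) := by
    unfold nodeProb
    rw [← integral_mul_of_dependsOn (hH i).measurable (hH j).measurable
      (dependsOn_hits_rank G (fun _ r => h r) i) (dependsOn_hits_rank G (fun _ r => h r) j)
      (disjoint_hopBall G hij), ← integral_sub (hf i).integrable (hH i).integrable,
      ← integral_sub (hf j).integrable (hH j).integrable]
    refine (integral_le_linear hU ((hH i).mul (hH j)) (hfH i) (hfH j) hU p p 0 ?_).trans
      (le_of_eq (by ring))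
    filter_upwards [ae_injective] with x hx
    refine (condProb_union_le_of_far G h0.le h1 hx hij).trans ?_
    have a1 := condProb_ball_le G h0.le h1 i x
    have a2 := condProb_ball_le G h0.le h1 j x
    have b1 := hm.le_condProb G x i
    have b2 := hm.le_condProb G x j
    nlinarith [mul_nonneg (sub_nonneg.2 a2) (sub_nonneg.2 b1),
      mul_nonneg (sub_nonneg.2 (b1.trans a1)) (sub_nonneg.2 b2)]
  have key := le_of_excess (c := s * N / p) (r := p) (d := 1) (by positivity) h0.le zero_le_one
    (hm.one_le i) (hm.one_le j) (hα i) (hα j) hX1 hX2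
    (by rw [one_mul]; exact mul_le_mul (hα i) (hα j) (hα0 j) ((hα0 i).trans (hα i))) hXB
  have e : p * (s * N / p) / 2 = s * N / 2 := by field_simp
  rw [e] at key
  linarith

/-- The total deficit of all 1-hop balls. A single deficit is of order `1 / K` for `K` clusters, and
the 1-hop balls meet at most `N K` clusters, counted with multiplicity. -/
theorem sum_deficit_le [Nonempty V] {N τ : ℝ} {n₀ : ℕ} (h0 : 0 ≤ p) (h1 : p < 1) (hτ : 0 ≤ τ)
    (hN : ∀ i, ((hopBall G 2 i).card : ℝ) ≤ N)
    (hK : ∀ x : V → ℝ, Function.Injective x → n₀ + 1 ≤ clusterCount G x)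
    (h : ∀ K a : ℕ, n₀ + 1 ≤ K → 1 ≤ a → a ≤ K → (a : ℝ) ≤ N →
      K * (p ^ a - completeProb p K a) ≤ τ * a) :
    ∑ i : V, ∫ x, (p ^ clusterHits G x (hopBall G 1 i) - condProb G p (hopBall G 1 i) x)
      ∂uniformNumbers V ≤ τ * N := by
  have hu : ∀ i : V, IsUnitVariable fun x =>
      p ^ clusterHits G x (hopBall G 1 i) - condProb G p (hopBall G 1 i) x := fun i =>
    (isUnitVariable_pow_hits G h0 h1 _).sub (isUnitVariable_condProb G h0 h1 _)
      fun x => condProb_le_pow G h0 h1 _ x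
  rw [← integral_finsetSum _ fun i _ => (hu i).integrable]
  have hc : ∫ _x : V → ℝ, τ * N ∂uniformNumbers V = τ * N := by simp
  rw [← hc]
  refine integral_mono_ae (integrable_finsetSum _ fun i _ => (hu i).integrable)
    (integrable_const _) ?_
  filter_upwards [ae_injective] with x hx
  have hKpos : (0 : ℝ) < clusterCount G x := by exact_mod_cast clusterCount_pos G x
  refine le_of_mul_le_mul_left ?_ hKpos
  rw [Finset.mul_sum]
  calc ∑ i, (clusterCount G x : ℝ) *
        (p ^ clusterHits G x (hopBall G 1 i) - condProb G p (hopBall G 1 i) x)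
      ≤ ∑ i, τ * (clusterHits G x (hopBall G 1 i) : ℝ) := by
        refine Finset.sum_le_sum fun i _ => h _ _ (hK x hx) (one_le_hits G x i)
          (clusterHits_le_clusterCount G x _) (le_trans ?_ (hN i))
        exact_mod_cast (clusterHits_le_rank G x i).trans (rank_le G x i)
    _ = τ * ∑ i, (clusterHits G x (hopBall G 1 i) : ℝ) := by rw [Finset.mul_sum]
    _ ≤ τ * (N * clusterCount G x) :=
        mul_le_mul_of_nonneg_left (sum_clusterHits_le G hx hN) hτ
    _ = _ := by ring

end Far

section Cutoff

/-- The real-number core of the bound for far pairs. For each node, `M` and `T` are the parts of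
the exposure probability with few and with many clusters, `δ` and `ε` the corresponding deficits. -/
theorem far_pair_core {X M T δ ε M' T' δ' ε' ξ c r : ℝ} (hM : 0 ≤ M)
    (hT : 0 ≤ T) (hT' : 0 ≤ T') (hδ : 0 ≤ δ) (hδ' : 0 ≤ δ') (hε : 0 ≤ ε) (hε' : 0 ≤ ε')
    (hξ : 0 ≤ ξ) (hr : 0 ≤ r) (hcM : 1 ≤ c * M) (hcM' : 1 ≤ c * M') (hc : 0 < c)
    (hδM : δ ≤ ξ * M) (hδM' : δ' ≤ ξ * M')
    (hX : X ≤ (M + δ) * (M' + δ') + (M + δ) * (T' + ε') + (T + ε) * (M' + δ') + r * T)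
    (hX' : X ≤ (M + δ) * (M' + δ') + (M + δ) * (T' + ε') + (T + ε) * (M' + δ') + r * T') :
    X - (M + T) * (M' + T') ≤
      (c * (δ' * (1 + ξ * (1 - T / (M + T)) / 2) + (1 + ξ) * ε' * (1 - T / (M + T)) +
          r / 2 * (T / (M + T) * (1 - T / (M + T)))) +
        c * (δ * (1 + ξ * (1 - T' / (M' + T')) / 2) + (1 + ξ) * ε * (1 - T' / (M' + T')) +
          r / 2 * (T' / (M' + T') * (1 - T' / (M' + T'))))) *
        ((M + T) * (M' + T')) := by
  have m0 : 0 < M := by by_contra! h; nlinarith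
  have m0' : 0 < M' := by by_contra! h; nlinarith
  have p0 : 0 < M + T := by linarith
  have p0' : 0 < M' + T' := by linarith
  set P := M + T with hP
  set P' := M' + T' with hP'
  set u := T / P with hu
  set u' := T' / P' with hu'
  have eT : T = u * P := by rw [hu]; field_simp
  have eT' : T' = u' * P' := by rw [hu']; field_simp
  have eM : M = (1 - u) * P := by rw [sub_mul, ← eT]; linarith
  have eM' : M' = (1 - u') * P' := by rw [sub_mul, ← eT']; linarith
  have u0 : 0 ≤ u := by positivity
  have u0' : 0 ≤ u' := by positivity
  have u1 : u ≤ 1 := by rw [hu, div_le_one p0]; linarith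
  have u1' : u' ≤ 1 := by rw [hu', div_le_one p0']; linarith
  have cP : 1 ≤ c * P := hcM.trans (mul_le_mul_of_nonneg_left (by linarith) hc.le)
  have cP' : 1 ≤ c * P' := hcM'.trans (mul_le_mul_of_nonneg_left (by linarith) hc.le)
  -- the bilinear terms
  have b1 : δ * δ' ≤ (δ * (ξ * M') + ξ * M * δ') / 2 := by
    have := mul_le_mul_of_nonneg_left hδM' hδ
    have := mul_le_mul_of_nonneg_right hδM hδ'
    linarith
  have b2 : δ * ε' ≤ ξ * M * ε' := mul_le_mul_of_nonneg_right hδM hε'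
  have b3 : ε * δ' ≤ ξ * M' * ε := by
    have := mul_le_mul_of_nonneg_left hδM' hε; linarith
  -- the linear terms, where `1 ≤ c * P`
  have l1 : δ' * (P + ξ * M / 2) ≤ c * (δ' * (1 + ξ * (1 - u) / 2)) * (P * P') := by
    have h1 : 0 ≤ δ' * (P + ξ * M / 2) := by positivity
    have h2 := mul_le_mul_of_nonneg_left cP' h1
    have e : δ' * (P + ξ * M / 2) * (c * P') = c * (δ' * (1 + ξ * (1 - u) / 2)) * (P * P') := by
      rw [eM]; ring
    linarith
  have l2 : δ * (P' + ξ * M' / 2) ≤ c * (δ * (1 + ξ * (1 - u') / 2)) * (P * P') := by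
    have h1 : 0 ≤ δ * (P' + ξ * M' / 2) := by positivity
    have h2 := mul_le_mul_of_nonneg_left cP h1
    have e : δ * (P' + ξ * M' / 2) * (c * P) = c * (δ * (1 + ξ * (1 - u') / 2)) * (P * P') := by
      rw [eM']; ring
    linarith
  have l3 : (1 + ξ) * ε' * M ≤ c * ((1 + ξ) * ε' * (1 - u)) * (P * P') := by
    have h1 : 0 ≤ (1 + ξ) * ε' * M := by positivity
    have h2 := mul_le_mul_of_nonneg_left cP' h1
    have e : (1 + ξ) * ε' * M * (c * P') = c * ((1 + ξ) * ε' * (1 - u)) * (P * P') := by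
      rw [eM]; ring
    linarith
  have l4 : (1 + ξ) * ε * M' ≤ c * ((1 + ξ) * ε * (1 - u')) * (P * P') := by
    have h1 : 0 ≤ (1 + ξ) * ε * M' := by positivity
    have h2 := mul_le_mul_of_nonneg_left cP h1
    have e : (1 + ξ) * ε * M' * (c * P) = c * ((1 + ξ) * ε * (1 - u')) * (P * P') := by
      rw [eM']; ring
    linarith
  have hpp : 0 ≤ c * (P * P') := by positivity
  have key : X - P * P' ≤ δ' * (P + ξ * M / 2) + δ * (P' + ξ * M' / 2) + (1 + ξ) * ε' * M +
      (1 + ξ) * ε * M' +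
      c * (r / 2 * (u * (1 - u)) + r / 2 * (u' * (1 - u'))) * (P * P') := by
    have hTT : 0 ≤ T * T' := mul_nonneg hT hT'
    have ePP : P * P' = M * M' + M * T' + T * M' + T * T' := by rw [hP, hP']; ring
    rcases min_mul_one_sub_le u0 u1 u0' u1' with hmin | hmin
    · have t1 : r * T ≤ c * (r / 2 * (u * (1 - u)) + r / 2 * (u' * (1 - u'))) * (P * P') := by
        have h1 : r * T ≤ r * T * (c * M') := by
          have := mul_le_mul_of_nonneg_left hcM' (mul_nonneg hr hT); linarith
        have e : r * T * (c * M') = r * (u * (1 - u')) * (c * (P * P')) := by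
          rw [eM', eT]; ring
        have h2 := mul_le_mul_of_nonneg_right (mul_le_mul_of_nonneg_left hmin hr) hpp
        linarith
      rw [ePP] at t1 ⊢
      rw [hP, hP']
      linarith
    · have t1 : r * T' ≤ c * (r / 2 * (u * (1 - u)) + r / 2 * (u' * (1 - u'))) * (P * P') := by
        have h1 : r * T' ≤ r * T' * (c * M) := by
          have := mul_le_mul_of_nonneg_left hcM (mul_nonneg hr hT'); linarith
        have e : r * T' * (c * M) = r * (u' * (1 - u)) * (c * (P * P')) := by
          rw [eM, eT']; ring
        have h2 := mul_le_mul_of_nonneg_right (mul_le_mul_of_nonneg_left hmin hr) hpp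
        linarith
      rw [ePP] at t1 ⊢
      rw [hP, hP']
      linarith
  linarith

universe u

variable {V : Type u} [Fintype V] (G : SimpleGraph V)

/-- The minorant of the conditional exposure probability that is exact if the 1-hop ball meets fewer
than `A` clusters. -/
noncomputable def mainPart (p : ℝ) (A : ℕ) (h : ℕ → ℝ) (i : V) (x : V → ℝ) : ℝ :=
  if clusterHits G x (hopBall G 1 i) < A then condProb G p (hopBall G 1 i) x else h (rank G x i)

/-- The part of the conditional exposure probability that is missing in `mainPart`. -/
noncomputable def tailPart (p : ℝ) (A : ℕ) (h : ℕ → ℝ) (i : V) (x : V → ℝ) : ℝ :=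
  if clusterHits G x (hopBall G 1 i) < A then 0
  else condProb G p (hopBall G 1 i) x - h (rank G x i)

/-- The local upper bound of `mainPart`, which does not depend on the number of clusters. -/
noncomputable def mainHat (p : ℝ) (A : ℕ) (h : ℕ → ℝ) (i : V) (x : V → ℝ) : ℝ :=
  if clusterHits G x (hopBall G 1 i) < A then p ^ clusterHits G x (hopBall G 1 i)
  else h (rank G x i)

/-- The local upper bound of `tailPart`. -/
noncomputable def tailHat (p : ℝ) (A : ℕ) (h : ℕ → ℝ) (i : V) (x : V → ℝ) : ℝ :=
  if clusterHits G x (hopBall G 1 i) < A then 0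
  else p ^ clusterHits G x (hopBall G 1 i) - h (rank G x i)

variable {p s N : ℝ} {h : ℕ → ℝ} (A : ℕ)

theorem isUnitVariable_mainPart [Nonempty V] (h0 : 0 ≤ p) (h1 : p < 1)
    (hm : IsMinorant G p s N h) (i : V) : IsUnitVariable (mainPart G p A h i) := by
  refine ⟨measurable_of_hits_rank G
    (fun K a r => if a < A then completeProb p K a else h r) (hopBall G 1 i) i, fun x => ?_,
    fun x => ?_⟩ <;> unfold mainPart <;> split_ifs
  · exact condProb_nonneg G h0 _ x
  · exact hm.nonneg _
  · exact (isUnitVariable_condProb G h0 h1 _).le_one x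
  · exact hm.le_one _

theorem isUnitVariable_tailPart [Nonempty V] (h0 : 0 ≤ p) (h1 : p < 1)
    (hm : IsMinorant G p s N h) (i : V) : IsUnitVariable (tailPart G p A h i) := by
  refine ⟨measurable_of_hits_rank G
    (fun K a r => if a < A then 0 else completeProb p K a - h r) (hopBall G 1 i) i, fun x => ?_,
    fun x => ?_⟩ <;> unfold tailPart <;> split_ifs
  · exact le_rfl
  · exact sub_nonneg.2 (hm.le_condProb G x i)
  · exact zero_le_one
  · linarith [(isUnitVariable_condProb G h0 h1 (hopBall G 1 i)).le_one x, hm.nonneg (rank G x i)]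

theorem isUnitVariable_mainHat [Nonempty V] (h0 : 0 ≤ p) (h1 : p < 1)
    (hm : IsMinorant G p s N h) (i : V) : IsUnitVariable (mainHat G p A h i) := by
  refine ⟨measurable_of_hits_rank G
    (fun _ a r => if a < A then p ^ a else h r) (hopBall G 1 i) i, fun x => ?_,
    fun x => ?_⟩ <;> unfold mainHat <;> split_ifs
  · positivity
  · exact hm.nonneg _
  · exact pow_le_one₀ h0 h1.le
  · exact hm.le_one _

theorem isUnitVariable_tailHat [Nonempty V] (h0 : 0 ≤ p) (h1 : p < 1)
    (hm : IsMinorant G p s N h) (i : V) : IsUnitVariable (tailHat G p A h i) := by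
  refine ⟨measurable_of_hits_rank G
    (fun _ a r => if a < A then 0 else p ^ a - h r) (hopBall G 1 i) i, fun x => ?_,
    fun x => ?_⟩ <;> unfold tailHat <;> split_ifs
  · exact le_rfl
  · exact sub_nonneg.2 ((hm.le_condProb G x i).trans (condProb_le_pow G h0 h1 _ x))
  · exact zero_le_one
  · linarith [pow_le_one₀ h0 h1.le (n := clusterHits G x (hopBall G 1 i)), hm.nonneg (rank G x i)]

theorem mainPart_add_tailPart (i : V) (x : V → ℝ) :
    mainPart G p A h i x + tailPart G p A h i x = condProb G p (hopBall G 1 i) x := by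
  unfold mainPart tailPart; split_ifs <;> ring

theorem mainHat_add_tailHat (i : V) (x : V → ℝ) :
    mainHat G p A h i x + tailHat G p A h i x = p ^ clusterHits G x (hopBall G 1 i) := by
  unfold mainHat tailHat; split_ifs <;> ring

theorem mainPart_le_mainHat [Nonempty V] (h0 : 0 ≤ p) (h1 : p < 1) (i : V) (x : V → ℝ) :
    mainPart G p A h i x ≤ mainHat G p A h i x := by
  unfold mainPart mainHat; split_ifs
  · exact condProb_le_pow G h0 h1 _ x
  · exact le_rfl

theorem tailPart_le_tailHat [Nonempty V] (h0 : 0 ≤ p) (h1 : p < 1) (i : V) (x : V → ℝ) :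
    tailPart G p A h i x ≤ tailHat G p A h i x := by
  unfold tailPart tailHat; split_ifs
  · exact le_rfl
  · exact sub_le_sub_right (condProb_le_pow G h0 h1 _ x) _

theorem tailPart_le_pow [Nonempty V] (h0 : 0 ≤ p) (h1 : p < 1) (hm : IsMinorant G p s N h) (i : V)
    (x : V → ℝ) : tailPart G p A h i x ≤ p ^ A := by
  unfold tailPart; split_ifs with ha
  · positivity
  · have := (condProb_le_pow G h0 h1 (hopBall G 1 i) x).trans
      (pow_le_pow_of_le_one h0 h1.le (not_lt.1 ha))
    linarith [hm.nonneg (rank G x i)]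

/-- The bound for the covariance of a far pair, with its two halves. -/
noncomputable def farTerm (p c ξ : ℝ) (A : ℕ) (h : ℕ → ℝ) (i j : V) : ℝ :=
  c * ((∫ x, mainHat G p A h j x - mainPart G p A h j x ∂uniformNumbers V) *
      (1 + ξ * (1 - (∫ x, tailPart G p A h i x ∂uniformNumbers V) / nodeProb G p i) / 2) +
    (1 + ξ) * (∫ x, tailHat G p A h j x - tailPart G p A h j x ∂uniformNumbers V) *
      (1 - (∫ x, tailPart G p A h i x ∂uniformNumbers V) / nodeProb G p i) +
    p ^ A / 2 * ((∫ x, tailPart G p A h i x ∂uniformNumbers V) / nodeProb G p i *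
      (1 - (∫ x, tailPart G p A h i x ∂uniformNumbers V) / nodeProb G p i)))

theorem nodeProb_eq_add [Nonempty V] (h0 : 0 ≤ p) (h1 : p < 1) (hm : IsMinorant G p s N h) (i : V) :
    nodeProb G p i = ∫ x, mainPart G p A h i x ∂uniformNumbers V +
      ∫ x, tailPart G p A h i x ∂uniformNumbers V := by
  rw [← integral_add (isUnitVariable_mainPart G A h0 h1 hm i).integrable
    (isUnitVariable_tailPart G A h0 h1 hm i).integrable]
  simp_rw [mainPart_add_tailPart]
  rfl

theorem one_le_mul_integral_mainPart (h0 : 0 < p) (h1 : p < 1) (hs : 0 ≤ s) (hN : 0 ≤ N)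
    (hm : IsMinorant G p s N h) (i : V) :
    1 ≤ s * N / p * ∫ x, mainPart G p A h i x ∂uniformNumbers V := by
  have : Nonempty V := ⟨i⟩
  refine (hm.one_le i).trans (mul_le_mul_of_nonneg_left ?_ (by positivity))
  refine integral_mono (hm.isUnitVariable G i).integrable
    (isUnitVariable_mainPart G A h0.le h1 hm i).integrable fun x => ?_
  change h (rank G x i) ≤ mainPart G p A h i x
  unfold mainPart; split_ifs
  · exact hm.le_condProb G x i
  · exact le_rfl

/-- For far nodes the conditional probability that both are exposed is at most the product of the
two conditional exposure probabilities. Each factor is split into its main part and its tail. The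
local upper bounds are independent; only the product of the two tails is bounded trivially, by
`p ^ A` times either of them. -/
theorem far_pair_le_farTerm [DecidableEq V] {ξ t : ℝ} {n₀ : ℕ} (h0 : 0 < p) (h1 : p < 1)
    (hs : 0 < s) (hN : 0 < N) (hm : IsMinorant G p s N h) (hA : IsCutoff p n₀ A ξ t)
    (hK : ∀ x : V → ℝ, Function.Injective x → n₀ + 1 ≤ clusterCount G x)
    {i j : V} (hij : j ∉ hopBall G 4 i) :
    treatProb G (completeProb p) (hopBall G 1 i ∪ hopBall G 1 j) -
      nodeProb G p i * nodeProb G p j ≤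
      (farTerm G p (s * N / p) ξ A h i j + farTerm G p (s * N / p) ξ A h j i) *
        (nodeProb G p i * nodeProb G p j) := by
  have : Nonempty V := ⟨i⟩
  have uM := isUnitVariable_mainPart G A h0.le h1 hm
  have uT := isUnitVariable_tailPart G A h0.le h1 hm
  have uM' := isUnitVariable_mainHat G A h0.le h1 hm
  have uT' := isUnitVariable_tailHat G A h0.le h1 hm
  have dM := fun k => (uM' k).sub (uM k) fun x => mainPart_le_mainHat G A h0.le h1 k x
  have dT := fun k => (uT' k).sub (uT k) fun x => tailPart_le_tailHat G A h0.le h1 k x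
  have hU := isUnitVariable_condProb G h0.le h1 (hopBall G 1 i ∪ hopBall G 1 j)
  have eM : ∀ k, ∫ x, mainHat G p A h k x ∂uniformNumbers V =
      ∫ x, mainPart G p A h k x ∂uniformNumbers V +
        ∫ x, mainHat G p A h k x - mainPart G p A h k x ∂uniformNumbers V := by
    intro k; rw [integral_sub (uM' k).integrable (uM k).integrable]; ring
  have eT : ∀ k, ∫ x, tailHat G p A h k x ∂uniformNumbers V =
      ∫ x, tailPart G p A h k x ∂uniformNumbers V +
        ∫ x, tailHat G p A h k x - tailPart G p A h k x ∂uniformNumbers V := by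
    intro k; rw [integral_sub (uT' k).integrable (uT k).integrable]; ring
  have hδ : ∀ k, ∫ x, mainHat G p A h k x - mainPart G p A h k x ∂uniformNumbers V ≤
      ξ * ∫ x, mainPart G p A h k x ∂uniformNumbers V := by
    intro k
    rw [← integral_const_mul]
    refine integral_mono_ae (dM k).integrable ((uM k).integrable.const_mul ξ) ?_
    filter_upwards [ae_injective] with x hx
    have hKx := hK x hx
    unfold mainHat mainPart
    split_ifs with ha
    · rcases (one_le_hits G x k).eq_or_lt with h2 | h2
      · unfold condProb
        rw [← h2, pow_one, completeProb_one h0.le h1 (clusterCount_pos G x), sub_self]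
        exact mul_nonneg hA.xi_nonneg h0.le
      · exact hA.deficit_le_mul _ _ hKx h2 ha (clusterHits_le_clusterCount G x _)
    · rw [sub_self]
      exact mul_nonneg hA.xi_nonneg (hm.nonneg _)
  have dep1 : ∀ k, DependsOn (mainHat G p A h k) (hopBall G 2 k : Set V) := fun k =>
    dependsOn_hits_rank G (fun a r => if a < A then p ^ a else h r) k
  have dep2 : ∀ k, DependsOn (tailHat G p A h k) (hopBall G 2 k : Set V) := fun k =>
    dependsOn_hits_rank G (fun a r => if a < A then 0 else p ^ a - h r) k
  have hd : Disjoint (hopBall G 2 i) (hopBall G 2 j) := disjoint_hopBall G hij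
  have i1 := integral_mul_of_dependsOn (uM' i).measurable (uM' j).measurable (dep1 i) (dep1 j) hd
  have i2 := integral_mul_of_dependsOn (uM' i).measurable (uT' j).measurable (dep1 i) (dep2 j) hd
  have i3 := integral_mul_of_dependsOn (uT' i).measurable (uM' j).measurable (dep2 i) (dep1 j) hd
  have hpt : ∀ᵐ x ∂uniformNumbers V,
      condProb G p (hopBall G 1 i ∪ hopBall G 1 j) x ≤
        mainHat G p A h i x * mainHat G p A h j x + mainHat G p A h i x * tailHat G p A h j x +
        tailHat G p A h i x * mainHat G p A h j x +
        tailPart G p A h i x * tailPart G p A h j x := by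
    filter_upwards [ae_injective] with x hx
    refine (condProb_union_le_of_far G h0.le h1 hx hij).trans ?_
    rw [← mainPart_add_tailPart G A (h := h) i x, ← mainPart_add_tailPart G A (h := h) j x]
    have a1 := mul_le_mul (mainPart_le_mainHat G A (h := h) h0.le h1 i x)
      (mainPart_le_mainHat G A (h := h) h0.le h1 j x) ((uM j).nonneg x) ((uM' i).nonneg x)
    have a2 := mul_le_mul (mainPart_le_mainHat G A (h := h) h0.le h1 i x)
      (tailPart_le_tailHat G A (h := h) h0.le h1 j x) ((uT j).nonneg x) ((uM' i).nonneg x)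
    have a3 := mul_le_mul (tailPart_le_tailHat G A (h := h) h0.le h1 i x)
      (mainPart_le_mainHat G A (h := h) h0.le h1 j x) ((uM j).nonneg x) ((uT' i).nonneg x)
    linarith
  have hX := integral_le_linear hU ((uM' i).mul (uM' j)) ((uM' i).mul (uT' j))
    ((uT' i).mul (uM' j)) (uT i) 1 1 (p ^ A) (hpt.mono fun x hx => hx.trans (by
      have := mul_le_mul_of_nonneg_left (tailPart_le_pow G A h0.le h1 hm j x) ((uT i).nonneg x)
      linarith))
  have hX' := integral_le_linear hU ((uM' i).mul (uM' j)) ((uM' i).mul (uT' j))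
    ((uT' i).mul (uM' j)) (uT j) 1 1 (p ^ A) (hpt.mono fun x hx => hx.trans (by
      have := mul_le_mul_of_nonneg_right (tailPart_le_pow G A h0.le h1 hm i x) ((uT j).nonneg x)
      linarith))
  rw [i1, i2, i3, eM i, eM j, eT i, eT j, one_mul, one_mul] at hX hX'
  have hc : 0 < s * N / p := by positivity
  have key := far_pair_core (uM i).integral_nonneg (uT i).integral_nonneg
    (uT j).integral_nonneg (dM i).integral_nonneg (dM j).integral_nonneg (dT i).integral_nonneg
    (dT j).integral_nonneg hA.xi_nonneg (by positivity : 0 ≤ p ^ A)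
    (one_le_mul_integral_mainPart G A h0 h1 hs.le hN.le hm i)
    (one_le_mul_integral_mainPart G A h0 h1 hs.le hN.le hm j) hc (hδ i) (hδ j) hX hX'
  rw [← nodeProb_eq_add G A h0.le h1 hm i, ← nodeProb_eq_add G A h0.le h1 hm j] at key
  exact key

end Cutoff

/-! ### Complete cluster-level randomization: the sum over far pairs -/

section FarSum

/-- One row of the double sum, for the total deficits `X` of the main parts and `Y` of the tails. -/
theorem row_le_of_tailBound {t ξ c B X Y Z N u : ℝ} (hX : 0 ≤ X) (hY : 0 ≤ Y) (hξ : 0 ≤ ξ)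
    (hN : 0 ≤ N) (hXY : X + Y ≤ t * N) (hu : 0 ≤ u) (hu1 : u ≤ 1) (hb : TailBound t ξ c B)
    (hZ : Z ≤ c * N) :
    (1 + ξ * (1 - u) / 2) * X + (1 + ξ) * (1 - u) * Y + Z * (u * (1 - u)) ≤ N * B := by
  have hv : 0 ≤ 1 - u := by linarith
  have hξv : 0 ≤ ξ * (1 - u) := mul_nonneg hξ hv
  obtain ⟨h1, h2⟩ := hb u hu hu1
  have h1' := mul_le_mul_of_nonneg_left h1 hN
  have h2' := mul_le_mul_of_nonneg_left h2 hN
  have hZ' := mul_le_mul_of_nonneg_right hZ (mul_nonneg hu hv)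
  have a1 : 0 ≤ 1 + ξ * (1 - u) / 2 := by linarith
  have a2 : 0 ≤ (1 + ξ) * (1 - u) := by nlinarith
  rcases le_total (1 + ξ * (1 - u) / 2) ((1 + ξ) * (1 - u)) with h | h
  · have b1 := mul_le_mul_of_nonneg_right h hX
    have b2 := mul_le_mul_of_nonneg_left hXY a2
    linarith
  · have b1 := mul_le_mul_of_nonneg_right h hY
    have b2 := mul_le_mul_of_nonneg_left hXY a1
    linarith

universe u

variable {V : Type u} [Fintype V] (G : SimpleGraph V) {p : ℝ}

theorem farTerm_nonneg [Nonempty V] {s N c ξ : ℝ} {h : ℕ → ℝ} (A : ℕ) (h0 : 0 < p) (h1 : p < 1)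
    (hc : 0 ≤ c) (hξ : 0 ≤ ξ) (hm : IsMinorant G p s N h) (i j : V) :
    0 ≤ farTerm G p c ξ A h i j ∧
      0 ≤ (∫ x, tailPart G p A h i x ∂uniformNumbers V) / nodeProb G p i ∧
      (∫ x, tailPart G p A h i x ∂uniformNumbers V) / nodeProb G p i ≤ 1 := by
  have uM := isUnitVariable_mainPart G A h0.le h1 hm
  have uT := isUnitVariable_tailPart G A h0.le h1 hm
  have dM := ((isUnitVariable_mainHat G A h0.le h1 hm j).sub (uM j)
    fun x => mainPart_le_mainHat G A h0.le h1 j x).integral_nonneg (μ := uniformNumbers V)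
  have dT := ((isUnitVariable_tailHat G A h0.le h1 hm j).sub (uT j)
    fun x => tailPart_le_tailHat G A h0.le h1 j x).integral_nonneg (μ := uniformNumbers V)
  have hM := (uM i).integral_nonneg (μ := uniformNumbers V)
  have hT := (uT i).integral_nonneg (μ := uniformNumbers V)
  have e := nodeProb_eq_add G A h0.le h1 hm i
  have hu0 : 0 ≤ (∫ x, tailPart G p A h i x ∂uniformNumbers V) / nodeProb G p i :=
    div_nonneg hT (by linarith)
  have hu1 : (∫ x, tailPart G p A h i x ∂uniformNumbers V) / nodeProb G p i ≤ 1 :=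
    div_le_one_of_le₀ (by linarith) (by linarith)
  refine ⟨?_, hu0, hu1⟩
  unfold farTerm
  have hv := sub_nonneg.2 hu1
  positivity

/-- With `n₀ + 1` the least number of clusters, each node has at most `n₀ (d_max + 1)` far nodes. -/
theorem exists_minimal_clusterCount [DecidableEq V] [DecidableRel G.Adj] [Nonempty V] :
    ∃ n₀ : ℕ, (∀ x : V → ℝ, Function.Injective x → n₀ + 1 ≤ clusterCount G x) ∧
      ∀ i, (((hopBall G 4 i)ᶜ : Finset V).card : ℝ) ≤ n₀ * (G.maxDegree + 1) := by
  classical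
  have hex : ∃ n, ∃ x : V → ℝ, Function.Injective x ∧ clusterCount G x = n := by
    obtain ⟨x, hx⟩ := exists_injective (V := V)
    exact ⟨_, x, hx, rfl⟩
  obtain ⟨x, hx, e⟩ := Nat.find_spec hex
  have hpos := clusterCount_pos G x
  refine ⟨Nat.find hex - 1, fun y hy => ?_, fun i => ?_⟩
  · have := Nat.find_min' hex ⟨y, hy, rfl⟩
    omega
  · have := card_far_le G hx i
    rw [e] at this
    exact_mod_cast this

/-- If `(1 - p) N < 1`, then the conditional exposure probabilities are bounded below by a linear
function of the rank, and even by `p / 2` on average. -/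
theorem exists_isMinorant_of_lt {N : ℝ} (h0 : 0 < p) (h1 : p < 1)
    (hN : ∀ i, ((hopBall G 2 i).card : ℝ) ≤ N) (hN0 : 0 < N) (hp : (1 - p) * N < 1) :
    ∃ h, IsMinorant G p (2 / N) N h := by
  have hq : 0 < 1 - p := by linarith
  have hr1 : ∀ r : ℕ, max (1 - (1 - p) * (r : ℝ)) 0 ≤ 1 := fun r => max_le (by
    have : 0 ≤ (1 - p) * (r : ℝ) := by positivity
    linarith) zero_le_one
  refine ⟨fun r => max (1 - (1 - p) * (r : ℝ)) 0, fun r => le_max_right _ _, hr1,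
    fun K a r ha haK har => ?_, fun i => ?_⟩
  · refine max_le ?_ (completeProb_nonneg h0.le K a)
    refine le_trans ?_ (one_sub_le_completeProb h0.le h1 haK (by omega))
    have : (a : ℝ) ≤ r := by exact_mod_cast har
    nlinarith
  · have hr := card_mul_integral_rank G (h := fun r => max (1 - (1 - p) * (r : ℝ)) 0)
      (fun r => le_max_right _ _) hr1 i
    have hS := le_sum_posPart (1 - p) (hopBall G 2 i).card
    rw [← hr] at hS
    have hc := one_le_hopBall_card G 2 i
    have e : 2 / N * N / p = 2 / p := by field_simp
    rw [e, div_mul_eq_mul_div, le_div_iff₀ h0, one_mul]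
    have h2 : ((hopBall G 2 i).card : ℝ) * (1 - (1 - p) * ((hopBall G 2 i).card + 1) / 2) ≤
        (hopBall G 2 i).card * ∫ x, max (1 - (1 - p) * (rank G x i : ℝ)) 0 ∂uniformNumbers V := by
      refine le_trans (le_of_eq ?_) hS; ring
    have h3 := le_of_mul_le_mul_left h2 (by linarith)
    have h4 := mul_le_mul_of_nonneg_left (hN i) hq.le
    linarith

variable [DecidableEq V]

/-- If exposure probabilities are at least `p / 2`, then the covariance of a far pair is bounded by
the deficits directly. -/
theorem far_pair_le_of_lt {N : ℝ} {h : ℕ → ℝ} (h0 : 0 < p) (h1 : p < 1) (hN0 : 0 < N)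
    (hm : IsMinorant G p (2 / N) N h) {i j : V} (hij : j ∉ hopBall G 4 i) :
    treatProb G (completeProb p) (hopBall G 1 i ∪ hopBall G 1 j) -
      nodeProb G p i * nodeProb G p j ≤
      3 / p * (∫ x, (p ^ clusterHits G x (hopBall G 1 i) - condProb G p (hopBall G 1 i) x)
          ∂uniformNumbers V +
        ∫ x, (p ^ clusterHits G x (hopBall G 1 j) - condProb G p (hopBall G 1 j) x)
          ∂uniformNumbers V) * (nodeProb G p i * nodeProb G p j) := by
  have : Nonempty V := ⟨i⟩
  have uF := fun k => isUnitVariable_pow_hits G h0.le h1 (hopBall G 1 k)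
  have uP := fun k => isUnitVariable_condProb G h0.le h1 (hopBall G 1 k)
  have hU := isUnitVariable_condProb G h0.le h1 (hopBall G 1 i ∪ hopBall G 1 j)
  have hle : ∀ k, nodeProb G p k ≤ ∫ x, p ^ clusterHits G x (hopBall G 1 k) ∂uniformNumbers V :=
    fun k => integral_mono (uP k).integrable (uF k).integrable
      fun x => condProb_le_pow G h0.le h1 _ x
  have hFp : ∀ k, ∫ x, p ^ clusterHits G x (hopBall G 1 k) ∂uniformNumbers V ≤ p := by
    intro k
    have hc : ∫ _x : V → ℝ, p ∂uniformNumbers V = p := by simp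
    refine le_trans (integral_mono (uF k).integrable (integrable_const p) fun x => ?_) hc.le
    calc p ^ clusterHits G x (hopBall G 1 k) ≤ p ^ 1 :=
          pow_le_pow_of_le_one h0.le h1.le (one_le_hits G x k)
      _ = p := pow_one p
  have hP : ∀ k, 1 ≤ 2 / p * nodeProb G p k := by
    intro k
    have e : 2 / N * N / p = 2 / p := by field_simp
    have := hm.one_le k
    rw [e] at this
    refine this.trans (mul_le_mul_of_nonneg_left ?_ (by positivity))
    exact integral_mono (hm.isUnitVariable G k).integrable (uP k).integrable
      fun x => hm.le_condProb G x k
  have hX : treatProb G (completeProb p) (hopBall G 1 i ∪ hopBall G 1 j) ≤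
      (∫ x, p ^ clusterHits G x (hopBall G 1 i) ∂uniformNumbers V) *
        ∫ x, p ^ clusterHits G x (hopBall G 1 j) ∂uniformNumbers V := by
    rw [← integral_mul_of_dependsOn (uF i).measurable (uF j).measurable
      (dependsOn_hits_rank G (fun a _ => p ^ a) i) (dependsOn_hits_rank G (fun a _ => p ^ a) j)
      (disjoint_hopBall G hij)]
    refine hU.integral_mono_ae ((uF i).mul (uF j)) ?_
    filter_upwards [ae_injective] with x hx
    exact (condProb_union_le_of_far G h0.le h1 hx hij).trans
      (mul_le_mul (condProb_le_pow G h0.le h1 _ x) (condProb_le_pow G h0.le h1 _ x)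
        ((uP j).nonneg x) ((uF i).nonneg x))
  rw [integral_sub (uF i).integrable (uP i).integrable,
    integral_sub (uF j).integrable (uP j).integrable]
  change _ ≤ 3 / p * (_ - nodeProb G p i + (_ - nodeProb G p j)) * _
  have hi := hle i
  have hj := hle j
  have hFi := hFp i
  have hFj := hFp j
  have hPi := hP i
  have hPj := hP j
  set F := ∫ x, p ^ clusterHits G x (hopBall G 1 i) ∂uniformNumbers V
  set F' := ∫ x, p ^ clusterHits G x (hopBall G 1 j) ∂uniformNumbers V
  set P := nodeProb G p i
  set P' := nodeProb G p j
  have hPi' : p ≤ 2 * P := by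
    rw [div_mul_eq_mul_div, le_div_iff₀ h0] at hPi; linarith
  have hPj' : p ≤ 2 * P' := by
    rw [div_mul_eq_mul_div, le_div_iff₀ h0] at hPj; linarith
  have hP0 : 0 < P := by linarith
  have hP0' : 0 < P' := by linarith
  have k1 : (F - P) * P' ≤ 2 / p * (F - P) * (P * P') := by
    have := mul_le_mul_of_nonneg_left hPi (mul_nonneg (sub_nonneg.2 hi) hP0'.le)
    linarith
  have k2 : (F' - P') * P ≤ 2 / p * (F' - P') * (P * P') := by
    have := mul_le_mul_of_nonneg_left hPj (mul_nonneg (sub_nonneg.2 hj) hP0.le)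
    linarith
  have k3 : (F - P) * (F' - P') ≤ ((F - P) * P' + (F' - P') * P) / 2 := by
    have a1 := mul_le_mul_of_nonneg_left (show F' - P' ≤ P' by linarith) (sub_nonneg.2 hi)
    have a2 := mul_le_mul_of_nonneg_left (show F - P ≤ P by linarith) (sub_nonneg.2 hj)
    linarith
  have e3 : (3 : ℝ) / p = 3 / 2 * (2 / p) := by ring
  rw [e3]
  have : treatProb G (completeProb p) (hopBall G 1 i ∪ hopBall G 1 j) - P * P' ≤
      (F - P) * P' + (F' - P') * P + (F - P) * (F' - P') := by linarith
  linarith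

variable [DecidableRel G.Adj]

/-- The bound for all far pairs together. The second bound uses `d_max + 1 ≤ (4 / 5) N` for
`N = κ (d_max + 1)`. -/
theorem exists_far_bound [Nonempty V] {κ : ℝ} (hκ : RestrictedGrowth G κ) (h0 : 0 < p)
    (h1 : p < 1) (hN4 : 4 ≤ κ * (G.maxDegree + 1)) :
    ∃ U : V → V → ℝ, (∀ i j, 0 ≤ U i j) ∧
      (∀ i j, j ∉ hopBall G 4 i →
        treatProb G (completeProb p) (hopBall G 1 i ∪ hopBall G 1 j) -
          nodeProb G p i * nodeProb G p j ≤ U i j * (nodeProb G p i * nodeProb G p j)) ∧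
      ∑ i, ∑ j ∈ (hopBall G 4 i)ᶜ, U i j ≤
        Fintype.card V * ((κ * (G.maxDegree + 1)) ^ 2 / p * (3 / 4)) ∧
      (5 / 4 ≤ κ → ∑ i, ∑ j ∈ (hopBall G 4 i)ᶜ, U i j ≤
        Fintype.card V * ((κ * (G.maxDegree + 1)) ^ 2 / p * 0.69)) := by
  set D : ℝ := G.maxDegree + 1 with hD
  set N : ℝ := κ * D with hN
  have hκ1 := hκ.one_le
  have hD0 : 0 < D := by positivity
  have hN0 : 0 < N := by linarith
  have hDN : D ≤ N := by nlinarith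
  have hN2 : ∀ i, ((hopBall G 2 i).card : ℝ) ≤ N := hκ.card_two_le
  obtain ⟨n₀, hK, hfar⟩ := exists_minimal_clusterCount G
  have hs := massScale_pos h1
  set s := massScale p with hsdef
  by_cases hp : p ≤ 1 / 2 ∨ 1 ≤ (1 - p) * N
  · obtain ⟨h, hm⟩ := exists_isMinorant G h0 h1 hN2 hp
    rcases le_or_exists_isCutoff (n₀ := n₀) h0 h1 with hT | ⟨A, ξ, t, hA⟩
    -- so few far pairs that the trivial bound suffices
    · have hrow : ∀ B : ℝ, 3 / 4 * D ≤ N * B →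
          ∑ i : V, ∑ j ∈ (hopBall G 4 i)ᶜ, s * N / 2 ≤ Fintype.card V * (N ^ 2 / p * B) := by
        intro B hB
        rw [← nsmul_eq_mul, ← Finset.card_univ, ← Finset.sum_const]
        refine Finset.sum_le_sum fun i _ => ?_
        rw [Finset.sum_const, nsmul_eq_mul]
        have e : N ^ 2 / p * B = N / p * (N * B) := by ring
        rw [e]
        refine le_trans ?_ (mul_le_mul_of_nonneg_left hB (by positivity))
        refine (mul_le_mul_of_nonneg_right (hfar i) (by positivity)).trans ?_
        have e2 : (n₀ : ℝ) * D * (s * N / 2) = N / p * (s * p * n₀ * D / 2) := by field_simp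
        rw [e2]
        refine mul_le_mul_of_nonneg_left ?_ (by positivity)
        have := mul_le_mul_of_nonneg_right hT hD0.le
        linarith
      refine ⟨fun _ _ => s * N / 2, fun _ _ => by positivity,
        fun i j hij => far_pair_le_half G h0 h1 hs hN0 hm hij, hrow _ (by linarith),
        fun hκ' => hrow _ ?_⟩
      have : 5 / 4 * D ≤ N := mul_le_mul_of_nonneg_right hκ' hD0.le
      linarith
    -- main parts and tails with respect to the cutoff `A`
    · have hc : 0 ≤ s * N / p := by positivity
      have hW := fun i j => farTerm_nonneg G (c := s * N / p) A h0 h1 hc hA.xi_nonneg hm i j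
      have uM := isUnitVariable_mainPart G A h0.le h1 hm
      have uT := isUnitVariable_tailPart G A h0.le h1 hm
      have uM' := isUnitVariable_mainHat G A h0.le h1 hm
      have uT' := isUnitVariable_tailHat G A h0.le h1 hm
      have dM := fun k => (uM' k).sub (uM k) fun x => mainPart_le_mainHat G A h0.le h1 k x
      have dT := fun k => (uT' k).sub (uT k) fun x => tailPart_le_tailHat G A h0.le h1 k x
      set δ : V → ℝ := fun j => ∫ x, mainHat G p A h j x - mainPart G p A h j x ∂uniformNumbers V
        with hδ
      set ε : V → ℝ := fun j => ∫ x, tailHat G p A h j x - tailPart G p A h j x ∂uniformNumbers V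
        with hε
      have hδ0 : ∀ j, 0 ≤ δ j := fun j => (dM j).integral_nonneg
      have hε0 : ∀ j, 0 ≤ ε j := fun j => (dT j).integral_nonneg
      have hsum : 2 * s * (∑ j, δ j) + 2 * s * ∑ j, ε j ≤ t * N := by
        have hd := sum_deficit_le G (N := N) (τ := t / (2 * s)) (n₀ := n₀) h0.le h1
          (div_nonneg hA.t_nonneg (by positivity)) hN2 hK fun K a hK ha haK _ => by
            have := hA.deficit_le K a hK ha haK
            rw [div_mul_eq_mul_div, le_div_iff₀ (by positivity)]
            linarith
        have e : ∀ j, ∫ x, (p ^ clusterHits G x (hopBall G 1 j) - condProb G p (hopBall G 1 j) x)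
            ∂uniformNumbers V = δ j + ε j := by
          intro j
          rw [hδ, hε, ← integral_add (dM j).integrable (dT j).integrable]
          refine integral_congr_ae (Filter.Eventually.of_forall fun x => ?_)
          change p ^ clusterHits G x (hopBall G 1 j) - condProb G p (hopBall G 1 j) x =
            _ - _ + (_ - _)
          rw [← mainHat_add_tailHat G A (h := h) j x, ← mainPart_add_tailPart G A (h := h) j x]
          ring
        simp_rw [e, Finset.sum_add_distrib] at hd
        rw [div_mul_eq_mul_div, le_div_iff₀ (by positivity)] at hd
        linarith
      have hrow : ∀ B c : ℝ, TailBound t ξ c B → s * p ^ A * n₀ * D ≤ c * N →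
          ∑ i : V, ∑ j ∈ (hopBall G 4 i)ᶜ,
            (farTerm G p (s * N / p) ξ A h i j + farTerm G p (s * N / p) ξ A h j i) ≤
          Fintype.card V * (N ^ 2 / p * B) := by
        intro B c hb hcN
        have hsymm : ∑ i : V, ∑ j ∈ (hopBall G 4 i)ᶜ, farTerm G p (s * N / p) ξ A h j i =
            ∑ i : V, ∑ j ∈ (hopBall G 4 i)ᶜ, farTerm G p (s * N / p) ξ A h i j := by
          refine Finset.sum_comm' fun i j => ?_
          simp [mem_hopBall_comm G (i := i) (j := j)]
        simp_rw [Finset.sum_add_distrib]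
        rw [hsymm, ← two_mul, Finset.mul_sum, ← nsmul_eq_mul, ← Finset.card_univ,
          ← Finset.sum_const]
        refine Finset.sum_le_sum fun i _ => ?_
        obtain ⟨-, hu0, hu1⟩ := hW i i
        set u := (∫ x, tailPart G p A h i x ∂uniformNumbers V) / nodeProb G p i with hu
        have hrw : ∀ j, farTerm G p (s * N / p) ξ A h i j = s * N / p *
            (δ j * (1 + ξ * (1 - u) / 2) + (1 + ξ) * ε j * (1 - u) +
              p ^ A / 2 * (u * (1 - u))) := fun j => rfl
        simp_rw [hrw]
        rw [← Finset.mul_sum, Finset.sum_add_distrib, Finset.sum_add_distrib, ← Finset.sum_mul,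
          ← Finset.sum_mul, ← Finset.mul_sum, Finset.sum_const, nsmul_eq_mul]
        have hξ := hA.xi_nonneg
        have hv : 0 ≤ 1 - u := by linarith
        have hδle : ∑ j ∈ (hopBall G 4 i)ᶜ, δ j ≤ ∑ j, δ j :=
          Finset.sum_le_sum_of_subset_of_nonneg (Finset.subset_univ _) fun j _ _ => hδ0 j
        have hεle : ∑ j ∈ (hopBall G 4 i)ᶜ, ε j ≤ ∑ j, ε j :=
          Finset.sum_le_sum_of_subset_of_nonneg (Finset.subset_univ _) fun j _ _ => hε0 j
        have key := row_le_of_tailBound (X := 2 * s * ∑ j, δ j) (Y := 2 * s * ∑ j, ε j)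
          (mul_nonneg (by positivity) (Finset.sum_nonneg fun j _ => hδ0 j))
          (mul_nonneg (by positivity) (Finset.sum_nonneg fun j _ => hε0 j)) hξ hN0.le hsum hu0 hu1
          hb hcN
        have b1 : (∑ j ∈ (hopBall G 4 i)ᶜ, δ j) * (1 + ξ * (1 - u) / 2) ≤
            (∑ j, δ j) * (1 + ξ * (1 - u) / 2) := mul_le_mul_of_nonneg_right hδle (by positivity)
        have b2 : (1 + ξ) * (∑ j ∈ (hopBall G 4 i)ᶜ, ε j) * (1 - u) ≤
            (1 + ξ) * (∑ j, ε j) * (1 - u) :=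
          mul_le_mul_of_nonneg_right (mul_le_mul_of_nonneg_left hεle (by positivity)) hv
        have b3 : (((hopBall G 4 i)ᶜ : Finset V).card : ℝ) * (p ^ A / 2 * (u * (1 - u))) ≤
            n₀ * D * (p ^ A / 2 * (u * (1 - u))) :=
          mul_le_mul_of_nonneg_right (hfar i) (by positivity)
        have e1 : N ^ 2 / p * B = N / p * (N * B) := by ring
        rw [e1]
        refine le_trans ?_ (mul_le_mul_of_nonneg_left key (by positivity))
        have e2 : ∀ z : ℝ, 2 * (s * N / p * z) = N / p * (2 * s * z) := by intro z; ring
        rw [e2]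
        refine mul_le_mul_of_nonneg_left ?_ (by positivity)
        have b4 := mul_le_mul_of_nonneg_left (add_le_add (add_le_add b1 b2) b3)
          (show 0 ≤ 2 * s by positivity)
        refine b4.trans (le_of_eq ?_)
        ring
      refine ⟨fun i j => farTerm G p (s * N / p) ξ A h i j + farTerm G p (s * N / p) ξ A h j i,
        fun i j => add_nonneg (hW i j).1 (hW j i).1,
        fun i j hij => far_pair_le_farTerm G A h0 h1 hs hN0 hm hA hK hij,
        hrow _ _ hA.tail ?_, fun hκ' => hrow _ _ hA.tail' ?_⟩
      · exact mul_le_mul_of_nonneg_left hDN (by positivity)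
      · have h5 : D ≤ 4 / 5 * N := by
          have : 5 / 4 * D ≤ N := mul_le_mul_of_nonneg_right hκ' hD0.le
          linarith
        refine (mul_le_mul_of_nonneg_left h5 (by positivity)).trans (le_of_eq (by ring))
  -- `p` so close to `1` that exposure probabilities are at least `p / 2`
  · rw [not_or, not_le, not_le] at hp
    obtain ⟨h, hm⟩ := exists_isMinorant_of_lt G h0 h1 hN2 hN0 hp.2
    set e : V → ℝ := fun i => ∫ x, (p ^ clusterHits G x (hopBall G 1 i) -
      condProb G p (hopBall G 1 i) x) ∂uniformNumbers V with he
    have he0 : ∀ i, 0 ≤ e i := fun i => integral_nonneg fun x =>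
      sub_nonneg.2 (condProb_le_pow G h0.le h1 _ x)
    have hsum : ∑ i, e i ≤ (N - 1) / (2 * N) * N := by
      refine sum_deficit_le G (n₀ := n₀) h0.le h1 (div_nonneg (by linarith) (by linarith)) hN2 hK
        fun K a hK ha haK haN => ?_
      refine (mul_deficit_le_half h0.le h1 ha haK).trans ?_
      rw [div_mul_eq_mul_div, div_le_div_iff₀ (by norm_num) (by positivity)]
      nlinarith
    have e1 : (N - 1) / (2 * N) * N = (N - 1) / 2 := by field_simp
    rw [e1] at hsum
    have htot : ∑ i : V, ∑ j ∈ (hopBall G 4 i)ᶜ, 3 / p * (e i + e j) ≤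
        Fintype.card V * (N ^ 2 / p * (9 / 16)) := by
      have hall : ∑ i : V, ∑ j ∈ (hopBall G 4 i)ᶜ, 3 / p * (e i + e j) ≤
          ∑ i : V, ∑ j : V, 3 / p * (e i + e j) :=
        Finset.sum_le_sum fun i _ => Finset.sum_le_sum_of_subset_of_nonneg
          (Finset.subset_univ _) fun j _ _ =>
            mul_nonneg (by positivity) (add_nonneg (he0 i) (he0 j))
      have e2 : ∑ i : V, ∑ j : V, 3 / p * (e i + e j) =
          Fintype.card V * (6 / p * ∑ i, e i) := by
        simp_rw [← Finset.mul_sum, Finset.sum_add_distrib, Finset.sum_const, ← Finset.smul_sum,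
          Finset.card_univ, nsmul_eq_mul]
        ring
      refine hall.trans (e2.le.trans (mul_le_mul_of_nonneg_left ?_ (Nat.cast_nonneg _)))
      have e3 : N ^ 2 / p * (9 / 16) = 6 / p * (N ^ 2 * (9 / 96)) := by ring
      rw [e3]
      refine mul_le_mul_of_nonneg_left (hsum.trans ?_) (by positivity)
      nlinarith [mul_nonneg (by linarith : 0 ≤ N - 4) (by linarith : 0 ≤ 3 * N - 4)]
    have hmono : ∀ B : ℝ, 9 / 16 ≤ B → (Fintype.card V : ℝ) * (N ^ 2 / p * (9 / 16)) ≤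
        Fintype.card V * (N ^ 2 / p * B) := fun B hB =>
      mul_le_mul_of_nonneg_left (mul_le_mul_of_nonneg_left hB (by positivity)) (Nat.cast_nonneg _)
    exact ⟨fun i j => 3 / p * (e i + e j),
      fun i j => mul_nonneg (by positivity) (add_nonneg (he0 i) (he0 j)),
      fun i j hij => far_pair_le_of_lt G h0 h1 hN0 hm hij,
      htot.trans (hmono _ (by norm_num)), fun _ => htot.trans (hmono _ (by norm_num))⟩

end FarSum

/-! ### Complete cluster-level randomization: pairs of near nodes -/

/-- The real-number core of the bound for near pairs in a component, where the excess `P - α` of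
either node may be used but only once. -/
theorem le_add_quarter {X g P P' α α' c : ℝ} (hc : 0 < c) (hα : 1 ≤ c * α) (hα' : 1 ≤ c * α')
    (hP : α ≤ P) (hP' : α' ≤ P') (hX : X ≤ g + (P - α)) (hX' : X ≤ g + (P' - α')) :
    X ≤ (g / (P * P') + c / 4) * (P * P') := by
  have a0 : 0 < α := by by_contra! h; nlinarith
  have a0' : 0 < α' := by by_contra! h; nlinarith
  have p0 : 0 < P := by linarith
  have p0' : 0 < P' := by linarith
  set v := (P - α) / P with hv
  set w := (P' - α') / P' with hw
  have ev : P - α = v * P := by rw [hv]; field_simp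
  have ew : P' - α' = w * P' := by rw [hw]; field_simp
  have v0 : 0 ≤ v := div_nonneg (by linarith) p0.le
  have w0 : 0 ≤ w := div_nonneg (by linarith) p0'.le
  have v1 : v ≤ 1 := by rw [hv, div_le_one p0]; linarith
  have w1 : w ≤ 1 := by rw [hw, div_le_one p0']; linarith
  have e : (g / (P * P') + c / 4) * (P * P') = g + c * (P * P') / 4 := by field_simp
  rw [e]
  have hpp : 0 < c * (P * P') := by positivity
  have h4 : (v * (1 - v) + w * (1 - w)) / 2 ≤ 1 / 4 := by
    nlinarith [sq_nonneg (v - 1 / 2), sq_nonneg (w - 1 / 2)]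
  rcases min_mul_one_sub_le v0 v1 w0 w1 with h | h
  · have h1 := mul_le_mul_of_nonneg_left hα' (sub_nonneg.2 hP)
    have h2 : (P - α) * (c * α') = v * (1 - w) * (c * (P * P')) := by
      have : α' = (1 - w) * P' := by rw [sub_mul, ← ew]; ring
      rw [ev, this]; ring
    have h3 := mul_le_mul_of_nonneg_right (h.trans h4) hpp.le
    linarith
  · have h1 := mul_le_mul_of_nonneg_left hα (sub_nonneg.2 hP')
    have h2 : (P' - α') * (c * α) = w * (1 - v) * (c * (P * P')) := by
      have : α = (1 - v) * P := by rw [sub_mul, ← ev]; ring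
      rw [ew, this]; ring
    have h3 := mul_le_mul_of_nonneg_right (h.trans h4) hpp.le
    linarith

section Near

universe u

variable {V : Type u} [Fintype V] (G : SimpleGraph V) {p : ℝ}

/-- The conditional exposure probability off the event that node `i` has the largest number in its
2-hop ball. -/
noncomputable def restPart (p : ℝ) (i : V) (x : V → ℝ) : ℝ :=
  condProb G p (hopBall G 1 i) x * (1 - localMax G i x)

theorem localMax_eq_zero_or_one (i : V) (x : V → ℝ) :
    (localMax G i x = 0 ∧ rank G x i ≠ 1) ∨ (localMax G i x = 1 ∧ rank G x i = 1) := by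
  by_cases h : rank G x i = 1
  · exact Or.inr ⟨localMax_of_rank G h, h⟩
  · exact Or.inl ⟨localMax_of_rank_ne G h, h⟩

theorem isUnitVariable_restPart [Nonempty V] (h0 : 0 ≤ p) (h1 : p < 1) (i : V) :
    IsUnitVariable (restPart G p i) := by
  have h : IsUnitVariable fun x : V → ℝ => 1 - localMax G i x :=
    IsUnitVariable.sub (F := fun _ => 1) ⟨measurable_const, fun _ => zero_le_one, fun _ => le_rfl⟩
      (isUnitVariable_localMax G i) (isUnitVariable_localMax G i).le_one
  exact (isUnitVariable_condProb G h0 h1 _).mul h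

/-- If node `i` is a local maximum, then its 1-hop ball lies in a single cluster. -/
theorem condProb_mul_localMax (h0 : 0 ≤ p) (h1 : p < 1) (i : V) (x : V → ℝ) :
    condProb G p (hopBall G 1 i) x * localMax G i x = p * localMax G i x := by
  have : Nonempty V := ⟨i⟩
  rcases localMax_eq_zero_or_one G i x with ⟨e, -⟩ | ⟨e, h⟩
  · rw [e, mul_zero, mul_zero]
  · rw [condProb, clusterHits_eq_one_of_rank G x h, completeProb_one h0 h1 (clusterCount_pos G x)]

theorem integral_restPart (h0 : 0 ≤ p) (h1 : p < 1) (i : V) :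
    ∫ x, restPart G p i x ∂uniformNumbers V =
      nodeProb G p i - p * (1 / (hopBall G 2 i).card) := by
  have : Nonempty V := ⟨i⟩
  rw [← integral_localMax, ← integral_const_mul, nodeProb,
    ← integral_sub (isUnitVariable_condProb G h0 h1 _).integrable
      ((isUnitVariable_localMax G i).integrable.const_mul p)]
  refine integral_congr_ae (Filter.Eventually.of_forall fun x => ?_)
  change condProb G p (hopBall G 1 i) x * (1 - localMax G i x) = _ - p * localMax G i x
  rw [← condProb_mul_localMax G h0 h1]
  ring

theorem le_nodeProb (h0 : 0 ≤ p) (h1 : p < 1) (i : V) :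
    p * (1 / (hopBall G 2 i).card) ≤ nodeProb G p i := by
  have : Nonempty V := ⟨i⟩
  have := (isUnitVariable_restPart G h0 h1 i).integral_nonneg (μ := uniformNumbers V)
  rw [integral_restPart G h0 h1] at this
  linarith

theorem one_le_mul_inv_card {N : ℝ} (h0 : 0 < p) {i : V} (hN : ((hopBall G 2 i).card : ℝ) ≤ N) :
    1 ≤ N / p * (p * (1 / ((hopBall G 2 i).card : ℝ))) := by
  have hc := one_le_hopBall_card G 2 i
  have e : N / p * (p * (1 / ((hopBall G 2 i).card : ℝ))) = N / (hopBall G 2 i).card := by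
    field_simp
  rw [e, le_div_iff₀ (by linarith), one_mul]
  exact hN

variable [DecidableEq V]

theorem treatProb_union_le (h0 : 0 ≤ p) (h1 : p < 1) (i j : V) :
    treatProb G (completeProb p) (hopBall G 1 i ∪ hopBall G 1 j) ≤ nodeProb G p i ∧
      treatProb G (completeProb p) (hopBall G 1 i ∪ hopBall G 1 j) ≤ nodeProb G p j := by
  have : Nonempty V := ⟨i⟩
  exact ⟨integral_mono (isUnitVariable_condProb G h0 h1 _).integrable
      (isUnitVariable_condProb G h0 h1 _).integrable
      fun x => condProb_mono G h0 h1 Finset.subset_union_left x,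
    integral_mono (isUnitVariable_condProb G h0 h1 _).integrable
      (isUnitVariable_condProb G h0 h1 _).integrable
      fun x => condProb_mono G h0 h1 Finset.subset_union_right x⟩

/-- If both nodes have the largest number in their 2-hop balls, then their clusters are distinct. -/
theorem condProb_union_mul_localMax_le (h0 : 0 ≤ p) (h1 : p < 1) {x : V → ℝ}
    (hx : Function.Injective x) {i j : V} (hij : j ≠ i) :
    condProb G p (hopBall G 1 i ∪ hopBall G 1 j) x * (localMax G i x * localMax G j x) ≤
      p ^ 2 * (localMax G i x * localMax G j x) := by
  have : Nonempty V := ⟨i⟩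
  rcases localMax_eq_zero_or_one G i x with ⟨ei, -⟩ | ⟨ei, hi⟩
  · simp [ei]
  rcases localMax_eq_zero_or_one G j x with ⟨ej, -⟩ | ⟨ej, hj⟩
  · simp [ej]
  rw [ei, ej, mul_one, mul_one, mul_one]
  refine (condProb_le_pow G h0 h1 _ x).trans (pow_le_pow_of_le_one h0 h1.le ?_)
  have hne : oneHopMax G x i ≠ oneHopMax G x j := by
    rw [oneHopMax_of_rank G x hi, oneHopMax_of_rank G x hj]
    exact fun e => hij (hx e).symm
  have hsub : ({oneHopMax G x i, oneHopMax G x j} : Finset ℝ) ⊆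
      (hopBall G 1 i ∪ hopBall G 1 j).image (oneHopMax G x) := by
    intro v hv
    rw [Finset.mem_insert, Finset.mem_singleton] at hv
    rcases hv with rfl | rfl
    · exact Finset.mem_image_of_mem _ (Finset.mem_union_left _ (self_mem_hopBall G 1 i))
    · exact Finset.mem_image_of_mem _ (Finset.mem_union_right _ (self_mem_hopBall G 1 j))
  have := Finset.card_le_card hsub
  rwa [Finset.card_pair hne] at this

/-- The normalized covariance of two distinct near nodes. For nodes within distance two, the events
of having the largest number in the 2-hop ball exclude each other; otherwise both happen with at
most twice the product of the probabilities. -/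
theorem near_pair_le {N : ℝ} (h0 : 0 < p) (h1 : p < 1)
    (hN : ∀ i, ((hopBall G 2 i).card : ℝ) ≤ N) {i j : V} (hij : j ≠ i) :
    treatProb G (completeProb p) (hopBall G 1 i ∪ hopBall G 1 j) ≤
      (N / (2 * p) + if j ∈ hopBall G 2 i then 0 else 2) * (nodeProb G p i * nodeProb G p j) := by
  have : Nonempty V := ⟨i⟩
  have hN0 : 0 < N := by linarith [one_le_hopBall_card G 2 i, hN i]
  have hU := isUnitVariable_condProb G h0.le h1 (hopBall G 1 i ∪ hopBall G 1 j)
  have hLL := (isUnitVariable_localMax G i).mul (isUnitVariable_localMax G j)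
  have hR := isUnitVariable_restPart G h0.le h1
  have hle := le_nodeProb G h0.le h1
  obtain ⟨hX1, hX2⟩ := treatProb_union_le G h0.le h1 i j
  have hXB := integral_le_linear (μ := uniformNumbers V) hU (hU.mul hLL) (hR i) (hR j) hU 1 1 0
    (Filter.Eventually.of_forall fun x => by
      have hi := condProb_mono G h0.le h1 (Finset.subset_union_left : hopBall G 1 i ⊆
        hopBall G 1 i ∪ hopBall G 1 j) x
      have hj := condProb_mono G h0.le h1 (Finset.subset_union_right : hopBall G 1 j ⊆
        hopBall G 1 i ∪ hopBall G 1 j) x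
      have c0 := hU.nonneg x
      unfold restPart
      rcases localMax_eq_zero_or_one G i x with ⟨ei, -⟩ | ⟨ei, -⟩ <;>
      rcases localMax_eq_zero_or_one G j x with ⟨ej, -⟩ | ⟨ej, -⟩ <;> rw [ei, ej] <;> linarith)
  rw [integral_restPart G h0.le h1, integral_restPart G h0.le h1] at hXB
  have key := le_of_excess (X := treatProb G (completeProb p) (hopBall G 1 i ∪ hopBall G 1 j))
    (c := N / p) (r := 1) (d := if j ∈ hopBall G 2 i then 0 else 2)
    (B := ∫ x, condProb G p (hopBall G 1 i ∪ hopBall G 1 j) x *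
      (localMax G i x * localMax G j x) ∂uniformNumbers V) (by positivity) zero_le_one
    (by split_ifs <;> norm_num) (one_le_mul_inv_card G h0 (hN i)) (one_le_mul_inv_card G h0 (hN j))
    (hle i) (hle j) (by rw [one_mul]; exact hX1) (by rw [one_mul]; exact hX2) ?_
    (hXB.trans (le_of_eq (by ring)))
  · have e : 1 * (N / p) / 2 = N / (2 * p) := by rw [one_mul]; field_simp
    rwa [e] at key
  · split_ifs with hj
    · rw [zero_mul]
      refine le_of_eq (integral_eq_zero_of_ae (Filter.Eventually.of_forall fun x => ?_))
      rcases localMax_eq_zero_or_one G i x with ⟨ei, -⟩ | ⟨ei, hi⟩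
      · simp [ei]
      · simp [localMax_of_rank_ne G (not_rank_eq_one G x hj hij hi)]
    · have h2 : ∫ x, condProb G p (hopBall G 1 i ∪ hopBall G 1 j) x *
          (localMax G i x * localMax G j x) ∂uniformNumbers V ≤
          p ^ 2 * ∫ x, localMax G i x * localMax G j x ∂uniformNumbers V := by
        rw [← integral_const_mul]
        refine MeasureTheory.integral_mono_ae (hU.mul hLL).integrable
          (hLL.integrable.const_mul _) ?_
        filter_upwards [ae_injective] with x hx
        exact condProb_union_mul_localMax_le G h0.le h1 hx hij
      refine h2.trans ((mul_le_mul_of_nonneg_left (integral_localMax_mul G hj)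
        (sq_nonneg p)).trans ?_)
      have h3 := mul_le_mul (hle i) (hle j) (by positivity)
        ((by positivity : (0 : ℝ) ≤ p * (1 / (hopBall G 2 i).card)).trans (hle i))
      refine le_trans (le_of_eq ?_) (mul_le_mul_of_nonneg_left h3 zero_le_two)
      ring

/-- The bound for two distinct nodes of a component in which all 2-hop balls are equal. -/
theorem near_pair_le_of_component {N : ℝ} (h0 : 0 < p) (h1 : p < 1)
    (hN : ∀ i, ((hopBall G 2 i).card : ℝ) ≤ N) {i j : V} (hij : j ≠ i) (hj : j ∈ hopBall G 2 i) :
    treatProb G (completeProb p) (hopBall G 1 i ∪ hopBall G 1 j) ≤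
      ((∫ x, restPart G p j x * localMax G i x ∂uniformNumbers V +
          ∫ x, restPart G p i x * localMax G j x ∂uniformNumbers V) /
            (nodeProb G p i * nodeProb G p j) + N / p / 4) *
        (nodeProb G p i * nodeProb G p j) := by
  have : Nonempty V := ⟨i⟩
  have hN0 : 0 < N := by linarith [one_le_hopBall_card G 2 i, hN i]
  have hU := isUnitVariable_condProb G h0.le h1 (hopBall G 1 i ∪ hopBall G 1 j)
  have hL := isUnitVariable_localMax G
  have hR := isUnitVariable_restPart G h0.le h1
  have hle := le_nodeProb G h0.le h1
  have hpt : ∀ x, condProb G p (hopBall G 1 i ∪ hopBall G 1 j) x ≤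
      restPart G p j x * localMax G i x + restPart G p i x * localMax G j x + restPart G p i x ∧
      condProb G p (hopBall G 1 i ∪ hopBall G 1 j) x ≤
      restPart G p j x * localMax G i x + restPart G p i x * localMax G j x + restPart G p j x := by
    intro x
    have hi := condProb_mono G h0.le h1 (Finset.subset_union_left : hopBall G 1 i ⊆
      hopBall G 1 i ∪ hopBall G 1 j) x
    have hj' := condProb_mono G h0.le h1 (Finset.subset_union_right : hopBall G 1 j ⊆
      hopBall G 1 i ∪ hopBall G 1 j) x
    have c0 := hU.nonneg x
    unfold restPart
    rcases localMax_eq_zero_or_one G i x with ⟨ei, -⟩ | ⟨ei, ri⟩ <;>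
    rcases localMax_eq_zero_or_one G j x with ⟨ej, -⟩ | ⟨ej, rj⟩
    · rw [ei, ej]; constructor <;> linarith
    · rw [ei, ej]; constructor <;> linarith
    · rw [ei, ej]; constructor <;> linarith
    · exact absurd rj (not_rank_eq_one G x hj hij ri)
  have hX := integral_le_linear (μ := uniformNumbers V) hU ((hR j).mul (hL i)) ((hR i).mul (hL j))
    (hR i) hU 1 1 0 (Filter.Eventually.of_forall fun x => by linarith [(hpt x).1])
  have hX' := integral_le_linear (μ := uniformNumbers V) hU ((hR j).mul (hL i)) ((hR i).mul (hL j))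
    (hR j) hU 1 1 0 (Filter.Eventually.of_forall fun x => by linarith [(hpt x).2])
  rw [integral_restPart G h0.le h1] at hX hX'
  exact le_add_quarter (by positivity) (one_le_mul_inv_card G h0 (hN i))
    (one_le_mul_inv_card G h0 (hN j)) (hle i) (hle j) (hX.trans (le_of_eq (by ring)))
    (hX'.trans (le_of_eq (by ring)))

end Near

section NearSum

universe u

variable {V : Type u} [Fintype V] (G : SimpleGraph V) {p : ℝ}

/-- If all 2-hop balls of a component are equal, then the local maxima of the component exclude each
other. -/
theorem sum_integral_restPart_mul_le (h0 : 0 ≤ p) (h1 : p < 1)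
    (hB : ∀ i, hopBall G 4 i = hopBall G 2 i) (i : V) :
    ∑ j ∈ hopBall G 2 i, ∫ x, restPart G p i x * localMax G j x ∂uniformNumbers V ≤
      ∫ x, restPart G p i x ∂uniformNumbers V := by
  have : Nonempty V := ⟨i⟩
  have hR := isUnitVariable_restPart G h0 h1 i
  have hRL := fun j => hR.mul (isUnitVariable_localMax G j)
  rw [← integral_finsetSum _ fun j _ => (hRL j).integrable]
  refine integral_mono (integrable_finsetSum _ fun j _ => (hRL j).integrable) hR.integrable
    fun x => ?_
  change ∑ j ∈ hopBall G 2 i, restPart G p i x * localMax G j x ≤ restPart G p i x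
  rw [← Finset.mul_sum]
  refine mul_le_of_le_one_right (hR.nonneg x) ?_
  by_cases h : ∃ k ∈ hopBall G 2 i, rank G x k = 1
  · obtain ⟨k, hk, hr⟩ := h
    rw [Finset.sum_eq_single_of_mem k hk, localMax_of_rank G hr]
    intro j hj hjk
    refine localMax_of_rank_ne G (not_rank_eq_one G x ?_ hjk hr)
    rw [← hB k]
    exact mem_hopBall_add G ((mem_hopBall_comm G).1 hk) hj
  · push Not at h
    rw [Finset.sum_eq_zero fun j hj => localMax_of_rank_ne G (h j hj)]
    exact zero_le_one

variable [DecidableEq V]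

theorem treatProb_union_self (i : V) :
    treatProb G (completeProb p) (hopBall G 1 i ∪ hopBall G 1 i) = nodeProb G p i := by
  rw [Finset.union_self]
  rfl

/-- The near pairs of a graph in which the 2-hop balls are the components. The excess of `P i` over
`p / |B_2(i)|` is charged once by the pairs `(i, j)` and once by the pairs `(j, i)`, because at most
one node of a component is a local maximum. -/
theorem exists_near_bound_of_component {N : ℝ} (h0 : 0 < p) (h1 : p < 1)
    (hN : ∀ i, ((hopBall G 2 i).card : ℝ) ≤ N) (hB : ∀ i, hopBall G 4 i = hopBall G 2 i) :
    ∃ U : V → V → ℝ, (∀ i j, 0 ≤ U i j) ∧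
      (∀ i j, j ∈ hopBall G 4 i →
        treatProb G (completeProb p) (hopBall G 1 i ∪ hopBall G 1 j) -
          nodeProb G p i * nodeProb G p j ≤ U i j * (nodeProb G p i * nodeProb G p j)) ∧
      ∑ i, ∑ j ∈ hopBall G 4 i, U i j ≤ Fintype.card V * (N / p * (2 + N / 4)) := by
  rcases isEmpty_or_nonempty V with hV | hV
  · exact ⟨fun _ _ => 0, fun _ _ => le_rfl, fun i => hV.elim i, by simp⟩
  have hc := fun i => one_le_hopBall_card G 2 i
  have hN0 : 0 < N := by
    linarith [hc (Classical.arbitrary V), hN (Classical.arbitrary V)]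
  have hR := isUnitVariable_restPart G h0.le h1
  have hL := isUnitVariable_localMax G
  have hle := le_nodeProb G h0.le h1
  have hα := fun i => one_le_mul_inv_card G h0 (hN i)
  have hα0 : ∀ i, 0 < p * (1 / ((hopBall G 2 i).card : ℝ)) := fun i => by
    have := hc i
    positivity
  have hP0 : ∀ i, 0 < nodeProb G p i := fun i => (hα0 i).trans_le (hle i)
  set g : V → V → ℝ := fun i j => ∫ x, restPart G p i x * localMax G j x ∂uniformNumbers V with hg
  have hg0 : ∀ i j, 0 ≤ g i j := fun i j => ((hR i).mul (hL j)).integral_nonneg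
  set a : V → ℝ := fun i => p * (1 / ((hopBall G 2 i).card : ℝ)) / nodeProb G p i with ha
  have ha0 : ∀ i, 0 ≤ a i := fun i => (div_pos (hα0 i) (hP0 i)).le
  have ha1 : ∀ i, 1 ≤ N / p * a i * nodeProb G p i := by
    intro i
    refine (hα i).trans (le_of_eq ?_)
    simp only [ha]
    have := (hP0 i).ne'
    field_simp
  have hNp : 0 < N / p := by positivity
  refine ⟨fun i j => N / p * (g j i / nodeProb G p j + g i j / nodeProb G p i + 1 / 4 +
    if j = i then a i else 0), fun i j => ?_, fun i j hj => ?_, ?_⟩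
  · have := hg0 i j
    have := hg0 j i
    have := (hP0 i).le
    have := (hP0 j).le
    have := ha0 i
    dsimp only
    split_ifs <;> positivity
  · have hPP := mul_pos (hP0 i) (hP0 j)
    dsimp only
    refine le_trans (sub_le_self _ hPP.le) ?_
    by_cases hij : j = i
    · subst hij
      rw [treatProb_union_self, if_pos rfl]
      have h2 : 0 ≤ g j j / nodeProb G p j := div_nonneg (hg0 j j) (hP0 j).le
      calc nodeProb G p j ≤ N / p * a j * nodeProb G p j * nodeProb G p j :=
            le_mul_of_one_le_left (hP0 j).le (ha1 j)
        _ = N / p * a j * (nodeProb G p j * nodeProb G p j) := by ring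
        _ ≤ _ := by
            refine mul_le_mul_of_nonneg_right (mul_le_mul_of_nonneg_left ?_ hNp.le) hPP.le
            linarith
    · rw [if_neg hij]
      refine (near_pair_le_of_component G h0 h1 hN hij (hB i ▸ hj)).trans
        (mul_le_mul_of_nonneg_right ?_ hPP.le)
      change (g j i + g i j) / _ + N / p / 4 ≤ _
      have key : ∀ k l, g k l / (nodeProb G p k * nodeProb G p l) ≤
          N / p * (g k l / nodeProb G p k) := by
        intro k l
        have h3 : 1 / nodeProb G p l ≤ N / p := by
          rw [div_le_iff₀ (hP0 l)]
          exact (hα l).trans (mul_le_mul_of_nonneg_left (hle l) hNp.le)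
        have h4 := mul_le_mul_of_nonneg_left h3 (div_nonneg (hg0 k l) (hP0 k).le)
        refine le_trans (le_of_eq ?_) (h4.trans (le_of_eq (mul_comm _ _)))
        rw [div_mul_div_comm, mul_one]
      have k1 := key i j
      have k2 := key j i
      rw [mul_comm (nodeProb G p j)] at k2
      rw [add_div]
      linarith
  · have hsum : ∀ i, ∑ j ∈ hopBall G 4 i, g i j / nodeProb G p i ≤ 1 - a i := by
      intro i
      rw [← Finset.sum_div, hB i, div_le_iff₀ (hP0 i)]
      refine (sum_integral_restPart_mul_le G h0.le h1 hB i).trans (le_of_eq ?_)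
      rw [integral_restPart G h0.le h1]
      simp only [ha]
      have := (hP0 i).ne'
      field_simp
    have hsymm : ∑ i, ∑ j ∈ hopBall G 4 i, g j i / nodeProb G p j =
        ∑ i, ∑ j ∈ hopBall G 4 i, g i j / nodeProb G p i :=
      Finset.sum_comm' fun i j => by simp [mem_hopBall_comm G (i := i)]
    have hdiag : ∀ i, ∑ j ∈ hopBall G 4 i, (if j = i then a i else 0) = a i := fun i => by
      rw [Finset.sum_ite_eq', if_pos (self_mem_hopBall G 4 i)]
    have e : ∑ i, ∑ j ∈ hopBall G 4 i, (N / p * (g j i / nodeProb G p j + g i j / nodeProb G p i +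
        1 / 4 + if j = i then a i else 0)) =
        N / p * ∑ i, (2 * ∑ j ∈ hopBall G 4 i, g i j / nodeProb G p i +
          ((hopBall G 4 i).card : ℝ) * (1 / 4) + a i) := by
      simp only [← Finset.mul_sum, Finset.sum_add_distrib, hsymm, hdiag, Finset.sum_const,
        nsmul_eq_mul]
      ring
    rw [e]
    have h5 : ∑ i : V, (2 * ∑ j ∈ hopBall G 4 i, g i j / nodeProb G p i +
        ((hopBall G 4 i).card : ℝ) * (1 / 4) + a i) ≤ ∑ _i : V, (2 + N / 4) := by
      refine Finset.sum_le_sum fun i _ => ?_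
      have := hsum i
      have := ha0 i
      have := hN i
      rw [hB i] at *
      linarith
    refine (mul_le_mul_of_nonneg_left h5 hNp.le).trans (le_of_eq ?_)
    rw [Finset.sum_const, nsmul_eq_mul, Finset.card_univ]
    ring

/-- The near pairs in general: pairs at distance `1` or `2` gain `2` against the others, since their
nodes are not both local maxima. -/
theorem exists_near_bound {κ N : ℝ} (h0 : 0 < p) (h1 : p < 1) (hκ : 1 ≤ κ)
    (hN : ∀ i, ((hopBall G 2 i).card : ℝ) ≤ N) (hN4 : 4 ≤ N)
    (hB : ∀ i, ((hopBall G 4 i).card : ℝ) ≤ κ ^ 2 * (hopBall G 2 i).card) :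
    ∃ U : V → V → ℝ, (∀ i j, 0 ≤ U i j) ∧
      (∀ i j, j ∈ hopBall G 4 i →
        treatProb G (completeProb p) (hopBall G 1 i ∪ hopBall G 1 j) -
          nodeProb G p i * nodeProb G p j ≤ U i j * (nodeProb G p i * nodeProb G p j)) ∧
      ∑ i, ∑ j ∈ hopBall G 4 i, U i j ≤
        Fintype.card V * (N * (κ ^ 2 * (N / (2 * p) + 1) - 2) + N / (2 * p)) := by
  have hNp : 2 ≤ N / (2 * p) := by
    rw [le_div_iff₀ (by linarith)]; linarith
  have hle := le_nodeProb G h0.le h1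
  have hα := fun i => one_le_mul_inv_card G h0 (hN i)
  refine ⟨fun i j => N / (2 * p) + 1 - (if j ∈ hopBall G 2 i then 2 else 0) +
    if j = i then N / (2 * p) else 0, fun i j => ?_, fun i j _ => ?_, ?_⟩
  · dsimp only
    split_ifs <;> linarith
  · dsimp only
    by_cases hij : j = i
    · subst hij
      rw [treatProb_union_self, if_pos rfl, if_pos (self_mem_hopBall G 2 j)]
      have e : N / p = 2 * (N / (2 * p)) := by field_simp
      have hP : 0 ≤ nodeProb G p j :=
        le_trans (by positivity) (hle j)
      have h2 := (hα j).trans (mul_le_mul_of_nonneg_left (hle j) (by positivity))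
      rw [e] at h2
      have := mul_le_mul_of_nonneg_right h2 hP
      linarith
    · rw [if_neg hij, add_zero]
      have := near_pair_le G h0 h1 hN hij
      split_ifs at this ⊢ <;> linarith
  · rw [← Finset.card_univ, ← nsmul_eq_mul]
    refine Finset.sum_le_card_nsmul _ _ _ fun i _ => ?_
    have e : ∑ j ∈ hopBall G 4 i, (if j ∈ hopBall G 2 i then (2 : ℝ) else 0) =
        (hopBall G 2 i).card * 2 := by
      rw [Finset.sum_ite_mem, Finset.inter_eq_right.2 (hopBall_mono G (by norm_num) i),
        Finset.sum_const, nsmul_eq_mul]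
    rw [Finset.sum_add_distrib, Finset.sum_sub_distrib, e, Finset.sum_ite_eq',
      if_pos (self_mem_hopBall G 4 i), Finset.sum_const, nsmul_eq_mul]
    have k1 := mul_le_mul_of_nonneg_right (hB i) (by linarith : 0 ≤ N / (2 * p) + 1)
    have k2 : 0 ≤ κ ^ 2 * (N / (2 * p) + 1) - 2 := by nlinarith
    have k3 := mul_le_mul_of_nonneg_right (hN i) k2
    linarith

end NearSum

/-! ### Complete cluster-level randomization: all pairs -/

/-- The numerical balance of near and far pairs if some 2-hop ball is not a component. -/
theorem near_add_far_le_of_two_le_cube {κ D p : ℝ} (h0 : 0 < p) (h1 : p < 1) (hκ0 : 0 < κ)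
    (hκ : 2 ≤ κ ^ 3) (hD : (D = 3 ∧ 4 / 3 ≤ κ) ∨ 4 ≤ D) :
    κ * D * (κ ^ 2 * (κ * D / (2 * p) + 1) - 2) + κ * D / (2 * p) + (κ * D) ^ 2 / p * 0.69 ≤
      κ ^ 2 * (κ * D) ^ 2 * p⁻¹ := by
  -- `1.2595` is slightly below the cube root of `2`
  have hκ' : 1.2595 ≤ κ := by
    by_contra! h
    have := pow_lt_pow_left₀ h hκ0.le (three_ne_zero)
    norm_num at this
    linarith
  have hκ2 : 1.586 ≤ κ ^ 2 := by nlinarith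
  have hN4 : 4 ≤ κ * D := by
    rcases hD with ⟨rfl, h⟩ | h
    · linarith
    · nlinarith
  have key : p * (κ ^ 2 - 2) + 1 / 2 + 0.69 * (κ * D) ≤ κ ^ 2 * (κ * D) / 2 := by
    rcases le_or_gt 2 (κ ^ 2) with h | h
    · have a1 := mul_le_mul_of_nonneg_right h1.le (sub_nonneg.2 h)
      nlinarith
    · have a1 : p * (κ ^ 2 - 2) ≤ 0 := by nlinarith
      rcases hD with ⟨rfl, h3⟩ | h3
      · have : 16 / 9 ≤ κ ^ 2 := by nlinarith
        nlinarith
      · have : 5.038 ≤ κ * D := by nlinarith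
        nlinarith
  set N := κ * D
  have e : κ ^ 2 * N ^ 2 * p⁻¹ - (N * (κ ^ 2 * (N / (2 * p) + 1) - 2) + N / (2 * p) +
      N ^ 2 / p * 0.69) =
      N / p * (κ ^ 2 * N / 2 - (p * (κ ^ 2 - 2) + 1 / 2 + 0.69 * N)) := by
    field_simp
    ring
  have : 0 ≤ N / p * (κ ^ 2 * N / 2 - (p * (κ ^ 2 - 2) + 1 / 2 + 0.69 * N)) :=
    mul_nonneg (by positivity) (sub_nonneg.2 key)
  linarith

/-- The numerical balance of near and far pairs if all 2-hop balls are components. -/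
theorem near_add_far_le_of_component {κ D p : ℝ} (h0 : 0 < p) (hD : 1 ≤ D)
    (hκ : 1 + 1 / D ≤ κ) :
    κ * D / p * (2 + κ * D / 4) + (κ * D) ^ 2 / p * (3 / 4) ≤ κ ^ 2 * (κ * D) ^ 2 * p⁻¹ := by
  have hD0 : 0 < D := by linarith
  have h2 : D + 1 ≤ κ * D := by
    have := mul_le_mul_of_nonneg_right hκ hD0.le
    rwa [add_mul, one_div_mul_cancel hD0.ne', one_mul] at this
  have hκ1 : 1 ≤ κ := by
    have : 0 < 1 / D := by positivity
    linarith
  have key : 2 + κ * D ≤ κ ^ 2 * (κ * D) := by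
    have h3 : 2 * κ - 1 ≤ κ ^ 2 := by nlinarith [sq_nonneg (κ - 1)]
    have h4 : κ * D + κ ≤ κ ^ 2 * D := by nlinarith
    have h5 := mul_le_mul_of_nonneg_left h4 (by linarith : 0 ≤ κ)
    nlinarith
  set N := κ * D
  have hN : 0 < N := by linarith
  have e : κ ^ 2 * N ^ 2 * p⁻¹ - (N / p * (2 + N / 4) + N ^ 2 / p * (3 / 4)) =
      N / p * (κ ^ 2 * N - (2 + N)) := by
    field_simp
    ring
  have : 0 ≤ N / p * (κ ^ 2 * N - (2 + N)) := mul_nonneg (by positivity) (sub_nonneg.2 key)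
  linarith

section Complete

universe u

variable {V : Type u} [Fintype V] (G : SimpleGraph V) {p : ℝ}

theorem completeProb_one_prob {K a : ℕ} (ha : a ≤ K) : completeProb 1 K a = 1 := by
  have hK : (K.descFactorial a : ℝ) ≠ 0 := by
    exact_mod_cast (Nat.descFactorial_eq_zero_iff_lt.not.2 (by omega))
  unfold completeProb
  rw [Finset.sum_eq_single_of_mem K (Finset.self_mem_range_succ K)]
  · rw [div_self hK, mul_one, one_mul, roundingProb, Nat.floor_natCast, if_pos rfl, sub_self,
      sub_zero]
  · intro m _ hm
    rw [one_mul, roundingProb, Nat.floor_natCast, if_neg hm, sub_self, ite_self, zero_mul]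

variable [DecidableEq V] [DecidableRel G.Adj]

theorem exists_bound_of_near_far {κ cn cf : ℝ}
    (hnear : ∃ U : V → V → ℝ, (∀ i j, 0 ≤ U i j) ∧
      (∀ i j, j ∈ hopBall G 4 i →
        treatProb G (completeProb p) (hopBall G 1 i ∪ hopBall G 1 j) -
          nodeProb G p i * nodeProb G p j ≤ U i j * (nodeProb G p i * nodeProb G p j)) ∧
      ∑ i, ∑ j ∈ hopBall G 4 i, U i j ≤ Fintype.card V * cn)
    (hfar : ∃ U : V → V → ℝ, (∀ i j, 0 ≤ U i j) ∧
      (∀ i j, j ∉ hopBall G 4 i →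
        treatProb G (completeProb p) (hopBall G 1 i ∪ hopBall G 1 j) -
          nodeProb G p i * nodeProb G p j ≤ U i j * (nodeProb G p i * nodeProb G p j)) ∧
      ∑ i, ∑ j ∈ (hopBall G 4 i)ᶜ, U i j ≤ Fintype.card V * cf)
    (hc : cn + cf ≤ κ ^ 2 * (κ * (G.maxDegree + 1)) ^ 2 * p⁻¹) :
    ∃ U : V → V → ℝ, (∀ i j, 0 ≤ U i j) ∧
      (∀ i j, treatProb G (completeProb p) (hopBall G 1 i ∪ hopBall G 1 j) -
        treatProb G (completeProb p) (hopBall G 1 i) *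
          treatProb G (completeProb p) (hopBall G 1 j) ≤
        U i j * (treatProb G (completeProb p) (hopBall G 1 i) *
          treatProb G (completeProb p) (hopBall G 1 j))) ∧
      ∑ i, ∑ j, U i j ≤ Fintype.card V * (κ ^ 2 * (κ * (G.maxDegree + 1)) ^ 2 * p⁻¹) := by
  obtain ⟨U, hU0, hU, hUs⟩ := hnear
  obtain ⟨W, hW0, hW, hWs⟩ := hfar
  refine ⟨fun i j => if j ∈ hopBall G 4 i then U i j else W i j, fun i j => ?_, fun i j => ?_, ?_⟩
  · dsimp only
    split_ifs
    exacts [hU0 i j, hW0 i j]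
  · change _ - nodeProb G p i * nodeProb G p j ≤ _ * (nodeProb G p i * nodeProb G p j)
    dsimp only
    split_ifs with h
    exacts [hU i j h, hW i j h]
  · have e : ∀ i, ∑ j, (if j ∈ hopBall G 4 i then U i j else W i j) =
        ∑ j ∈ hopBall G 4 i, U i j + ∑ j ∈ (hopBall G 4 i)ᶜ, W i j := by
      intro i
      rw [← Finset.sum_add_sum_compl (hopBall G 4 i)]
      congr 1
      · exact Finset.sum_congr rfl fun j hj => if_pos hj
      · exact Finset.sum_congr rfl fun j hj => if_neg (Finset.mem_compl.1 hj)
    simp only [e, Finset.sum_add_distrib]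
    refine (add_le_add hUs hWs).trans ?_
    rw [← mul_add]
    exact mul_le_mul_of_nonneg_left hc (Nat.cast_nonneg _)

/-- The bound for complete randomization, where disjoint unions of cliques, graphs whose 2-hop balls
are components, and all other graphs need different estimates. -/
theorem exists_bound_complete {κ : ℝ} (hκ : RestrictedGrowth G κ) (h0 : 0 < p) (hp1 : p ≤ 1) :
    ∃ U : V → V → ℝ, (∀ i j, 0 ≤ U i j) ∧
      (∀ i j, treatProb G (completeProb p) (hopBall G 1 i ∪ hopBall G 1 j) -
        treatProb G (completeProb p) (hopBall G 1 i) *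
          treatProb G (completeProb p) (hopBall G 1 j) ≤
        U i j * (treatProb G (completeProb p) (hopBall G 1 i) *
          treatProb G (completeProb p) (hopBall G 1 j))) ∧
      ∑ i, ∑ j, U i j ≤ Fintype.card V * (κ ^ 2 * (κ * (G.maxDegree + 1)) ^ 2 * p⁻¹) := by
  rcases isEmpty_or_nonempty V with hV | hV
  · exact ⟨fun _ _ => 0, fun _ _ => le_rfl, fun i => hV.elim i, by simp⟩
  rcases hp1.eq_or_lt with rfl | h1
  -- every cluster is treated
  · have e : ∀ S : Finset V, treatProb G (completeProb 1) S = 1 := by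
      intro S
      have : ∀ x : V → ℝ, completeProb 1 (clusterCount G x) (clusterHits G x S) = 1 := fun x =>
        completeProb_one_prob (clusterHits_le_clusterCount G x S)
      simp only [treatProb, this]
      simp
    refine ⟨fun _ _ => 0, fun _ _ => le_rfl, fun i j => by simp [e], ?_⟩
    simp only [Finset.sum_const_zero]
    positivity
  set D : ℝ := G.maxDegree + 1 with hD
  have hD1 : 1 ≤ D := by simp [hD]
  have hκ1 := hκ.one_le
  have hN := hκ.card_two_le
  rw [← hD] at hN
  by_cases hcl : ∀ i, hopBall G 2 i = hopBall G 1 i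
  -- disjoint unions of cliques: all exposure probabilities are `p`
  · have hone : ∀ i x, condProb G p (hopBall G 1 i) x = p := fun i x => by
      rw [condProb, clusterHits_eq_one_of_clique G hcl,
        completeProb_one h0.le h1 (clusterCount_pos G x)]
    have hP : ∀ i, nodeProb G p i = p := fun i => by simp [nodeProb, hone]
    refine exists_bound_of_near_far G (cn := κ ^ 2 * (κ * D) * (1 / p)) (cf := 0)
      ⟨fun _ _ => 1 / p, fun _ _ => by positivity, fun i j _ => ?_, ?_⟩
      ⟨fun _ _ => 0, fun _ _ => le_rfl, fun i j hj => ?_, by simp⟩ ?_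
    · have := (treatProb_union_le G h0.le h1 i j).1
      rw [hP] at this
      rw [hP, hP, one_div, inv_mul_cancel_left₀ h0.ne']
      linarith [mul_pos h0 h0]
    · rw [← Finset.card_univ, ← nsmul_eq_mul]
      refine Finset.sum_le_card_nsmul _ _ _ fun i _ => ?_
      rw [Finset.sum_const, nsmul_eq_mul]
      refine mul_le_mul_of_nonneg_right ?_ (by positivity)
      exact (hκ.card_four_le i).trans (mul_le_mul_of_nonneg_left (hN i) (sq_nonneg κ))
    · rw [zero_mul, sub_nonpos, hP, hP]
      have hc : ∫ _x : V → ℝ, p * p ∂uniformNumbers V = p * p := by simp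
      rw [← hc]
      refine MeasureTheory.integral_mono_ae (isUnitVariable_condProb G h0.le h1 _).integrable
        (integrable_const _) ?_
      filter_upwards [ae_injective] with x hx
      have := condProb_union_le_of_far G h0.le h1 hx hj
      rwa [hone, hone] at this
    · have hN1 : 1 ≤ κ * D := one_le_mul_of_one_le_of_one_le hκ1 hD1
      rw [add_zero, one_div]
      refine mul_le_mul_of_nonneg_right (mul_le_mul_of_nonneg_left ?_ (sq_nonneg κ))
        (by positivity)
      exact le_self_pow₀ hN1 two_ne_zero
  · push Not at hcl
    obtain ⟨hκD, hd⟩ := hκ.le_of_not_clique hcl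
    rw [← hD] at hκD
    have hD3 : (3 : ℝ) ≤ D := by
      have : (2 : ℝ) ≤ G.maxDegree := by exact_mod_cast hd
      linarith
    have hN4 : 4 ≤ κ * D := by
      have := mul_le_mul_of_nonneg_right hκD (by linarith : 0 ≤ D)
      rw [add_mul, one_div_mul_cancel (by linarith), one_mul] at this
      linarith
    obtain ⟨W, hW0, hW, hWs, hWs'⟩ := exists_far_bound G hκ h0 h1 hN4
    by_cases hB : ∀ i, hopBall G 4 i = hopBall G 2 i
    · exact exists_bound_of_near_far G (exists_near_bound_of_component G h0 h1 hN hB)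
        ⟨W, hW0, hW, hWs⟩ (near_add_far_le_of_component h0 hD1 hκD)
    · push Not at hB
      have hκ3 := hκ.two_le_cube hB
      have hκ54 : 5 / 4 ≤ κ := by
        by_contra! h
        have := pow_lt_pow_left₀ h (by linarith) three_ne_zero
        norm_num at this
        linarith
      refine exists_bound_of_near_far G (exists_near_bound G h0 h1 hκ1 hN hN4 hκ.card_four_le)
        ⟨W, hW0, hW, hWs' hκ54⟩ (near_add_far_le_of_two_le_cube h0 h1 (by linarith) hκ3 ?_)
      rcases hd.eq_or_lt with h2 | h2
      · left
        have e : D = 3 := by rw [hD, ← h2]; norm_num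
        refine ⟨e, ?_⟩
        rw [e] at hκD
        linarith
      · right
        have : (3 : ℝ) ≤ G.maxDegree := by exact_mod_cast h2
        linarith

end Complete

end RGCR

theorem mainTheorem5 {V : Type*} [Fintype V] (G : SimpleGraph V) [DecidableRel G.Adj]
    (κ : ℝ) (hκ : RGCR.RestrictedGrowth G κ)
    (p : unitInterval) (hp : 0 < p)
    (Ybar : ℝ) (Y : V → (V → Bool) → ℝ) (hY : RGCR.ExposureModel G Y)
    (hbound : ∀ i z, Y i z ∈ Set.Icc 0 Ybar) :
    RGCR.htVariance G
        (RGCR.design (RGCR.oneHopMaxLaw G) (RGCR.independentRandomization p)) Y ≤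
      1 / (Fintype.card V : ℝ) *
        (Ybar ^ 2 * ((G.maxDegree : ℝ) + 1) ^ 2 * κ ^ 4 * (p : ℝ)⁻¹) ∧
    RGCR.htVariance G
        (RGCR.design (RGCR.oneHopMaxLaw G) (RGCR.completeRandomization p)) Y ≤
      1 / (Fintype.card V : ℝ) *
        (Ybar ^ 2 * ((G.maxDegree : ℝ) + 1) ^ 2 * κ ^ 4 * (p : ℝ)⁻¹) := by
  classical
  have h0 : (0 : ℝ) < p := hp
  constructor
  · obtain ⟨U, hU0, hU, hsum⟩ := RGCR.exists_bound_independent G hκ h0 p.2.2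
    exact RGCR.htVariance_le_of_sum_le G (RGCR.hasTreatmentProb_independent p)
      (fun _ _ => pow_nonneg h0.le _) hY hbound hU0 hU hsum
  · obtain ⟨U, hU0, hU, hsum⟩ := RGCR.exists_bound_complete G hκ h0 p.2.2
    exact RGCR.htVariance_le_of_sum_le G (RGCR.hasTreatmentProb_complete p)
      (fun K a => RGCR.completeProb_nonneg h0.le K a) hY hbound hU0 hU hsum
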